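/- Let $n\ge 1$. Let $q(n)$ be the maximum number $k$ such that every family $\mathcal S$ of $n$ disjoint line segments in the plane, whose $2n$ endpoints are in convex position, admits an alternating path compatible with $\mathcal S$ going through $k$ segments of $\mathcal S$. Here an alternating path is a simple polygonal chain in which every other edge is a segment of $\mathcal S$, and it is compatible with $\mathcal S$ if it does not cross any segment of $\mathcal S$ that is not in the chain. This maximum exists, and it has the following values. For $1\le n\le 170$: $q(n)=n$ for $1\le n\le 4$; $q(n)=5$ for $5\le n\le 6$; $q(n)=6$ for $7\le n\le 8$; $q(n)=7$ for $9\le n\le 10$; $q(n)=8$ for $11\le n\le 12$; $q(n)=9$ for $13\le n\le 15$; $q(n)=10$ for $16\le n\le 20$; $q(n)=11$ for $21\le n\le 25$; $q(n)=12$ for $26\le n\le 30$; $q(n)=13$ for $31\le n\le 35$; $q(n)=14$ for $36\le n\le 44$; $q(n)=15$ for $45\le n\le 55$; $q(n)=16$ for $56\le n\le 66$; $q(n)=17$ for $67\le n\le 80$; $q(n)=18$ for $81\le n\le 96$; $q(n)=19$ for $97\le n\le 115$; $q(n)=20$ for $116\le n\le 138$; $q(n)=21$ for $139\le n\le 170$.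 For $n\ge 171$, $q(n)=\max\{q_r(n)\mid 0\le r\le 5\}$, where \begin{align*} q_0(n)&=6\left\lfloor\tfrac16\left\lceil 6\log_3\left(\tfrac{2n}{55}+\tfrac1{11}\right)+11\right\rceil\right\rfloor,\\ q_1(n)&=6\left\lfloor\tfrac16\left\lceil 6\log_3\left(\tfrac{n}{33}+\tfrac1{11}\right)+11\right\rceil\right\rfloor+1,\\ q_2(n)&=6\left\lfloor\tfrac16\left\lceil 6\log_3\left(\tfrac{2n}{235}+\tfrac1{47}\right)+17\right\rceil\right\rfloor+2,\\ q_3(n)&=6\left\lfloor\tfrac16\left\lceil 6\log_3\left(\tfrac{n}{141}+\tfrac1{47}\right)+17\right\rceil\right\rfloor+3,\\ q_4(n)&=6\left\lfloor\tfrac16\left\lceil 6\log_3\left(\tfrac{2n}{115}+\tfrac1{23}\right)+11\right\rceil\right\rfloor+4,\\ q_5(n)&=6\left\lfloor\tfrac16\left\lceil 6\log_3\left(\tfrac{n}{69}+\tfrac1{23}\right)+11\right\rceil\right\rfloor+5. \end{align*} Moreover, for every $n\ge 1$, $q(n)$ is also the maximum number $k$ such that every tree with $n$ edges contains a caterpillar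 with $k$ edges as a subgraph (a caterpillar is a tree whose non-leaf vertices induce a possibly empty path). Finally, there is a constant $C$ such that $|q(n)-6\log_3 n|\le C$ for all $n\ge 1$. -/

import Mathlib

/-! ### Alternating paths through segments in convex position -/

/-- The Euclidean plane. -/
abbrev Plane : Type := EuclideanSpace ℝ (Fin 2)

/-- The `j`-th (closed) segment of a family of `n` segments in the plane. The family is given by
its `2n` endpoints: segment `j` joins `S (j, false)` and `S (j, true)`. -/
def famSegment {n : ℕ} (S : Fin n × Bool → Plane) (j : Fin n) : Set Plane :=
  segment ℝ (S (j, false)) (S (j, true))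

/-- The `n` segments are pairwise disjoint and their `2n` endpoints are in convex position
(no endpoint lies in the convex hull of other ones; in particular the endpoints are distinct,
so the segments are nondegenerate). -/
def IsDisjointConvexFamily {n : ℕ} (S : Fin n × Bool → Plane) : Prop :=
  (Pairwise fun i j : Fin n => Disjoint (famSegment S i) (famSegment S j)) ∧
    ConvexIndependent ℝ S

/-- The `i`-th edge of the polygonal chain with vertices `v 0, v 1, …`. -/
def chainEdge (v : ℕ → Plane) (i : ℕ) : Set Plane :=
  segment ℝ (v i) (v (i + 1))

/-- The polygonal chain `v 0, …, v m` with `m` edges is simple: its edges are nondegenerate,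
consecutive edges meet only in their common vertex, and other pairs of edges are disjoint. -/
def IsSimpleChain (v : ℕ → Plane) (m : ℕ) : Prop :=
  (∀ i < m, v i ≠ v (i + 1)) ∧
  (∀ i, i + 1 < m → chainEdge v i ∩ chainEdge v (i + 1) = {v (i + 1)}) ∧
  (∀ i j, i + 1 < j → j < m → Disjoint (chainEdge v i) (chainEdge v j))

/-- Edge `i` of the chain is the segment `j` of the family, traversed in either direction. -/
def EdgeIsSegment {n : ℕ} (S : Fin n × Bool → Plane) (v : ℕ → Plane) (i : ℕ) (j : Fin n) : Prop :=
  s(v i, v (i + 1)) = s(S (j, false), S (j, true))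

/-- The chain `v 0, …, v m` is an alternating path among the segments of `S`: it is a simple
polygonal chain, and every other edge of it (those whose index has parity `r`) is a segment
of `S`. The chain may start, and may end, with a segment of `S` or with a connecting edge. -/
def IsAlternatingPath {n : ℕ} (S : Fin n × Bool → Plane) (v : ℕ → Plane) (m r : ℕ) : Prop :=
  IsSimpleChain v m ∧ r < 2 ∧ ∀ i < m, i % 2 = r → ∃ j, EdgeIsSegment S v i j

/-- The chain is compatible with `S`: it does not meet any segment of `S` that is not in the chain.
(For endpoints in convex position an edge of the chain that joins endpoints of two other segments
meets a segment if and only if it crosses it.) -/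
def IsCompatibleChain {n : ℕ} (S : Fin n × Bool → Plane) (v : ℕ → Plane) (m : ℕ) : Prop :=
  ∀ j : Fin n, (∀ i < m, ¬ EdgeIsSegment S v i j) →
    ∀ i < m, Disjoint (chainEdge v i) (famSegment S j)

/-- `S` admits an alternating path compatible with `S` going through (exactly) `k` segments
of `S`. -/
def AdmitsCompatiblePath {n : ℕ} (S : Fin n × Bool → Plane) (k : ℕ) : Prop :=
  ∃ (v : ℕ → Plane) (m r : ℕ), IsAlternatingPath S v m r ∧ IsCompatibleChain S v m ∧
    ((Finset.range m).filter fun i => i % 2 = r).card = k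

/-- The numbers `k` such that every family of `n` disjoint segments with endpoints in convex
position admits a compatible alternating path going through `k` of its segments. -/
def guaranteedPathSizes (n : ℕ) : Set ℕ :=
  {k | ∀ S : Fin n × Bool → Plane, IsDisjointConvexFamily S → AdmitsCompatiblePath S k}

/-- `q(n)`: the maximum of `guaranteedPathSizes n`. -/
noncomputable def q (n : ℕ) : ℕ := sSup (guaranteedPathSizes n)

/-! ### Caterpillars in trees -/

/-- A caterpillar: a tree whose non-leaf vertices induce a (possibly empty) path. A leaf is a
vertex with exactly one neighbour. -/
def IsCaterpillar {V : Type} (G : SimpleGraph V) : Prop :=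
  G.IsTree ∧
    ∃ l : ℕ, Nonempty (G.induce {x | (G.neighborSet x).encard ≠ 1} ≃g SimpleGraph.pathGraph l)

/-- `G` contains a caterpillar with `k` edges as a subgraph. -/
def ContainsCaterpillar {V : Type} (G : SimpleGraph V) (k : ℕ) : Prop :=
  ∃ H : G.Subgraph, IsCaterpillar H.coe ∧ H.edgeSet.encard = k

/-- The numbers `k` such that every tree with `n` edges contains a caterpillar with `k` edges. -/
def guaranteedCaterpillarSizes (n : ℕ) : Set ℕ :=
  {k | ∀ (V : Type) (T : SimpleGraph V), T.IsTree → T.edgeSet.encard = n → ContainsCaterpillar T k}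

/-! ### The explicit formulas -/

/-- `6 ⌊(1/6) ⌈6 log₃ x + c⌉⌋`. -/
noncomputable def roundedLog (x c : ℝ) : ℤ :=
  6 * ⌊(1 / 6 : ℝ) * (⌈6 * Real.logb 3 x + c⌉ : ℝ)⌋

noncomputable def q₀ (n : ℕ) : ℤ := roundedLog (2 * (n : ℝ) / 55 + 1 / 11) 11
noncomputable def q₁ (n : ℕ) : ℤ := roundedLog ((n : ℝ) / 33 + 1 / 11) 11 + 1
noncomputable def q₂ (n : ℕ) : ℤ := roundedLog (2 * (n : ℝ) / 235 + 1 / 47) 17 + 2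
noncomputable def q₃ (n : ℕ) : ℤ := roundedLog ((n : ℝ) / 141 + 1 / 47) 17 + 3
noncomputable def q₄ (n : ℕ) : ℤ := roundedLog (2 * (n : ℝ) / 115 + 1 / 23) 11 + 4
noncomputable def q₅ (n : ℕ) : ℤ := roundedLog ((n : ℝ) / 69 + 1 / 23) 11 + 5

/-!
Cut along `n` disjoint segments with endpoints in convex position, the convex hull falls into
`n + 1` regions; the regions and the segments are the vertices and the edges of the dual tree. A
compatible alternating path is a sequence of segments in which consecutive ones bound a common
region, that is, a sequence of edges of the dual tree in which consecutive ones share a vertex.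
Such a sequence sweeps over a caterpillar. So both maxima in the theorem are governed by the same
extremal number: `extremalSize k`, the largest number of edges of a tree all of whose caterpillars
have at most `k` edges. The optimum is a vertex of degree `D` that carries `D` equal branches of
height `h`, where `D + 2 * h = k`; here the height counts all the edges met at the vertices on the
way down. The largest branch of height `h` has `branchSize h` edges.

*Long paths exist* (`mem_guaranteedPathSizes`). Numbering the endpoints along the hull turns the
family into a noncrossing matching of the positions `0, …, 2 * n - 1`, that is, into a parenthesis
word, and the word into a `PlaneForest`. Changing the first endpoint rotates the forest, so that
every segment can be brought into the front position, with subforests `A` and `B` on its two sides.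
Some segment is balanced: if the edges are oriented towards their side of larger height and this
height is minimal, then `B.maxHeight ≤ A.height` and `A.height ≤ B.height`, up to exchanging `A` and
`B`, and numerical properties of `branchSize` yield
`n ≤ extremalSize (A.height + B.height + 1)` (`PlaneForest.exists_rotation_size_le`). On either side
there is an alternating path through `height` many segments that starts next to the given segment;
together they form a path through `A.height + B.height + 1` segments
(`PlaneForest.exists_path_cons`). That combinatorial noncrossing implies geometric disjointness
rests on the orientation of triples of points in convex position.

*From paths to caterpillars* (`guaranteedPathSizes_subset`). Every tree is the dual tree of a family
of segments: the tree is drawn by nested intervals on a line, and the line is lifted to a parabola.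
A path that is compatible with this family traces a caterpillar of the tree
(`SimpleGraph.IsTree.exists_family`, `SimpleGraph.IsTree.containsCaterpillar`).

*Caterpillars can be short* (`le_of_mem_guaranteedCaterpillarSizes`). The extremal tree is realized
on words. A caterpillar with `j` edges is bounded by the sum of `degree - 1` over its spine, and a
path in the extremal tree climbs and descends at most once.

Hence `k + 1 ≤ q n` if and only if `extremalSize k < n` (`succ_le_q_iff`). Since
`branchSize (h + 3) = 1 + 3 * branchSize h` for `h ≥ 5`, and the optimal degree is `5` or `6`
depending on the parity of `k`, the numbers `extremalSize k` with `k` in a fixed residue class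
modulo `6` are explicit in terms of powers of `3`; solving for `k` gives the six formulas.
-/

/-! ### The extremal numbers -/

/-- The maximal number of edges of a branch (a tree planted at one of its leaf edges) of height
`h`, where a vertex with `d` children counts `d` towards the height. -/
def branchSize : ℕ → ℕ
  | 0 => 1
  | 1 => 2
  | 2 => 3
  | 3 => 5
  | 4 => 7
  | 5 => 11
  | 6 => 16
  | 7 => 23
  | (n + 8) => 1 + 3 * branchSize (n + 5)

/-- The maximal number of edges of a tree all of whose caterpillars have at most `k` edges: some
vertex of degree `k - 2 * h` carries optimal branches of height `h`. -/
def extremalSize (k : ℕ) : ℕ :=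
  (Finset.range (k / 2 + 1)).sup fun h => (k - 2 * h) * branchSize h

theorem branchSize_pos (h : ℕ) : 0 < branchSize h := by
  unfold branchSize
  split <;> omega

theorem branchSize_add_three {h : ℕ} (hh : 5 ≤ h) : branchSize (h + 3) = 1 + 3 * branchSize h := by
  obtain ⟨m, rfl⟩ := Nat.exists_eq_add_of_le' hh
  rw [show m + 5 + 3 = m + 8 by ring, branchSize]

/-- Induction in steps of three, following the recursion of `branchSize`. -/
theorem branchSize_induction {P : ℕ → Prop} (base : ∀ h < 8, P h)
    (step : ∀ h, 5 ≤ h → P h → P (h + 3)) (h : ℕ) : P h := by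
  induction h using Nat.strong_induction_on with
  | _ h ih =>
    by_cases hh : h < 8
    · exact base h hh
    · have := step (h - 3) (by omega) (ih _ (by omega))
      rwa [show h - 3 + 3 = h by omega] at this

theorem branchSize_ratio_lower (h : ℕ) : 4 * branchSize h + 1 ≤ 3 * branchSize (h + 1) := by
  induction h using branchSize_induction with
  | base h hh => interval_cases h <;> decide
  | step h hh ih =>
    have := branchSize_add_three hh
    have := branchSize_add_three (show 5 ≤ h + 1 by omega)
    rw [show h + 3 + 1 = h + 1 + 3 by ring]
    omega

theorem branchSize_mono : Monotone branchSize :=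
  monotone_nat_of_le_succ fun h => by have := branchSize_ratio_lower h; omega

theorem branchSize_ratio_lower' (h : ℕ) : 7 * branchSize h ≤ 5 * branchSize (h + 1) := by
  have key : 7 * branchSize h + (if h = 3 then 0 else 1) ≤ 5 * branchSize (h + 1) := by
    induction h using branchSize_induction with
    | base h hh => interval_cases h <;> decide
    | step h hh ih =>
      have := branchSize_add_three hh
      have := branchSize_add_three (show 5 ≤ h + 1 by omega)
      rw [show h + 3 + 1 = h + 1 + 3 by ring]
      rw [if_neg (by omega)] at ih ⊢
      omega
  split_ifs at key <;> omega

theorem branchSize_ratio_upper (h : ℕ) : branchSize (h + 1) ≤ 2 * branchSize h := by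
  induction h using branchSize_induction with
  | base h hh => interval_cases h <;> decide
  | step h hh ih =>
    have := branchSize_add_three hh
    have := branchSize_add_three (show 5 ≤ h + 1 by omega)
    rw [show h + 3 + 1 = h + 1 + 3 by ring]
    omega

theorem branchSize_ratio_upper_odd {h : ℕ} (hh : 1 ≤ h) :
    3 * branchSize (h + 1) ≤ 5 * branchSize h := by
  induction h using branchSize_induction with
  | base h h8 => interval_cases h <;> decide
  | step h h5 ih =>
    have := branchSize_add_three h5
    have := branchSize_add_three (show 5 ≤ h + 1 by omega)
    have := ih (by omega)
    rw [show h + 3 + 1 = h + 1 + 3 by ring]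
    omega

theorem branchSize_ratio_upper_even {h : ℕ} (hh : 5 ≤ h) :
    4 * branchSize (h + 1) ≤ 6 * branchSize h := by
  induction h using branchSize_induction with
  | base h h8 => interval_cases h <;> decide
  | step h h5 ih =>
    have := branchSize_add_three h5
    have := branchSize_add_three (show 5 ≤ h + 1 by omega)
    have := ih (by omega)
    rw [show h + 3 + 1 = h + 1 + 3 by ring]
    omega

theorem branchSize_add_two_le (h : ℕ) : branchSize (h + 2) ≤ 3 * branchSize h := by
  induction h using branchSize_induction with
  | base h hh => interval_cases h <;> decide
  | step h hh ih =>
    have := branchSize_add_three hh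
    have := branchSize_add_three (show 5 ≤ h + 2 by omega)
    rw [show h + 3 + 2 = h + 2 + 3 by ring]
    omega

theorem branchSize_add_three_le {h : ℕ} (hh : 1 ≤ h) : branchSize (h + 3) ≤ 4 * branchSize h := by
  by_cases h5 : 5 ≤ h
  · have := branchSize_add_three h5
    have := branchSize_pos h
    omega
  · interval_cases h <;> decide

theorem one_add_two_mul_branchSize_le (m : ℕ) : 1 + 2 * branchSize m ≤ branchSize (m + 2) := by
  induction m using branchSize_induction with
  | base h hh => interval_cases h <;> decide
  | step h hh ih =>
    have := branchSize_add_three hh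
    have := branchSize_add_three (show 5 ≤ h + 2 by omega)
    rw [show h + 3 + 2 = h + 2 + 3 by ring]
    omega

theorem one_add_three_mul_branchSize_le (m : ℕ) : 1 + 3 * branchSize m ≤ branchSize (m + 3) := by
  by_cases h5 : 5 ≤ m
  · exact (branchSize_add_three h5).ge
  · interval_cases m <;> decide

/-- From three on, it does not pay to trade height for a larger number of children. -/
theorem succ_mul_branchSize_le {d : ℕ} (hd : 3 ≤ d) (m : ℕ) :
    (d + 1) * branchSize m ≤ d * branchSize (m + 1) := by
  have := branchSize_ratio_lower m
  nlinarith

/-- A vertex with `d` children that carry branches of height `m` is the start of a branch of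
height `m + d`, and so has at most the optimal size. -/
theorem one_add_mul_branchSize_le (d m : ℕ) : 1 + d * branchSize m ≤ branchSize (m + d) := by
  induction d generalizing m with
  | zero => simpa using Nat.succ_le_of_lt (branchSize_pos m)
  | succ d ih =>
    rcases Nat.lt_or_ge d 3 with hd | hd
    · interval_cases d
      · have := branchSize_ratio_lower m
        have := branchSize_pos m
        simp only [zero_add, one_mul]
        omega
      · exact one_add_two_mul_branchSize_le m
      · exact one_add_three_mul_branchSize_le m
    · calc 1 + (d + 1) * branchSize m ≤ 1 + d * branchSize (m + 1) := by
            have := succ_mul_branchSize_le hd m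
            omega
        _ ≤ branchSize (m + 1 + d) := ih (m + 1)
        _ = branchSize (m + (d + 1)) := by ring_nf

/-- The optimal number of children of the first vertex of a branch of height `h`. -/
def branchDegree (h : ℕ) : ℕ :=
  if h ≤ 1 then h else if h = 6 ∨ 8 ≤ h then 3 else 2

theorem branchDegree_le (h : ℕ) : branchDegree h ≤ h := by
  unfold branchDegree
  split_ifs <;> omega

theorem branchDegree_pos {h : ℕ} (hh : 0 < h) : 0 < branchDegree h := by
  unfold branchDegree
  split_ifs <;> omega

theorem branchSize_eq (h : ℕ) :
    branchSize h = 1 + branchDegree h * branchSize (h - branchDegree h) := by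
  by_cases hh : h < 8
  · interval_cases h <;> decide
  · have := branchSize_add_three (show 5 ≤ h - 3 by omega)
    rw [show h - 3 + 3 = h by omega] at this
    rw [branchDegree, if_neg (by omega), if_pos (by omega), this]

theorem mul_branchSize_le_extremalSize {D h k : ℕ} (hk : D + 2 * h ≤ k) :
    D * branchSize h ≤ extremalSize k :=
  calc D * branchSize h ≤ (k - 2 * h) * branchSize h := Nat.mul_le_mul_right _ (by omega)
    _ ≤ _ := Finset.le_sup (f := fun h => (k - 2 * h) * branchSize h)
      (Finset.mem_range.2 (by omega))

theorem exists_extremalSize_eq (k : ℕ) :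
    ∃ D h, D + 2 * h = k ∧ extremalSize k = D * branchSize h := by
  obtain ⟨h, hh, e⟩ := Finset.exists_mem_eq_sup (Finset.range (k / 2 + 1)) ⟨0, by simp⟩
    fun h => (k - 2 * h) * branchSize h
  exact ⟨k - 2 * h, h, by have := Finset.mem_range.1 hh; omega, e⟩

theorem extremalSize_mono : Monotone extremalSize := by
  intro k l hkl
  obtain ⟨D, h, e, he⟩ := exists_extremalSize_eq k
  rw [he]
  exact mul_branchSize_le_extremalSize (by omega)

theorem le_extremalSize (k : ℕ) : k ≤ extremalSize k := by
  simpa [branchSize] using mul_branchSize_le_extremalSize (D := k) (h := 0) (k := k) (by omega)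

/-- A vertex with one branch of height `m + t` and `d` branches of height `m`, where `t ≤ d`, is no
better than a vertex all of whose branches have the same height. -/
theorem branchSize_add_mul_le_extremalSize (d m t : ℕ) (ht : t ≤ d) :
    branchSize (m + t) + d * branchSize m ≤ extremalSize (2 * m + t + d + 1) := by
  induction d generalizing m t with
  | zero =>
    obtain rfl : t = 0 := by omega
    simpa using mul_branchSize_le_extremalSize (D := 1) (h := m) (k := 2 * m + 1) (by omega)
  | succ d ih =>
    have h0 : (d + 2 + t) * branchSize m ≤ extremalSize (2 * m + t + (d + 1) + 1) :=
      mul_branchSize_le_extremalSize (by omega)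
    have hle (c : ℕ) (hc : branchSize (m + t) ≤ c * branchSize m) (hct : c ≤ t + 1) :
        branchSize (m + t) + (d + 1) * branchSize m ≤
          extremalSize (2 * m + t + (d + 1) + 1) := by
      refine le_trans ?_ h0
      have := branchSize_pos m
      nlinarith
    rcases Nat.lt_or_ge t 3 with h3 | h3
    · interval_cases t
      · exact hle 1 (by simp) le_rfl
      · exact hle 2 (branchSize_ratio_upper m) le_rfl
      · exact hle 3 (branchSize_add_two_le m) le_rfl
    rcases Nat.lt_or_ge d 3 with hd | hd
    · -- here `d + 1 = t = 3`
      obtain rfl : t = 3 := by omega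
      obtain rfl : d = 2 := by omega
      rcases Nat.eq_zero_or_pos m with rfl | hm
      · decide
      · exact hle 4 (branchSize_add_three_le hm) le_rfl
    · -- trade one child for one unit of height
      have h1 := succ_mul_branchSize_le hd m
      have h2 := ih (m + 1) (t - 1) (by omega)
      rw [show m + 1 + (t - 1) = m + t by omega,
        show 2 * (m + 1) + (t - 1) + d + 1 = 2 * m + t + (d + 1) + 1 by omega] at h2
      omega

/-- Large degrees are not optimal. -/
theorem mul_branchSize_le_sub_two {D : ℕ} (hD : 7 ≤ D) (h : ℕ) :
    D * branchSize h ≤ (D - 2) * branchSize (h + 1) := by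
  obtain ⟨d, rfl⟩ := Nat.exists_eq_add_of_le hD
  have := branchSize_ratio_lower' h
  rw [show 7 + d - 2 = 5 + d by omega]
  have := branchSize_mono (Nat.le_succ h)
  simp only [Nat.succ_eq_add_one] at this
  nlinarith

theorem extremalSize_odd {h : ℕ} (hh : 1 ≤ h) : extremalSize (2 * h + 5) = 5 * branchSize h := by
  refine le_antisymm ?_ (mul_branchSize_le_extremalSize (by omega))
  have key : ∀ j m, 2 * j + 1 + 2 * m = 2 * h + 5 →
      (2 * j + 1) * branchSize m ≤ 5 * branchSize h := by
    intro j
    induction j using Nat.strong_induction_on with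
    | _ j ih =>
      intro m e
      rcases Nat.lt_or_ge j 3 with h3 | h3
      · interval_cases j
        · obtain rfl : m = h + 2 := by omega
          have := branchSize_add_two_le h
          have := branchSize_pos h
          omega
        · obtain rfl : m = h + 1 := by omega
          exact branchSize_ratio_upper_odd hh
        · obtain rfl : m = h := by omega
          exact le_rfl
      · refine (mul_branchSize_le_sub_two (by omega) m).trans ?_
        have := ih (j - 1) (by omega) (m + 1) (by omega)
        rwa [show 2 * (j - 1) + 1 = 2 * j + 1 - 2 by omega] at this
  obtain ⟨D, m, e, he⟩ := exists_extremalSize_eq (2 * h + 5)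
  rw [he]
  have := key (D / 2) m (by omega)
  rwa [show 2 * (D / 2) + 1 = D by omega] at this

theorem extremalSize_even {h : ℕ} (hh : 5 ≤ h) : extremalSize (2 * h + 6) = 6 * branchSize h := by
  refine le_antisymm ?_ (mul_branchSize_le_extremalSize (by omega))
  have key : ∀ j m, 2 * j + 2 * m = 2 * h + 6 →
      (2 * j) * branchSize m ≤ 6 * branchSize h := by
    intro j
    induction j using Nat.strong_induction_on with
    | _ j ih =>
      intro m e
      rcases Nat.lt_or_ge j 4 with h3 | h3
      · interval_cases j
        · simp
        · obtain rfl : m = h + 2 := by omega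
          have := branchSize_add_two_le h
          omega
        · obtain rfl : m = h + 1 := by omega
          exact branchSize_ratio_upper_even hh
        · obtain rfl : m = h := by omega
          exact le_rfl
      · refine (mul_branchSize_le_sub_two (by omega) m).trans ?_
        have := ih (j - 1) (by omega) (m + 1) (by omega)
        rwa [show 2 * (j - 1) = 2 * j - 2 by omega] at this
  obtain ⟨D, m, e, he⟩ := exists_extremalSize_eq (2 * h + 6)
  rw [he]
  have := key (D / 2) m (by omega)
  rwa [show 2 * (D / 2) = D by omega] at this

/-! ### Plane forests and their rotations -/

/-- A plane forest: a finite sequence of rooted plane trees, given by the forest `c` hanging below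
the root of the first tree and the sequence `r` of the remaining trees. Read as the parenthesis word
`( c ) r`, a plane forest is a noncrossing perfect matching of the letters of that word. -/
inductive PlaneForest : Type
  | nil : PlaneForest
  | cons (c r : PlaneForest) : PlaneForest

namespace PlaneForest

/-- The number of edges, that is, of pairs of matching parentheses; every root counts as the lower
end of an edge. -/
def size : PlaneForest → ℕ
  | nil => 0
  | cons c r => c.size + 1 + r.size

/-- The number of trees. -/
def numTrees : PlaneForest → ℕ
  | nil => 0
  | cons _ r => r.numTrees + 1

/-- The largest height of a tree of the forest (see `PlaneForest.height`). -/
def maxHeight : PlaneForest → ℕ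
  | nil => 0
  | cons c r => max (c.numTrees + c.maxHeight) r.maxHeight

/-- The height of a forest: the largest number of edges met by a path that descends from the top of
the forest, where all the edges at every vertex of the path count. -/
def height (φ : PlaneForest) : ℕ := φ.numTrees + φ.maxHeight

/-- Concatenation of forests. -/
def append : PlaneForest → PlaneForest → PlaneForest
  | nil, ψ => ψ
  | cons c r, ψ => cons c (r.append ψ)

/-- `IsRotation φ ψ`: the parenthesis word of `ψ` is a cyclic rotation of that of `φ`. If the
initial parenthesis of `( a ) b` is moved to the end, it changes places with its partner, and the
word becomes `a ( b )`. -/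
inductive IsRotation : PlaneForest → PlaneForest → Prop
  | refl (φ : PlaneForest) : IsRotation φ φ
  | step {φ a b : PlaneForest} : IsRotation φ (cons a b) → IsRotation φ (a.append (cons b nil))

theorem IsRotation.trans {φ ψ χ : PlaneForest} (h₁ : IsRotation φ ψ) (h₂ : IsRotation ψ χ) :
    IsRotation φ χ := by
  induction h₂ with
  | refl => exact h₁
  | step _ ih => exact ih.step

theorem append_nil (φ : PlaneForest) : φ.append nil = φ := by
  induction φ with
  | nil => rfl
  | cons c r _ ih => rw [append, ih]

theorem append_assoc (φ ψ χ : PlaneForest) :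
    (φ.append ψ).append χ = φ.append (ψ.append χ) := by
  induction φ with
  | nil => rfl
  | cons c r _ ih => rw [append, append, append, ih]

theorem size_append (φ ψ : PlaneForest) : (φ.append ψ).size = φ.size + ψ.size := by
  induction φ with
  | nil => simp [append, size]
  | cons c r _ ih => simp only [append, size, ih]; omega

theorem maxHeight_append (φ ψ : PlaneForest) :
    (φ.append ψ).maxHeight = max φ.maxHeight ψ.maxHeight := by
  induction φ with
  | nil => simp [append, maxHeight]
  | cons c r _ ih => simp only [append, maxHeight, ih, max_assoc]

theorem IsRotation.size_eq {φ ψ : PlaneForest} (h : IsRotation φ ψ) : ψ.size = φ.size := by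
  induction h with
  | refl => rfl
  | step _ ih => rw [← ih]; simp only [size_append, size]; omega

/-- Whole trees can be rotated from the front to the end. -/
theorem isRotation_append_comm (φ ψ : PlaneForest) :
    IsRotation (φ.append ψ) (ψ.append φ) := by
  induction φ generalizing ψ with
  | nil => rw [append_nil]; exact .refl _
  | cons a b iha ihb =>
    have h1 : IsRotation (cons a (b.append ψ)) (a.append (cons (b.append ψ) nil)) :=
      .step (.refl _)
    have h2 := iha (cons (b.append ψ) nil)
    have h3 : IsRotation (cons (b.append ψ) a) ((b.append ψ).append (cons a nil)) :=
      .step (.refl _)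
    have h4 := ihb (ψ.append (cons a nil))
    rw [append_assoc] at h3
    have := ((h1.trans h2).trans h3).trans h4
    rwa [append_assoc] at this

theorem isRotation_cons_comm (φ ψ : PlaneForest) : IsRotation (cons φ ψ) (cons ψ φ) :=
  (IsRotation.step (.refl _)).trans (isRotation_append_comm φ (cons ψ nil))

/-- Moving the base point of the matching across the root edge of the tree of `c`. -/
theorem isRotation_cons_append (α c β ψ : PlaneForest) :
    IsRotation (cons (α.append (cons c β)) ψ) (cons c (β.append (cons ψ α))) := by
  have h1 : IsRotation (cons (α.append (cons c β)) ψ)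
      ((α.append (cons c β)).append (cons ψ nil)) := .step (.refl _)
  have h2 := isRotation_append_comm α ((cons c β).append (cons ψ nil))
  rw [← append_assoc] at h2
  have := h1.trans h2
  rwa [append, append, append_assoc, append, append] at this

theorem exists_append_cons_of_numTrees_pos {φ : PlaneForest} (h : 0 < φ.numTrees) :
    ∃ α c β : PlaneForest, φ = α.append (cons c β) ∧ c.height = φ.maxHeight := by
  induction φ with
  | nil => simp [numTrees] at h
  | cons c r _ ih =>
    rcases le_total r.maxHeight c.height with hle | hle
    · exact ⟨nil, c, r, rfl, (max_eq_left hle).symm⟩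
    · rcases Nat.eq_zero_or_pos r.numTrees with h0 | h0
      · obtain rfl : r = nil := by
          cases r with
          | nil => rfl
          | cons => simp [numTrees] at h0
        refine ⟨nil, c, nil, rfl, (max_eq_left ?_).symm⟩
        simp [maxHeight]
      · obtain ⟨α, e, β, rfl, he⟩ := ih h0
        refine ⟨cons c α, e, β, rfl, ?_⟩
        rw [he]
        exact (max_eq_right hle).symm

theorem size_le_numTrees_mul (φ : PlaneForest) :
    φ.size ≤ φ.numTrees * branchSize φ.maxHeight := by
  induction φ with
  | nil => simp [size]
  | cons c r ihc ihr =>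
    have h1 : c.size + 1 ≤ branchSize (max (c.numTrees + c.maxHeight) r.maxHeight) := by
      have h2 := one_add_mul_branchSize_le c.numTrees c.maxHeight
      have h3 : branchSize (c.maxHeight + c.numTrees) ≤
          branchSize (max (c.numTrees + c.maxHeight) r.maxHeight) :=
        branchSize_mono (by rw [add_comm]; exact le_max_left _ _)
      omega
    have h4 : r.size ≤ r.numTrees *
        branchSize (max (c.numTrees + c.maxHeight) r.maxHeight) :=
      ihr.trans (Nat.mul_le_mul_left _ (branchSize_mono (le_max_right _ _)))
    simp only [size, numTrees, maxHeight, add_mul, one_mul]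
    omega

theorem size_add_one_le (φ : PlaneForest) : φ.size + 1 ≤ branchSize φ.height := by
  have h1 := φ.size_le_numTrees_mul
  have h2 := one_add_mul_branchSize_le φ.numTrees φ.maxHeight
  rw [add_comm φ.maxHeight] at h2
  exact le_trans (by omega) h2

/-- If the heights on the two sides of an edge do not differ too much, the size is bounded by the
extremal number for the longest path through the edge. -/
theorem size_cons_le_extremalSize {A B : PlaneForest} (h₁ : B.maxHeight ≤ A.height)
    (h₂ : A.height ≤ B.height) : (cons A B).size ≤ extremalSize (A.height + B.height + 1) := by
  obtain ⟨t, ht⟩ := Nat.exists_eq_add_of_le h₁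
  have hB : B.height = B.numTrees + B.maxHeight := rfl
  have key := branchSize_add_mul_le_extremalSize B.numTrees B.maxHeight t (by omega)
  have hA := A.size_add_one_le
  have hs := B.size_le_numTrees_mul
  rw [← ht] at key
  rw [show A.height + B.height + 1 = 2 * B.maxHeight + t + B.numTrees + 1 by omega]
  simp only [size]
  omega

/-- Some edge of a plane forest is balanced: among all edges, oriented towards the side of larger
height, one takes an edge for which this height is smallest. -/
theorem exists_rotation_size_le {Φ : PlaneForest} (hΦ : Φ ≠ nil) :
    ∃ A B, IsRotation Φ (cons A B) ∧ Φ.size ≤ extremalSize (A.height + B.height + 1) := by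
  classical
  suffices h : ∃ A B, IsRotation Φ (cons A B) ∧ B.maxHeight ≤ A.height ∧
      A.height ≤ B.height by
    obtain ⟨A, B, hr, h₁, h₂⟩ := h
    exact ⟨A, B, hr, hr.size_eq ▸ size_cons_le_extremalSize h₁ h₂⟩
  have hex : ∃ L φ ψ, IsRotation Φ (cons φ ψ) ∧ ψ.height ≤ φ.height ∧ φ.height = L := by
    cases Φ with
    | nil => exact absurd rfl hΦ
    | cons φ ψ =>
      rcases le_total ψ.height φ.height with h | h
      · exact ⟨_, φ, ψ, .refl _, h, rfl⟩
      · exact ⟨_, ψ, φ, isRotation_cons_comm φ ψ, h, rfl⟩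
  obtain ⟨φ, ψ, hr, hle, hL⟩ := Nat.find_spec hex
  have hmin : ∀ φ' ψ', IsRotation Φ (cons φ' ψ') → ψ'.height ≤ φ'.height →
      φ.height ≤ φ'.height := fun φ' ψ' h h' =>
    hL ▸ Nat.find_min' hex ⟨φ', ψ', h, h', rfl⟩
  have hφ : φ.height = φ.numTrees + φ.maxHeight := rfl
  rcases le_or_gt φ.maxHeight ψ.height with h | h
  · exact ⟨ψ, φ, hr.trans (isRotation_cons_comm φ ψ), h, hle⟩
  · have hd : 0 < φ.numTrees := by
      cases φ with
      | nil => simp [maxHeight] at h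
      | cons => simp [numTrees]
    obtain ⟨α, c, β, rfl, hc⟩ := exists_append_cons_of_numTrees_pos hd
    have hr' := hr.trans (isRotation_cons_append α c β ψ)
    refine ⟨c, _, hr', ?_, ?_⟩
    · rw [hc]
      simp only [maxHeight_append, maxHeight] at h ⊢
      rw [show ψ.numTrees + ψ.maxHeight = ψ.height from rfl]
      omega
    · by_contra hlt
      have := hmin _ _ hr' (by omega)
      omega

end PlaneForest

/-! ### Alternating paths in noncrossing matchings -/

/-- The pairs `e` and `f` of positions on a line (or on a circle cut open at a point) interlace: the
chords of the circle that they span cross in their relative interiors. -/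
def Interlace (e f : ℕ × ℕ) : Prop :=
  (min e.1 e.2 < min f.1 f.2 ∧ min f.1 f.2 < max e.1 e.2 ∧ max e.1 e.2 < max f.1 f.2) ∨
  (min f.1 f.2 < min e.1 e.2 ∧ min e.1 e.2 < max f.1 f.2 ∧ max f.1 f.2 < max e.1 e.2)

theorem Interlace.symm {e f : ℕ × ℕ} (h : Interlace e f) : Interlace f e :=
  Or.symm h

theorem interlace_swap_left {e f : ℕ × ℕ} : Interlace e.swap f ↔ Interlace e f := by
  simp only [Interlace, Prod.fst_swap, Prod.snd_swap, min_comm e.2, max_comm e.2]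

theorem interlace_swap_right {e f : ℕ × ℕ} : Interlace e f.swap ↔ Interlace e f := by
  simp only [Interlace, Prod.fst_swap, Prod.snd_swap, min_comm f.2, max_comm f.2]

/-- The connecting pairs of a sequence of oriented chords: each leads from the end of a chord to the
start of the next one. -/
def links : List (ℕ × ℕ) → List (ℕ × ℕ)
  | p :: q :: l => (p.2, q.1) :: links (q :: l)
  | _ => []

theorem links_append (l₁ l₂ : List (ℕ × ℕ)) (p q : ℕ × ℕ) :
    links (l₁ ++ p :: q :: l₂) = links (l₁ ++ [p]) ++ (p.2, q.1) :: links (q :: l₂) := by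
  induction l₁ with
  | nil => rfl
  | cons a l₁ ih =>
    cases l₁ with
    | nil => rfl
    | cons b l₁ => simpa [links] using ih

theorem links_reverse (l : List (ℕ × ℕ)) :
    links (l.map Prod.swap).reverse = ((links l).map Prod.swap).reverse := by
  induction l with
  | nil => rfl
  | cons p l ih =>
    cases l with
    | nil => rfl
    | cons q l =>
      simp only [List.map_cons, List.reverse_cons, List.append_assoc, List.singleton_append,
        links] at ih ⊢
      rw [links_append, ih]
      rfl

theorem fst_or_snd_of_mem_links {e : ℕ × ℕ} {l : List (ℕ × ℕ)} (he : e ∈ links l) :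
    (∃ p ∈ l, e.1 = p.2) ∧ ∃ q ∈ l, e.2 = q.1 := by
  induction l with
  | nil => simp [links] at he
  | cons p l ih =>
    cases l with
    | nil => simp [links] at he
    | cons q l =>
      rcases List.mem_cons.1 he with rfl | he
      · exact ⟨⟨p, by simp⟩, q, by simp⟩
      · obtain ⟨⟨a, ha, ha'⟩, b, hb, hb'⟩ := ih he
        exact ⟨⟨a, List.mem_cons_of_mem _ ha, ha'⟩, b, List.mem_cons_of_mem _ hb, hb'⟩

/-- The sequence `l` of oriented chords of the matching `C` is an alternating path: the chords are
disjoint, and the connecting pairs neither cross a chord of `C` nor each other. -/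
structure IsAltPath (C : Set (ℕ × ℕ)) (l : List (ℕ × ℕ)) : Prop where
  mem : ∀ p ∈ l, p ∈ C ∨ p.swap ∈ C
  disjoint : l.Pairwise fun p q => p.1 ≠ q.1 ∧ p.1 ≠ q.2 ∧ p.2 ≠ q.1 ∧ p.2 ≠ q.2
  not_interlace : ∀ e ∈ links l, ∀ f ∈ C, ¬ Interlace e f
  pairwise : (links l).Pairwise fun e f => ¬ Interlace e f

namespace IsAltPath

theorem nil (C : Set (ℕ × ℕ)) : IsAltPath C [] :=
  ⟨by simp, by simp, by simp [links], by simp [links]⟩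

theorem singleton {C : Set (ℕ × ℕ)} {p : ℕ × ℕ} (h : p ∈ C ∨ p.swap ∈ C) : IsAltPath C [p] :=
  ⟨by simpa using h, by simp, by simp [links], by simp [links]⟩

theorem reverse {C : Set (ℕ × ℕ)} {l : List (ℕ × ℕ)} (h : IsAltPath C l) :
    IsAltPath C (l.map Prod.swap).reverse where
  mem p hp := by
    simp only [List.mem_reverse, List.mem_map] at hp
    obtain ⟨q, hq, rfl⟩ := hp
    simpa [or_comm] using h.mem q hq
  disjoint := by
    rw [List.pairwise_reverse, List.pairwise_map]
    refine h.disjoint.imp fun {p q} hpq => ?_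
    simp only [Prod.fst_swap, Prod.snd_swap]
    tauto
  not_interlace e he f hf := by
    rw [links_reverse, List.mem_reverse, List.mem_map] at he
    obtain ⟨e, he, rfl⟩ := he
    rw [interlace_swap_left]
    exact h.not_interlace e he f hf
  pairwise := by
    rw [links_reverse, List.pairwise_reverse, List.pairwise_map]
    refine h.pairwise.imp fun {e f} hef hfe => hef ?_
    rw [interlace_swap_left, interlace_swap_right] at hfe
    exact hfe.symm

theorem mono {C C' : Set (ℕ × ℕ)} {l : List (ℕ × ℕ)} (h : IsAltPath C l) (hC : C ⊆ C')
    (h' : ∀ e ∈ links l, ∀ f ∈ C', f ∉ C → ¬ Interlace e f) : IsAltPath C' l where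
  mem p hp := (h.mem p hp).imp (@hC _) (@hC _)
  disjoint := h.disjoint
  not_interlace e he f hf := by
    by_cases hfC : f ∈ C
    · exact h.not_interlace e he f hfC
    · exact h' e he f hf hfC
  pairwise := h.pairwise

theorem range {C : Set (ℕ × ℕ)} {l : List (ℕ × ℕ)} (h : IsAltPath C l) {a b : ℕ}
    (hC : ∀ p ∈ C, (a ≤ p.1 ∧ p.1 < b) ∧ a ≤ p.2 ∧ p.2 < b) {p : ℕ × ℕ} (hp : p ∈ l) :
    (a ≤ p.1 ∧ p.1 < b) ∧ a ≤ p.2 ∧ p.2 < b := by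
  rcases h.mem p hp with h | h
  · exact hC p h
  · exact (hC _ h).symm

theorem range_links {C : Set (ℕ × ℕ)} {l : List (ℕ × ℕ)} (h : IsAltPath C l) {a b : ℕ}
    (hC : ∀ p ∈ C, (a ≤ p.1 ∧ p.1 < b) ∧ a ≤ p.2 ∧ p.2 < b) {e : ℕ × ℕ} (he : e ∈ links l) :
    (a ≤ e.1 ∧ e.1 < b) ∧ a ≤ e.2 ∧ e.2 < b := by
  obtain ⟨⟨p, hp, hp'⟩, q, hq, hq'⟩ := fst_or_snd_of_mem_links he
  rw [hp', hq']
  exact ⟨(h.range hC hp).2, (h.range hC hq).1⟩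

/-- Paths in two consecutive intervals `[a, m)` and `[m, b)` can be joined if the first one ends at
one end of its interval and the second one starts at one end of its interval. -/
theorem append {C₁ C₂ : Set (ℕ × ℕ)} {l₁ l₂ : List (ℕ × ℕ)} (h₁ : IsAltPath C₁ l₁)
    (h₂ : IsAltPath C₂ l₂) {a m b : ℕ}
    (hC₁ : ∀ p ∈ C₁, (a ≤ p.1 ∧ p.1 < m) ∧ a ≤ p.2 ∧ p.2 < m)
    (hC₂ : ∀ p ∈ C₂, (m ≤ p.1 ∧ p.1 < b) ∧ m ≤ p.2 ∧ p.2 < b)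
    (hl₁ : ∀ p ∈ l₁.getLast?, p.2 = a ∨ p.2 + 1 = m)
    (hl₂ : ∀ p ∈ l₂.head?, p.1 = m ∨ p.1 + 1 = b) : IsAltPath (C₁ ∪ C₂) (l₁ ++ l₂) := by
  have hsep : ∀ e f : ℕ × ℕ, ((a ≤ e.1 ∧ e.1 < m) ∧ a ≤ e.2 ∧ e.2 < m) →
      ((m ≤ f.1 ∧ f.1 < b) ∧ m ≤ f.2 ∧ f.2 < b) → ¬ Interlace e f := by
    intro e f he hf
    simp only [Interlace]
    omega
  have h₁' : IsAltPath (C₁ ∪ C₂) l₁ := h₁.mono Set.subset_union_left fun e he f hf hf' =>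
    hsep e f (h₁.range_links hC₁ he) (hC₂ f (hf.resolve_left hf'))
  have h₂' : IsAltPath (C₁ ∪ C₂) l₂ := h₂.mono Set.subset_union_right fun e he f hf hf' h =>
    hsep f e (hC₁ f (hf.resolve_right hf')) (h₂.range_links hC₂ he) h.symm
  rcases List.eq_nil_or_concat l₁ with rfl | ⟨l₁, p, rfl⟩
  · simpa using h₂'
  rcases l₂ with _ | ⟨q, l₂⟩
  · simpa using h₁'
  simp only [List.concat_eq_append] at *
  simp only [List.getLast?_append, List.getLast?_singleton, Option.some_or, Option.mem_def,
    Option.some.injEq, forall_eq', List.head?_cons] at hl₁ hl₂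
  have hp := h₁.range hC₁ (p := p) (by simp)
  have hq := h₂.range hC₂ (p := q) (by simp)
  have hlinks : links (l₁ ++ [p] ++ q :: l₂) =
      links (l₁ ++ [p]) ++ (p.2, q.1) :: links (q :: l₂) := by
    rw [List.append_assoc, List.singleton_append, links_append]
  -- the new connecting pair joins the ends of the two intervals and so cuts off neither interval
  have hnew₁ : ∀ e : ℕ × ℕ, ((a ≤ e.1 ∧ e.1 < m) ∧ a ≤ e.2 ∧ e.2 < m) →
      ¬ Interlace (p.2, q.1) e := by
    intro e he
    simp only [Interlace]
    omega
  have hnew₂ : ∀ e : ℕ × ℕ, ((m ≤ e.1 ∧ e.1 < b) ∧ m ≤ e.2 ∧ e.2 < b) →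
      ¬ Interlace (p.2, q.1) e := by
    intro e he
    simp only [Interlace]
    omega
  refine ⟨?_, ?_, ?_, ?_⟩
  · intro x hx
    rcases List.mem_append.1 hx with hx | hx
    · exact h₁'.mem x hx
    · exact h₂'.mem x hx
  · refine List.pairwise_append.2 ⟨h₁.disjoint, h₂.disjoint, fun x hx y hy => ?_⟩
    have := h₁.range hC₁ hx
    have := h₂.range hC₂ hy
    omega
  · intro e he f hf
    rw [hlinks, List.mem_append, List.mem_cons] at he
    rcases he with he | rfl | he
    · exact h₁'.not_interlace e he f hf
    · exact hf.elim (fun hf => hnew₁ f (hC₁ f hf)) fun hf => hnew₂ f (hC₂ f hf)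
    · exact h₂'.not_interlace e he f hf
  · rw [hlinks]
    refine List.pairwise_append.2 ⟨h₁.pairwise, List.pairwise_cons.2
      ⟨fun e he => hnew₂ e (h₂.range_links hC₂ he), h₂.pairwise⟩, fun e he f hf => ?_⟩
    rcases List.mem_cons.1 hf with rfl | hf
    · exact fun h => hnew₁ e (h₁.range_links hC₁ he) h.symm
    · exact hsep e f (h₁.range_links hC₁ he) (h₂.range_links hC₂ hf)

/-- A path in the interval `(a, m)` that starts at one end of this interval can be preceded by the
chord from `m` to `a`. -/
theorem cons_enclosing {C : Set (ℕ × ℕ)} {l : List (ℕ × ℕ)} (h : IsAltPath C l) {a m : ℕ}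
    (ham : a < m) (hC : ∀ p ∈ C, (a + 1 ≤ p.1 ∧ p.1 < m) ∧ a + 1 ≤ p.2 ∧ p.2 < m)
    (hl : ∀ p ∈ l.head?, p.1 = a + 1 ∨ p.1 + 1 = m) :
    IsAltPath (insert (a, m) C) ((m, a) :: l) := by
  have hin : ∀ e : ℕ × ℕ, ((a + 1 ≤ e.1 ∧ e.1 < m) ∧ a + 1 ≤ e.2 ∧ e.2 < m) →
      ¬ Interlace e (a, m) := by
    intro e he
    simp only [Interlace]
    omega
  have h' : IsAltPath (insert (a, m) C) l := h.mono (Set.subset_insert _ _) fun e he f hf hf' => by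
    obtain rfl : f = (a, m) := hf.resolve_right hf'
    exact hin e (h.range_links hC he)
  rcases l with _ | ⟨q, l⟩
  · exact singleton (by simp)
  simp only [List.head?_cons, Option.mem_def, Option.some.injEq, forall_eq'] at hl
  have hnew : ∀ e : ℕ × ℕ, ((a + 1 ≤ e.1 ∧ e.1 < m) ∧ a + 1 ≤ e.2 ∧ e.2 < m) →
      ¬ Interlace (a, q.1) e := by
    intro e he
    simp only [Interlace]
    omega
  refine ⟨?_, ?_, ?_, ?_⟩
  · rintro x (_ | ⟨_, hx⟩)
    · simp
    · exact h'.mem x hx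
  · refine List.pairwise_cons.2 ⟨fun x hx => ?_, h.disjoint⟩
    have := h.range hC hx
    omega
  · intro e he f hf
    rcases List.mem_cons.1 he with rfl | he
    · rcases hf with rfl | hf
      · simp only [Interlace]
        omega
      · exact hnew f (hC f hf)
    · exact h'.not_interlace e he f hf
  · exact List.pairwise_cons.2 ⟨fun e he => hnew e (h.range_links hC he), h.pairwise⟩

end IsAltPath

namespace PlaneForest

/-- The pairs of matching parentheses of a plane forest, where the positions of the parentheses are
numbered from `a` on. -/
def chords : PlaneForest → ℕ → Set (ℕ × ℕ)
  | nil, _ => ∅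
  | cons c r, a => insert (a, a + 1 + 2 * c.size) (c.chords (a + 1)) ∪
      r.chords (a + 1 + 2 * c.size + 1)

theorem chords_range {φ : PlaneForest} {a : ℕ} {p : ℕ × ℕ} (hp : p ∈ φ.chords a) :
    (a ≤ p.1 ∧ p.1 < a + 2 * φ.size) ∧ a ≤ p.2 ∧ p.2 < a + 2 * φ.size := by
  induction φ generalizing a with
  | nil => exact hp.elim
  | cons c r ihc ihr =>
    simp only [size]
    rcases hp with (rfl | hp) | hp
    · dsimp only
      omega
    · have := ihc hp
      omega
    · have := ihr hp
      omega

/-- A path that ends up to the left of a forest can start with a sweep over the roots of the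
forest. -/
theorem exists_sweep {C : Set (ℕ × ℕ)} {l : List (ℕ × ℕ)} {a : ℕ} (h : IsAltPath C l)
    (hl : l ≠ []) (hC : ∀ p ∈ C, p.1 < a ∧ p.2 < a) (hhead : ∀ p ∈ l.head?, p.1 + 1 = a)
    (r : PlaneForest) :
    ∃ l', IsAltPath (C ∪ r.chords a) l' ∧ l' ≠ [] ∧ l'.length = r.numTrees + l.length ∧
      ∀ p ∈ l'.head?, p.1 + 1 = a + 2 * r.size := by
  induction r generalizing C l a with
  | nil => exact ⟨l, by simpa [chords] using h, hl, by simp [numTrees], by simpa [size] using hhead⟩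
  | cons c r _ ihr =>
    have h1 : IsAltPath (insert (a, a + 1 + 2 * c.size) (c.chords (a + 1)))
        [(a, a + 1 + 2 * c.size)] := .singleton (by simp)
    have hrange : ∀ p ∈ insert (a, a + 1 + 2 * c.size) (c.chords (a + 1)),
        (a ≤ p.1 ∧ p.1 < a + 1 + 2 * c.size + 1) ∧ a ≤ p.2 ∧ p.2 < a + 1 + 2 * c.size + 1 := by
      rintro p (rfl | hp)
      · dsimp only
        omega
      · have := chords_range hp
        omega
    have h2 := h.reverse.append h1 (a := 0) (m := a) (b := a + 1 + 2 * c.size + 1)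
      (fun p hp => ⟨⟨Nat.zero_le _, (hC p hp).1⟩, Nat.zero_le _, (hC p hp).2⟩) hrange
      (fun p hp => by
        rw [List.getLast?_reverse, List.head?_map, Option.mem_def, Option.map_eq_some_iff] at hp
        obtain ⟨q, hq, rfl⟩ := hp
        exact Or.inr (hhead q hq))
      (by simp)
    have h3 := h2.reverse
    simp only [List.map_append, List.map_reverse, List.map_map, Prod.swap_swap_eq, List.map_id,
      List.reverse_append, List.reverse_reverse] at h3
    obtain ⟨l', h', hl', hlen, hhead'⟩ := ihr (a := a + 1 + 2 * c.size + 1) h3 (by simp)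
      (by
        rintro p (hp | hp)
        · have := hC p hp
          omega
        · exact ⟨(hrange p hp).1.2, (hrange p hp).2.2⟩)
      (by simp)
    refine ⟨l', ?_, hl', ?_, fun p hp => ?_⟩
    · rwa [chords, ← Set.union_assoc]
    · rw [hlen]
      simp only [numTrees, List.map_cons, List.map_nil, List.reverse_cons, List.reverse_nil,
        List.nil_append, List.singleton_append, List.length_cons]
      omega
    · rw [hhead' p hp]
      simp only [size]
      omega

/-- The longest descent into a forest is realised by an alternating path that starts at an end of
the interval of the forest. If the path turns into the first tree, then it sweeps over the other
trees before. -/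
theorem exists_descending_path (φ : PlaneForest) (a : ℕ) :
    ∃ l, IsAltPath (φ.chords a) l ∧ l.length = φ.height ∧
      ∀ p ∈ l.head?, p.1 = a ∨ p.1 + 1 = a + 2 * φ.size := by
  induction φ generalizing a with
  | nil => exact ⟨[], .nil _, rfl, by simp⟩
  | cons c r ihc ihr =>
    have hrange : ∀ p ∈ c.chords (a + 1), (a + 1 ≤ p.1 ∧ p.1 < a + 1 + 2 * c.size) ∧
        a + 1 ≤ p.2 ∧ p.2 < a + 1 + 2 * c.size := fun p hp => chords_range hp
    have hrange' : ∀ p ∈ insert (a, a + 1 + 2 * c.size) (c.chords (a + 1)),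
        (a ≤ p.1 ∧ p.1 < a + 1 + 2 * c.size + 1) ∧ a ≤ p.2 ∧ p.2 < a + 1 + 2 * c.size + 1 := by
      rintro p (rfl | hp)
      · dsimp only
        omega
      · have := chords_range hp
        omega
    rcases le_total c.height r.maxHeight with hle | hle
    · obtain ⟨l, hl, hlen, hhead⟩ := ihr (a + 1 + 2 * c.size + 1)
      refine ⟨(a, a + 1 + 2 * c.size) :: l, ?_, ?_, by simp⟩
      · exact IsAltPath.append (l₁ := [(a, a + 1 + 2 * c.size)]) (.singleton (by simp)) hl hrange'
          (fun p hp => chords_range hp) (by simp) hhead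
      · have : max c.height r.maxHeight = r.maxHeight := max_eq_right hle
        rw [List.length_cons, hlen]
        simp only [height, numTrees, maxHeight] at this ⊢
        omega
    · obtain ⟨l, hl, hlen, hhead⟩ := ihc (a + 1)
      obtain ⟨l', hl', -, hlen', hhead'⟩ := exists_sweep
        (hl.cons_enclosing (m := a + 1 + 2 * c.size) (by omega) hrange hhead) (by simp)
        (fun p hp => ⟨(hrange' p hp).1.2, (hrange' p hp).2.2⟩) (by simp) r
      refine ⟨l', hl', ?_, fun p hp => Or.inr ?_⟩
      · have : max c.height r.maxHeight = c.height := max_eq_left hle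
        rw [hlen', List.length_cons, hlen]
        simp only [height, numTrees, maxHeight] at this ⊢
        omega
      · rw [hhead' p hp]
        simp only [size]
        omega

/-- Descending paths on the two sides of an edge combine to a path through the edge. -/
theorem exists_path_cons (A B : PlaneForest) :
    ∃ l, IsAltPath ((cons A B).chords 0) l ∧ l.length = A.height + B.height + 1 := by
  obtain ⟨l₁, h₁, hlen₁, hhead₁⟩ := exists_descending_path A (0 + 1)
  obtain ⟨l₂, h₂, hlen₂, hhead₂⟩ := exists_descending_path B (0 + 1 + 2 * A.size + 1)
  have h := (h₁.cons_enclosing (a := 0) (m := 0 + 1 + 2 * A.size) (by omega)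
    (fun p hp => chords_range hp) hhead₁).reverse
  refine ⟨_, h.append h₂ (a := 0) (m := 0 + 1 + 2 * A.size + 1) ?_ (fun p hp => chords_range hp) ?_
    hhead₂, ?_⟩
  · rintro p (rfl | hp)
    · dsimp only
      omega
    · have := chords_range hp
      omega
  · simp
  · simp only [List.map_cons, List.reverse_cons, List.length_append, List.length_reverse,
      List.length_map, List.length_cons, List.length_nil, hlen₁, hlen₂]
    omega

end PlaneForest

/-! ### Points in convex position -/

/-- Twice the signed area of the triangle `a b c`; it is positive if and only if the triangle is
oriented counterclockwise. -/
def orient (a b c : Plane) : ℝ :=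
  (b 0 - a 0) * (c 1 - a 1) - (b 1 - a 1) * (c 0 - a 0)

theorem orient_rotate (a b c : Plane) : orient b c a = orient a b c := by
  simp only [orient]; ring

theorem orient_swap (a b c : Plane) : orient b a c = -orient a b c := by
  simp only [orient]; ring

theorem orient_combo (a b c d : Plane) {s t : ℝ} (hst : s + t = 1) :
    orient a b (s • c + t • d) = s * orient a b c + t * orient a b d := by
  obtain rfl : s = 1 - t := by linarith
  simp only [orient, PiLp.add_apply, PiLp.smul_apply, smul_eq_mul]
  ring

@[simp] theorem orient_self_right (a b : Plane) : orient a b b = 0 := by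
  simp only [orient]; ring

@[simp] theorem orient_self_left (a b : Plane) : orient a b a = 0 := by
  simp only [orient]; ring

theorem plane_ext {a b : Plane} (h0 : a 0 = b 0) (h1 : a 1 = b 1) : a = b := by
  ext i
  fin_cases i
  · exact h0
  · exact h1

theorem disjoint_segment_of_orient {a b c d : Plane} (h : 0 < orient a b c * orient a b d) :
    Disjoint (segment ℝ a b) (segment ℝ c d) := by
  rw [Set.disjoint_left]
  rintro x ⟨s, t, -, -, hst, rfl⟩ ⟨s', t', hs', ht', hst', hx⟩
  have h0 : orient a b (s • a + t • b) = 0 := by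
    rw [orient_combo _ _ _ _ hst]; simp
  rw [← hx, orient_combo _ _ _ _ hst'] at h0
  rcases hs'.eq_or_lt with rfl | hs'
  · obtain rfl : t' = 1 := by linarith
    have : orient a b d = 0 := by linarith
    simp [this] at h
  · have h1 := congrArg (· * orient a b d) h0
    simp only [zero_mul] at h1
    linarith [mul_nonneg ht' (sq_nonneg (orient a b d)), mul_pos hs' h]

theorem segment_inter_segment_of_orient {a b c : Plane} (h : orient a b c ≠ 0) :
    segment ℝ a b ∩ segment ℝ b c = {b} := by
  refine Set.eq_singleton_iff_unique_mem.2
    ⟨⟨right_mem_segment ℝ a b, left_mem_segment ℝ b c⟩, ?_⟩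
  rintro x ⟨⟨s, t, -, -, hst, rfl⟩, s', t', -, -, hst', hx⟩
  have h0 : orient a b (s • a + t • b) = 0 := by
    rw [orient_combo _ _ _ _ hst]; simp
  have h1 := h0
  rw [← hx, orient_combo _ _ _ _ hst'] at h1
  have ht' : t' = 0 := by simpa [h] using h1
  obtain rfl : s' = 1 := by linarith
  rw [← hx, ht']
  simp

/-- The diagonals of a convex quadrilateral cross. -/
theorem not_disjoint_segment_of_orient {a b c d : Plane} (habc : 0 < orient a b c)
    (habd : 0 < orient a b d) (hacd : 0 < orient a c d) (hbcd : 0 < orient b c d) :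
    ¬ Disjoint (segment ℝ a c) (segment ℝ b d) := by
  have hsum : orient a c d + orient a b c = orient b c d + orient a b d := by
    simp only [orient]; ring
  have hpos : 0 < orient a c d + orient a b c := by positivity
  rw [Set.not_disjoint_iff]
  refine ⟨(orient b c d / (orient a c d + orient a b c)) • a +
    (orient a b d / (orient a c d + orient a b c)) • c,
    ⟨_, _, by positivity, by positivity, ?_, rfl⟩,
    ⟨orient a c d / (orient a c d + orient a b c), orient a b c / (orient a c d + orient a b c),
      by positivity, by positivity, ?_, ?_⟩⟩
  · rw [hsum] at hpos ⊢
    field_simp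
  · field_simp
  · apply plane_ext
    all_goals
      simp only [PiLp.add_apply, PiLp.smul_apply, smul_eq_mul]
      field_simp
      simp only [orient]
      ring

theorem mem_convexHull_of_orient {x y z p : Plane} (h₁ : 0 < orient x y p) (h₂ : 0 < orient y z p)
    (h₃ : 0 < orient z x p) : p ∈ convexHull ℝ {x, y, z} := by
  have hpos : 0 < orient x y p + orient y z p + orient z x p := by positivity
  rw [convexHull_insert ⟨y, by simp⟩, convexHull_pair, mem_convexJoin]
  refine ⟨x, rfl, (orient z x p / (orient z x p + orient x y p)) • y +
    (orient x y p / (orient z x p + orient x y p)) • z,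
    ⟨_, _, by positivity, by positivity, by field_simp, rfl⟩,
    orient y z p / (orient x y p + orient y z p + orient z x p),
    (orient z x p + orient x y p) / (orient x y p + orient y z p + orient z x p),
    by positivity, by positivity, by field_simp; ring, ?_⟩
  apply plane_ext
  all_goals
    simp only [PiLp.add_apply, PiLp.smul_apply, smul_eq_mul]
    field_simp
    simp only [orient]
    ring

section ConvexIndependent

variable {ι : Type*} {P : ι → Plane}

theorem ConvexIndependent.eq_or_eq_of_mem_segment (hP : ConvexIndependent ℝ P) {x y z : ι}
    (h : P x ∈ segment ℝ (P y) (P z)) : x = y ∨ x = z := by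
  have := hP {y, z} x (by rwa [Set.image_pair, convexHull_pair])
  simpa using this

theorem ConvexIndependent.not_orient_pos (hP : ConvexIndependent ℝ P) {x y z p : ι}
    (hx : p ≠ x) (hy : p ≠ y) (hz : p ≠ z) (h₁ : 0 < orient (P x) (P y) (P p))
    (h₂ : 0 < orient (P y) (P z) (P p)) : ¬ 0 < orient (P z) (P x) (P p) := by
  intro h₃
  have := hP {x, y, z} p (by
    rw [Set.image_insert_eq, Set.image_pair]
    exact mem_convexHull_of_orient h₁ h₂ h₃)
  simp [hx, hy, hz] at this

theorem ConvexIndependent.orient_ne_zero (hP : ConvexIndependent ℝ P) {x y z : ι}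
    (hxy : x ≠ y) (hxz : x ≠ z) (hyz : y ≠ z) : orient (P x) (P y) (P z) ≠ 0 := by
  intro h
  have hne : P y ≠ P x := fun h => hxy (hP.injective h).symm
  -- the point `P z` lies on the line through `P x` and `P y`
  obtain ⟨t, ht⟩ : ∃ t : ℝ, P z = P x + t • (P y - P x) := by
    have h01 : P y 0 - P x 0 ≠ 0 ∨ P y 1 - P x 1 ≠ 0 := by
      by_contra hcon
      push Not at hcon
      exact hne (plane_ext (by linarith [hcon.1]) (by linarith [hcon.2]))
    simp only [orient] at h
    rcases h01 with h0 | h0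
    · refine ⟨(P z 0 - P x 0) / (P y 0 - P x 0), plane_ext ?_ ?_⟩ <;>
        simp only [PiLp.add_apply, PiLp.smul_apply, PiLp.sub_apply, smul_eq_mul] <;>
        field_simp <;> linarith
    · refine ⟨(P z 1 - P x 1) / (P y 1 - P x 1), plane_ext ?_ ?_⟩ <;>
        simp only [PiLp.add_apply, PiLp.smul_apply, PiLp.sub_apply, smul_eq_mul] <;>
        field_simp <;> linarith
  have hz (i : Fin 2) : P z i = P x i + t * (P y i - P x i) := by
    rw [ht]; simp
  rcases lt_or_ge t 0 with h0 | h0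
  · have hpos : 0 < 1 - t := by linarith
    rcases hP.eq_or_eq_of_mem_segment (x := x) (y := y) (z := z)
      ⟨-t / (1 - t), 1 / (1 - t), div_nonneg (by linarith) hpos.le, by positivity,
        by field_simp; ring, by
          apply plane_ext <;>
            simp only [PiLp.add_apply, PiLp.smul_apply, smul_eq_mul, hz] <;> field_simp <;>
            ring⟩ with h | h
    · exact hxy h
    · exact hxz h
  · rcases le_or_gt t 1 with h1 | h1
    · rcases hP.eq_or_eq_of_mem_segment (x := z) (y := x) (z := y)
        ⟨1 - t, t, by linarith, h0, by ring, by
          apply plane_ext <;>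
            simp only [PiLp.add_apply, PiLp.smul_apply, smul_eq_mul, hz] <;> ring⟩ with h | h
      · exact hxz h.symm
      · exact hyz h.symm
    · have hpos : 0 < t := by linarith
      rcases hP.eq_or_eq_of_mem_segment (x := y) (y := x) (z := z)
        ⟨(t - 1) / t, 1 / t, div_nonneg (by linarith) hpos.le, by positivity,
          by field_simp; ring, by
          apply plane_ext <;>
            simp only [PiLp.add_apply, PiLp.smul_apply, smul_eq_mul, hz] <;> field_simp <;>
            ring⟩ with h | h
      · exact hxy h.symm
      · exact hyz h

/-- Points in convex position can be numbered in counterclockwise order: they are sorted by their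
angle at one of them. -/
theorem ConvexIndependent.exists_equiv_orient_pos [Fintype ι] [Nonempty ι]
    (hP : ConvexIndependent ℝ P) : ∃ e : Fin (Fintype.card ι) ≃ ι,
      ∀ a b c, a < b → b < c → 0 < orient (P (e a)) (P (e b)) (P (e c)) := by
  classical
  obtain ⟨o⟩ := ‹Nonempty ι›
  let r : ι → ι → Prop := fun x y =>
    x ≠ y ∧ (x = o ∨ (y ≠ o ∧ 0 < orient (P o) (P x) (P y)))
  have hirr : ∀ x, ¬ r x x := fun x h => h.1 rfl
  have htrans : ∀ x y z, r x y → r y z → r x z := by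
    rintro x y z ⟨hxy, hx⟩ ⟨hyz, hy⟩
    rcases hx with rfl | ⟨hyo, hx⟩
    · rcases hy with rfl | ⟨hzo, hy⟩
      · exact absurd rfl hxy
      · exact ⟨hzo.symm, Or.inl rfl⟩
    rcases hy with rfl | ⟨hzo, hy⟩
    · exact absurd rfl hyo
    have hxo : x ≠ o := by
      rintro rfl
      rw [orient_rotate] at hx
      simp at hx
    have hxz : x ≠ z := by
      rintro rfl
      rw [← orient_rotate, orient_swap] at hx
      rw [← orient_rotate] at hy
      linarith
    refine ⟨hxz, Or.inr ⟨hzo, ?_⟩⟩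
    -- otherwise the point `P o` would lie in the triangle of the other three
    by_contra hneg
    have hne := hP.orient_ne_zero hxo.symm hzo.symm hxz
    have hlt : orient (P o) (P x) (P z) < 0 := lt_of_le_of_ne (not_lt.1 hneg) hne
    refine hP.not_orient_pos hxo.symm hyo.symm hzo.symm (x := x) (y := y) (z := z) ?_ ?_ ?_
    · rwa [orient_rotate]
    · rwa [orient_rotate]
    · rw [orient_swap, ← orient_rotate (P x), ← orient_rotate (P z)]
      linarith
  have htri : ∀ x y, r x y ∨ x = y ∨ r y x := by
    intro x y
    by_cases hxy : x = y
    · exact Or.inr (Or.inl hxy)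
    by_cases hx : x = o
    · exact Or.inl ⟨hxy, Or.inl hx⟩
    by_cases hy : y = o
    · exact Or.inr (Or.inr ⟨Ne.symm hxy, Or.inl hy⟩)
    rcases lt_or_gt_of_ne (hP.orient_ne_zero (Ne.symm hx) (Ne.symm hy) hxy) with h | h
    · refine Or.inr (Or.inr ⟨Ne.symm hxy, Or.inr ⟨hx, ?_⟩⟩)
      rw [← orient_rotate, orient_swap, ← orient_rotate, ← orient_rotate]
      linarith
    · exact Or.inl ⟨hxy, Or.inr ⟨hy, h⟩⟩
  have : IsStrictTotalOrder ι r :=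
    { irrefl := hirr, trans := htrans, trichotomous := fun x y h1 h2 =>
        ((htri x y).resolve_left h1).resolve_right h2 }
  let : LinearOrder ι := linearOrderOfSTO r
  have hlt : ∀ x y : ι, x < y ↔ r x y := fun _ _ => Iff.rfl
  let e := Fintype.orderIsoFinOfCardEq ι rfl
  refine ⟨e.toEquiv, fun a b c hab hbc => ?_⟩
  have hab' := (hlt _ _).1 (e.lt_iff_lt.2 hab)
  have hbc' := (hlt _ _).1 (e.lt_iff_lt.2 hbc)
  have hac' := htrans _ _ _ hab' hbc'
  change 0 < orient (P (e a)) (P (e b)) (P (e c))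
  generalize e a = x at *
  generalize e b = y at *
  generalize e c = z at *
  obtain ⟨hxy, hx⟩ := hab'
  obtain ⟨hyz, hy⟩ := hbc'
  obtain ⟨hxz, hx'⟩ := hac'
  rcases hx with rfl | ⟨hyo, hx⟩
  · exact (hy.resolve_left hxy.symm).2
  have hxo : x ≠ o := by
    rintro rfl
    rw [orient_rotate] at hx
    simp at hx
  have hy := hy.resolve_left hyo
  have hx' := hx'.resolve_left hxo
  by_contra hneg
  have hlt : orient (P x) (P y) (P z) < 0 :=
    lt_of_le_of_ne (not_lt.1 hneg) (hP.orient_ne_zero hxy hxz hyz)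
  -- otherwise the point `P y` would lie in the triangle of the other three
  refine hP.not_orient_pos hyo hxy.symm hyz (x := o) (y := x) (z := z) hx ?_ ?_
  · rw [← orient_rotate, orient_swap, orient_rotate, orient_rotate]
    linarith [orient_rotate (P z) (P x) (P y)]
  · rw [← orient_rotate]
    exact hy.2

end ConvexIndependent

/-! ### Alternating paths through segments in convex position -/

/-- The other endpoint of the segment with the given endpoint. -/
def mate {n : ℕ} (x : Fin n × Bool) : Fin n × Bool := (x.1, !x.2)

@[simp] theorem mate_mate {n : ℕ} (x : Fin n × Bool) : mate (mate x) = x := by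
  simp [mate]

theorem mate_ne {n : ℕ} (x : Fin n × Bool) : mate x ≠ x := by
  intro h
  have := congrArg Prod.snd h
  simp [mate] at this

theorem eq_or_eq_mate {n : ℕ} {x y : Fin n × Bool} (h : x.1 = y.1) : x = y ∨ x = mate y := by
  obtain ⟨i, b⟩ := x
  obtain ⟨j, c⟩ := y
  obtain rfl : i = j := h
  cases b <;> cases c <;> simp [mate]

theorem famSegment_eq {n : ℕ} (S : Fin n × Bool → Plane) (x : Fin n × Bool) :
    famSegment S x.1 = segment ℝ (S x) (S (mate x)) := by
  obtain ⟨i, b⟩ := x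
  cases b
  · rfl
  · exact segment_symm ℝ _ _

theorem sym2_eq {n : ℕ} (S : Fin n × Bool → Plane) (x : Fin n × Bool) :
    s(S x, S (mate x)) = s(S (x.1, false), S (x.1, true)) := by
  obtain ⟨i, b⟩ := x
  cases b
  · rfl
  · exact Sym2.eq_swap

/-- A counterclockwise numbering, periodic with period `2 * n`, of the endpoints of `n` segments. -/
structure IsNumbering {n : ℕ} (S : Fin n × Bool → Plane) (pt : ℕ → Fin n × Bool) : Prop where
  periodic : ∀ i, pt (i + 2 * n) = pt i
  injOn : ∀ i j, i < 2 * n → j < 2 * n → pt i = pt j → i = j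
  surj : ∀ x, ∃ i, i < 2 * n ∧ pt i = x
  orient_pos : ∀ a b c, a < b → b < c → c < 2 * n →
    0 < orient (S (pt a)) (S (pt b)) (S (pt c))

theorem exists_isNumbering {n : ℕ} (hn : 1 ≤ n) {S : Fin n × Bool → Plane}
    (hS : ConvexIndependent ℝ S) : ∃ pt, IsNumbering S pt := by
  have : Nonempty (Fin n × Bool) := ⟨(⟨0, hn⟩, true)⟩
  obtain ⟨e, he⟩ := hS.exists_equiv_orient_pos
  have hcard : Fintype.card (Fin n × Bool) = 2 * n := by
    simp [mul_comm]
  generalize Fintype.card (Fin n × Bool) = N at *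
  subst hcard
  have hpos : 0 < 2 * n := by omega
  refine ⟨fun i => e ⟨i % (2 * n), Nat.mod_lt _ hpos⟩, fun i => by simp, ?_, ?_, ?_⟩
  · intro i j hi hj h
    simpa [Nat.mod_eq_of_lt hi, Nat.mod_eq_of_lt hj] using e.injective h
  · intro x
    refine ⟨e.symm x, (e.symm x).2, ?_⟩
    simp [Nat.mod_eq_of_lt (e.symm x).2]
  · intro a b c hab hbc hc
    apply he
    · simpa [Nat.mod_eq_of_lt (show a < 2 * n by omega),
        Nat.mod_eq_of_lt (show b < 2 * n by omega)] using hab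
    · simpa [Nat.mod_eq_of_lt (show c < 2 * n by omega),
        Nat.mod_eq_of_lt (show b < 2 * n by omega)] using hbc

namespace IsNumbering

variable {n : ℕ} {S : Fin n × Bool → Plane} {pt : ℕ → Fin n × Bool}

theorem rotate (h : IsNumbering S pt) : IsNumbering S fun i => pt (i + 1) where
  periodic i := by rw [← h.periodic (i + 1)]; congr 1; omega
  injOn i j hi hj hij := by
    have h0 : pt (2 * n) = pt 0 := by simpa using h.periodic 0
    rcases Nat.lt_or_ge (i + 1) (2 * n) with hi' | hi' <;>
      rcases Nat.lt_or_ge (j + 1) (2 * n) with hj' | hj'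
    · have := h.injOn _ _ hi' hj' hij
      omega
    · rw [show j + 1 = 2 * n by omega, h0] at hij
      have := h.injOn _ _ hi' (by omega) hij
      omega
    · rw [show i + 1 = 2 * n by omega, h0] at hij
      have := h.injOn _ _ (by omega) hj' hij
      omega
    · omega
  surj x := by
    obtain ⟨i, hi, rfl⟩ := h.surj x
    rcases Nat.eq_zero_or_pos i with rfl | hi0
    · exact ⟨2 * n - 1, by omega, by
        rw [show 2 * n - 1 + 1 = 0 + 2 * n by omega, h.periodic]⟩
    · exact ⟨i - 1, by omega, by rw [show i - 1 + 1 = i by omega]⟩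
  orient_pos a b c hab hbc hc := by
    rcases Nat.lt_or_ge (c + 1) (2 * n) with hc' | hc'
    · exact h.orient_pos _ _ _ (by omega) (by omega) hc'
    · rw [show c + 1 = 0 + 2 * n by omega, h.periodic, orient_rotate]
      exact h.orient_pos _ _ _ (by omega) (by omega) (by omega)

theorem orient_ne_zero (h : IsNumbering S pt) {a b c : ℕ} (ha : a < 2 * n) (hb : b < 2 * n)
    (hc : c < 2 * n) (hab : a ≠ b) (hac : a ≠ c) (hbc : b ≠ c) :
    orient (S (pt a)) (S (pt b)) (S (pt c)) ≠ 0 := by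
  have key : ∀ x y z, x < 2 * n → y < 2 * n → z < 2 * n → x < y → x < z → y ≠ z →
      orient (S (pt x)) (S (pt y)) (S (pt z)) ≠ 0 := by
    intro x y z hx hy hz hxy hxz hyz
    rcases lt_or_gt_of_ne hyz with hyz | hyz
    · exact (h.orient_pos x y z hxy hyz hz).ne'
    · have := h.orient_pos x z y hxz hyz hy
      rw [← orient_rotate, orient_swap, ← orient_rotate]
      linarith [orient_rotate (S (pt x)) (S (pt z)) (S (pt y)),
        orient_rotate (S (pt z)) (S (pt y)) (S (pt x))]
  rcases lt_or_ge a b with h1 | h1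
  · rcases lt_or_ge a c with h2 | h2
    · exact key a b c ha hb hc h1 h2 hbc
    · rw [← orient_rotate, ← orient_rotate]
      exact key c a b hc ha hb (by omega) (by omega) hab
  · rcases lt_or_ge b c with h2 | h2
    · rw [← orient_rotate]
      exact key b c a hb hc ha h2 (by omega) hac.symm
    · rw [← orient_rotate, ← orient_rotate]
      exact key c a b hc ha hb (by omega) (by omega) hab

theorem segment_inter_segment (h : IsNumbering S pt) {a b c : ℕ} (ha : a < 2 * n) (hb : b < 2 * n)
    (hc : c < 2 * n) (hab : a ≠ b) (hac : a ≠ c) (hbc : b ≠ c) :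
    segment ℝ (S (pt a)) (S (pt b)) ∩ segment ℝ (S (pt b)) (S (pt c)) = {S (pt b)} :=
  segment_inter_segment_of_orient (h.orient_ne_zero ha hb hc hab hac hbc)

/-- Segments between points in convex position are disjoint if their ends do not interlace. -/
theorem disjoint_segment (h : IsNumbering S pt) {a b c d : ℕ} (ha : a < 2 * n) (hb : b < 2 * n)
    (hc : c < 2 * n) (hd : d < 2 * n) (hab : a ≠ b) (hac : a ≠ c) (had : a ≠ d) (hbc : b ≠ c)
    (hbd : b ≠ d) (hI : ¬ Interlace (a, b) (c, d)) :
    Disjoint (segment ℝ (S (pt a)) (S (pt b))) (segment ℝ (S (pt c)) (S (pt d))) := by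
  have key : ∀ a b, a < 2 * n → b < 2 * n → a ≠ c → a ≠ d → b ≠ c → b ≠ d →
      ¬ Interlace (a, b) (c, d) → a < b →
      Disjoint (segment ℝ (S (pt a)) (S (pt b))) (segment ℝ (S (pt c)) (S (pt d))) := by
    clear hac had hbc hbd hab ha hb hI a b
    intro a b ha hb hac had hbc hbd hI hlt
    have hpos : ∀ x, x < 2 * n → x < a ∨ b < x → 0 < orient (S (pt a)) (S (pt b)) (S (pt x)) := by
      rintro x hx (hxa | hbx)
      · rw [orient_rotate]
        exact h.orient_pos _ _ _ hxa hlt hb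
      · exact h.orient_pos _ _ _ hlt hbx hx
    have hneg : ∀ x, a < x ∧ x < b → orient (S (pt a)) (S (pt b)) (S (pt x)) < 0 := by
      rintro x ⟨hax, hxb⟩
      have := h.orient_pos _ _ _ hax hxb hb
      rw [← orient_rotate, orient_swap, orient_rotate] at this
      linarith [orient_rotate (S (pt a)) (S (pt b)) (S (pt x)),
        orient_rotate (S (pt b)) (S (pt x)) (S (pt a))]
    apply disjoint_segment_of_orient
    by_cases hin : a < c ∧ c < b
    · have hin' : a < d ∧ d < b := by
        simp only [Interlace] at hI
        omega
      exact mul_pos_of_neg_of_neg (hneg c hin) (hneg d hin')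
    · have hin' : ¬ (a < d ∧ d < b) := by
        simp only [Interlace] at hI
        omega
      exact mul_pos (hpos c hc (by omega)) (hpos d hd (by omega))
  rcases lt_or_gt_of_ne hab with hlt | hlt
  · exact key a b ha hb hac had hbc hbd hI hlt
  · rw [segment_symm]
    refine key b a hb ha hbc hbd hac had (fun hI' => hI ?_) hlt
    rwa [← interlace_swap_left] at hI'

/-- Disjoint segments with endpoints in convex position do not interlace. -/
theorem not_interlace_mate (h : IsNumbering S pt) (hS : IsDisjointConvexFamily S) {a b c d : ℕ}
    (hab : a < b) (hbc : b < c) (hcd : c < d) (hd : d < 2 * n) (hac : mate (pt a) = pt c) :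
    mate (pt b) ≠ pt d := by
  intro hbd
  have hne : (pt a).1 ≠ (pt b).1 := by
    intro he
    rcases eq_or_eq_mate he with he | he
    · have := h.injOn _ _ (by omega) (by omega) he
      omega
    · have := h.injOn _ _ (by omega) (by omega) (he.trans hbd)
      omega
  refine not_disjoint_segment_of_orient (h.orient_pos a b c hab hbc (by omega))
    (h.orient_pos a b d hab (by omega) hd) (h.orient_pos a c d (by omega) hcd hd)
    (h.orient_pos b c d hbc hcd hd) ?_
  rw [← hac, ← hbd, ← famSegment_eq, ← famSegment_eq]
  exact hS.1 hne

end IsNumbering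

namespace PlaneForest

theorem chords_append (φ ψ : PlaneForest) (a : ℕ) :
    (φ.append ψ).chords a = φ.chords a ∪ ψ.chords (a + 2 * φ.size) := by
  induction φ generalizing a with
  | nil => simp [append, chords, size]
  | cons c r _ ih =>
    simp only [append, chords, ih, size, Set.union_assoc]
    rw [show a + 1 + 2 * c.size + 1 + 2 * r.size = a + 2 * (c.size + 1 + r.size) by omega]

theorem add_one_mem_chords {φ : PlaneForest} {a : ℕ} {p : ℕ × ℕ} (hp : p ∈ φ.chords a) :
    (p.1 + 1, p.2 + 1) ∈ φ.chords (a + 1) := by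
  induction φ generalizing a with
  | nil => exact hp
  | cons c r ihc ihr =>
    simp only [chords] at hp ⊢
    rcases hp with (rfl | hp) | hp
    · refine Or.inl (Or.inl ?_)
      ext <;> dsimp only
      omega
    · exact Or.inl (Or.inr (ihc hp))
    · refine Or.inr ?_
      have := ihr hp
      rwa [show a + 1 + 2 * c.size + 1 + 1 = a + 1 + 1 + 2 * c.size + 1 by omega] at this

theorem exists_mem_chords {φ : PlaneForest} {a x : ℕ} (h : a ≤ x) (h' : x < a + 2 * φ.size) :
    ∃ p ∈ φ.chords a, p.1 = x ∨ p.2 = x := by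
  induction φ generalizing a with
  | nil => simp only [size] at h'; omega
  | cons c r ihc ihr =>
    simp only [size] at h'
    by_cases h1 : x = a ∨ x = a + 1 + 2 * c.size
    · exact ⟨_, Or.inl (Or.inl rfl), h1.imp Eq.symm Eq.symm⟩
    by_cases h2 : x < a + 1 + 2 * c.size
    · obtain ⟨p, hp, hpx⟩ := ihc (a := a + 1) (by omega) h2
      exact ⟨p, Or.inl (Or.inr hp), hpx⟩
    · obtain ⟨p, hp, hpx⟩ := ihr (a := a + 1 + 2 * c.size + 1) (by omega) (by omega)
      exact ⟨p, Or.inr hp, hpx⟩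

/-- Every noncrossing perfect matching `μ` of an interval is given by a plane forest. -/
theorem exists_chords_eq (μ : ℕ → ℕ) (len a : ℕ)
    (hmem : ∀ x, a ≤ x → x < a + len → a ≤ μ x ∧ μ x < a + len)
    (hinv : ∀ x, a ≤ x → x < a + len → μ (μ x) = x)
    (hne : ∀ x, a ≤ x → x < a + len → μ x ≠ x)
    (hcross : ∀ x y, a ≤ x → x < y → y < μ x → μ x < μ y → μ y < a + len → False) :
    ∃ φ : PlaneForest, 2 * φ.size = len ∧ ∀ p ∈ φ.chords a, μ p.1 = p.2 := by
  induction len using Nat.strong_induction_on generalizing a with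
  | _ len ih =>
    rcases Nat.eq_zero_or_pos len with rfl | hlen
    · exact ⟨nil, rfl, by simp [chords]⟩
    have ha := hmem a le_rfl (by omega)
    have hna := hne a le_rfl (by omega)
    have hia := hinv a le_rfl (by omega)
    -- the partner of `a` separates the interval into two parts
    have hinner : ∀ x, a + 1 ≤ x → x < μ a → a + 1 ≤ μ x ∧ μ x < μ a := by
      intro x hx hx'
      have h1 := hmem x (by omega) (by omega)
      have h2 := hinv x (by omega) (by omega)
      refine ⟨?_, ?_⟩
      · by_contra hcon
        obtain h3 : μ x = a := by omega
        rw [h3] at h2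
        omega
      · by_contra hcon
        rcases (not_lt.1 hcon).eq_or_lt with h3 | h3
        · rw [← h3, hia] at h2
          omega
        · exact hcross a x le_rfl (by omega) hx' h3 h1.2
    have houter : ∀ x, μ a + 1 ≤ x → x < a + len → μ a + 1 ≤ μ x ∧ μ x < a + len := by
      intro x hx hx'
      have h1 := hmem x (by omega) hx'
      have h2 := hinv x (by omega) hx'
      refine ⟨?_, h1.2⟩
      by_contra hcon
      rcases (show μ x = a ∨ μ x = μ a ∨ (a + 1 ≤ μ x ∧ μ x < μ a) by omega) with h3 | h3 | h3
      · rw [h3] at h2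
        omega
      · rw [h3, hia] at h2
        omega
      · have := hinner _ h3.1 h3.2
        omega
    obtain ⟨c, hc, hc'⟩ := ih (μ a - (a + 1)) (by omega) (a + 1)
      (fun x hx hx' => by have := hinner x hx (by omega); omega)
      (fun x hx hx' => hinv x (by omega) (by omega)) (fun x hx hx' => hne x (by omega) (by omega))
      (fun x y h1 h2 h3 h4 h5 => hcross x y (by omega) h2 h3 h4 (by omega))
    obtain ⟨r, hr, hr'⟩ := ih (a + len - (μ a + 1)) (by omega) (μ a + 1)
      (fun x hx hx' => by have := houter x hx (by omega); omega)
      (fun x hx hx' => hinv x (by omega) (by omega)) (fun x hx hx' => hne x (by omega) (by omega))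
      (fun x y h1 h2 h3 h4 h5 => hcross x y (by omega) h2 h3 h4 (by omega))
    have hμ : a + 1 + 2 * c.size = μ a := by omega
    refine ⟨cons c r, by simp only [size]; omega, ?_⟩
    rw [chords, hμ]
    rintro p ((rfl | hp) | hp)
    · rfl
    · exact hc' p hp
    · exact hr' p hp

/-- The plane forest `Φ` is the matching of the endpoints of the segments in the numbering `pt`. -/
def Represents {n : ℕ} (Φ : PlaneForest) (pt : ℕ → Fin n × Bool) : Prop :=
  Φ.size = n ∧ ∀ p ∈ Φ.chords 0, mate (pt p.1) = pt p.2

theorem exists_represents {n : ℕ} {S : Fin n × Bool → Plane} {pt : ℕ → Fin n × Bool}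
    (h : IsNumbering S pt) (hS : IsDisjointConvexFamily S) : ∃ Φ : PlaneForest,
      Φ.Represents pt := by
  choose μ hμ hμ' using fun x => h.surj (mate (pt x))
  obtain ⟨Φ, hΦ, hΦ'⟩ := exists_chords_eq μ (2 * n) 0 (fun x _ _ => by
      have := hμ x
      omega)
    (fun x _ hx => h.injOn _ _ (hμ _) (by omega) (by rw [hμ', hμ', mate_mate]))
    (fun x _ hx he => mate_ne (pt x) (by rw [← hμ', he]))
    (fun x y _ h1 h2 h3 h4 => h.not_interlace_mate hS h1 h2 h3 (by omega) (hμ' x).symm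
      (hμ' y).symm)
  exact ⟨Φ, by omega, fun p hp => by rw [← hμ', hΦ' p hp]⟩

theorem Represents.exists_of_isRotation {n : ℕ} {S : Fin n × Bool → Plane}
    {pt : ℕ → Fin n × Bool} (h : IsNumbering S pt) {Φ Ψ : PlaneForest} (hΦ : Φ.Represents pt)
    (hr : IsRotation Φ Ψ) : ∃ pt', IsNumbering S pt' ∧ Ψ.Represents pt' := by
  induction hr with
  | refl => exact ⟨pt, h, hΦ⟩
  | @step a b hr ih =>
    obtain ⟨pt', h', hsize, hrep⟩ := ih
    simp only [size] at hsize
    refine ⟨_, h'.rotate, by simp only [size_append, size]; omega, ?_⟩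
    rw [chords_append]
    simp only [chords] at hrep ⊢
    rintro p (hp | ((rfl | hp) | hp))
    · exact hrep _ (Or.inl (Or.inr (add_one_mem_chords hp)))
    · -- the parenthesis at `0`, which has been moved to the end
      have h0 := hrep (0, 0 + 1 + 2 * a.size) (Or.inl (Or.inl rfl))
      dsimp only at h0 ⊢
      rw [show 0 + 2 * a.size + 1 + 2 * b.size + 1 = 0 + 2 * n by omega, h'.periodic,
        show 0 + 2 * a.size + 1 = 0 + 1 + 2 * a.size by omega, ← h0, mate_mate]
    · refine hrep (p.1 + 1, p.2 + 1) (Or.inr ?_)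
      have := add_one_mem_chords hp
      rwa [show 0 + 2 * a.size + 1 + 1 = 0 + 1 + 2 * a.size + 1 by omega] at this
    · exact hp.elim

end PlaneForest

/-! ### From paths in the matching to polygonal chains -/

theorem length_links (l : List (ℕ × ℕ)) : (links l).length = l.length - 1 := by
  induction l with
  | nil => rfl
  | cons p l ih =>
    cases l with
    | nil => rfl
    | cons q l => simpa [links] using ih

theorem getElem_links (l : List (ℕ × ℕ)) (i : ℕ) (hi : i + 1 < l.length)
    (hi' : i < (links l).length) : (links l)[i] = (l[i].2, l[i + 1].1) := by
  induction l generalizing i with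
  | nil => simp at hi
  | cons p l ih =>
    cases l with
    | nil => simp at hi
    | cons q l =>
      cases i with
      | zero => rfl
      | succ i => exact ih i (by simpa using hi) (by simpa [links] using hi')

theorem admitsCompatiblePath_of_isAltPath {n : ℕ} {S : Fin n × Bool → Plane}
    {pt : ℕ → Fin n × Bool} (h : IsNumbering S pt) (hS : IsDisjointConvexFamily S)
    {Φ : PlaneForest} (hΦ : Φ.Represents pt) {l : List (ℕ × ℕ)} (hl : IsAltPath (Φ.chords 0) l)
    {k : ℕ} (hk : k ≤ l.length) : AdmitsCompatiblePath S k := by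
  obtain ⟨hsize, hrep⟩ := hΦ
  have hrange : ∀ p ∈ Φ.chords 0, (0 ≤ p.1 ∧ p.1 < 2 * n) ∧ 0 ≤ p.2 ∧ p.2 < 2 * n := by
    intro p hp
    have := PlaneForest.chords_range hp
    omega
  -- the positions of the vertices of the chain
  let W : ℕ → ℕ := fun i => if i % 2 = 0 then (l.getD (i / 2) (0, 0)).1
    else (l.getD (i / 2) (0, 0)).2
  have hW0 : ∀ i (hi : i < l.length), W (2 * i) = l[i].1 := by
    intro i hi
    simp [W, hi]
  have hW1 : ∀ i (hi : i < l.length), W (2 * i + 1) = l[i].2 := by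
    intro i hi
    simp [W, hi, show (2 * i + 1) / 2 = i by omega, show (2 * i + 1) % 2 = 1 by omega]
  have hWlt : ∀ i, i < 2 * l.length → W i < 2 * n := by
    intro i hi
    have := hl.range hrange (List.getElem_mem (show i / 2 < l.length by omega))
    rcases Nat.mod_two_eq_zero_or_one i with he | he
    · have h1 := hW0 (i / 2) (by omega)
      rw [show 2 * (i / 2) = i by omega] at h1
      omega
    · have h1 := hW1 (i / 2) (by omega)
      rw [show 2 * (i / 2) + 1 = i by omega] at h1
      omega
  have hmate : ∀ i, i < l.length → mate (pt (W (2 * i))) = pt (W (2 * i + 1)) := by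
    intro i hi
    rw [hW0 i hi, hW1 i hi]
    rcases hl.mem _ (List.getElem_mem hi) with hm | hm
    · exact hrep _ hm
    · have := hrep _ hm
      rw [Prod.fst_swap, Prod.snd_swap] at this
      rw [← this, mate_mate]
  have hWne' : ∀ i j, i < j → j < 2 * l.length → W i ≠ W j := by
    intro i j hij hj
    rcases Nat.lt_or_ge (i / 2) (j / 2) with hlt | hge
    · have hd := List.pairwise_iff_getElem.1 hl.disjoint (i / 2) (j / 2) (by omega) (by omega) hlt
      rw [← hW0 _ (by omega), ← hW0 _ (by omega), ← hW1 _ (by omega), ← hW1 _ (by omega)] at hd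
      rcases Nat.mod_two_eq_zero_or_one i with hi2 | hi2 <;>
        rcases Nat.mod_two_eq_zero_or_one j with hj2 | hj2
      · rw [show 2 * (i / 2) = i by omega, show 2 * (j / 2) = j by omega] at hd
        exact hd.1
      · rw [show 2 * (i / 2) = i by omega, show 2 * (j / 2) + 1 = j by omega] at hd
        exact hd.2.1
      · rw [show 2 * (i / 2) + 1 = i by omega, show 2 * (j / 2) = j by omega] at hd
        exact hd.2.2.1
      · rw [show 2 * (i / 2) + 1 = i by omega, show 2 * (j / 2) + 1 = j by omega] at hd
        exact hd.2.2.2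
    · intro he
      have hm := hmate (i / 2) (by omega)
      rw [show 2 * (i / 2) = i by omega, show i + 1 = j by omega, he] at hm
      exact mate_ne _ hm
  have hWne : ∀ i j, i ≠ j → i < 2 * l.length → j < 2 * l.length → W i ≠ W j := by
    intro i j hij hi hj
    rcases lt_or_gt_of_ne hij with h1 | h1
    · exact hWne' i j h1 hj
    · exact (hWne' j i h1 hi).symm
  have hlink : ∀ i, i + 1 < l.length → (W (2 * i + 1), W (2 * i + 1 + 1)) ∈ links l := by
    intro i hi
    rw [hW1 i (by omega), show 2 * i + 1 + 1 = 2 * (i + 1) by ring, hW0 (i + 1) hi,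
      ← getElem_links l i hi (by rw [length_links]; omega)]
    exact List.getElem_mem _
  have hpair : ∀ i j, i < j → j + 1 < l.length →
      ¬ Interlace (W (2 * i + 1), W (2 * i + 1 + 1)) (W (2 * j + 1), W (2 * j + 1 + 1)) := by
    intro i j hij hj
    have := List.pairwise_iff_getElem.1 hl.pairwise i j (by rw [length_links]; omega)
      (by rw [length_links]; omega) hij
    rw [getElem_links l i (by omega), getElem_links l j hj] at this
    rwa [hW1 i (by omega), show 2 * i + 1 + 1 = 2 * (i + 1) by ring, hW0 (i + 1) (by omega),
      hW1 j (by omega), show 2 * j + 1 + 1 = 2 * (j + 1) by ring, hW0 (j + 1) (by omega)]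
  have hchord : ∀ i a b, i + 1 < l.length → a < 2 * n → b < 2 * n → mate (pt a) = pt b →
      ¬ Interlace (W (2 * i + 1), W (2 * i + 1 + 1)) (a, b) := by
    intro i a b hi ha hb hab
    obtain ⟨p, hp, hpa⟩ := PlaneForest.exists_mem_chords (φ := Φ) (a := 0) (x := a)
      (Nat.zero_le _) (by omega)
    have hpr := hrange p hp
    have hpm := hrep p hp
    have hI := hl.not_interlace _ (hlink i hi) p hp
    rcases hpa with rfl | rfl
    · obtain rfl : p.2 = b := h.injOn _ _ hpr.2.2 hb (hpm.symm.trans hab)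
      exact hI
    · obtain rfl : p.1 = b := h.injOn _ _ hpr.1.2 hb (by rw [← hab, ← hpm, mate_mate])
      rwa [← interlace_swap_right] at hI
  -- an edge of the chain is disjoint from the segments that do not share a vertex with it
  have hedge : ∀ i a b, i + 1 < 2 * l.length → a < 2 * n → b < 2 * n → mate (pt a) = pt b →
      W i ≠ a → W i ≠ b → W (i + 1) ≠ a → W (i + 1) ≠ b →
      Disjoint (segment ℝ (S (pt (W i))) (S (pt (W (i + 1)))))
        (segment ℝ (S (pt a)) (S (pt b))) := by
    intro i a b hi ha hb hab h1 h2 h3 h4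
    rcases Nat.mod_two_eq_zero_or_one i with hi2 | hi2
    · have hm := hmate (i / 2) (by omega)
      rw [show 2 * (i / 2) = i by omega] at hm
      rw [← hm, ← hab, ← famSegment_eq, ← famSegment_eq]
      refine hS.1 fun he => ?_
      rcases eq_or_eq_mate he with he | he
      · exact h1 (h.injOn _ _ (hWlt i (by omega)) ha he)
      · exact h2 (h.injOn _ _ (hWlt i (by omega)) hb (he.trans hab))
    · refine h.disjoint_segment (hWlt i (by omega)) (hWlt _ hi) ha hb
        (hWne _ _ (by omega) (by omega) hi) h1 h2 h3 h4 ?_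
      have := hchord (i / 2) a b (by omega) ha hb hab
      rwa [show 2 * (i / 2) + 1 = i by omega] at this
  refine ⟨fun i => S (pt (W i)), 2 * k - 1, 0, ⟨⟨?_, ?_, ?_⟩, by norm_num, ?_⟩, ?_, ?_⟩
  · intro i hi he
    exact hWne i (i + 1) (by omega) (by omega) (by omega)
      (h.injOn _ _ (hWlt _ (by omega)) (hWlt _ (by omega)) (hS.2.injective he))
  · intro i hi
    exact h.segment_inter_segment (hWlt _ (by omega)) (hWlt _ (by omega)) (hWlt _ (by omega))
      (hWne _ _ (by omega) (by omega) (by omega)) (hWne _ _ (by omega) (by omega) (by omega))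
      (hWne _ _ (by omega) (by omega) (by omega))
  · intro i j hij hj
    have n1 := hWne i j (by omega) (by omega) (by omega)
    have n2 := hWne i (j + 1) (by omega) (by omega) (by omega)
    have n3 := hWne (i + 1) j (by omega) (by omega) (by omega)
    have n4 := hWne (i + 1) (j + 1) (by omega) (by omega) (by omega)
    have b1 := hWlt i (by omega)
    have b2 := hWlt (i + 1) (by omega)
    have b3 := hWlt j (by omega)
    have b4 := hWlt (j + 1) (by omega)
    rcases Nat.mod_two_eq_zero_or_one j with hj2 | hj2
    · have hm := hmate (j / 2) (by omega)
      rw [show 2 * (j / 2) = j by omega] at hm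
      exact hedge i _ _ (by omega) b3 b4 hm n1 n2 n3 n4
    rcases Nat.mod_two_eq_zero_or_one i with hi2 | hi2
    · have hm := hmate (i / 2) (by omega)
      rw [show 2 * (i / 2) = i by omega] at hm
      exact (hedge j _ _ (by omega) b1 b2 hm n1.symm n3.symm n2.symm n4.symm).symm
    · refine h.disjoint_segment b1 b2 b3 b4 (hWne _ _ (by omega) (by omega) (by omega))
        n1 n2 n3 n4 ?_
      have := hpair (i / 2) (j / 2) (by omega) (by omega)
      rwa [show 2 * (i / 2) + 1 = i by omega, show 2 * (j / 2) + 1 = j by omega] at this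
  · intro i hi hi2
    refine ⟨(pt (W i)).1, ?_⟩
    have hm := hmate (i / 2) (by omega)
    rw [show 2 * (i / 2) = i by omega] at hm
    unfold EdgeIsSegment
    dsimp only
    rw [← hm, sym2_eq]
  · intro j hj i hi
    obtain ⟨a, ha, hpa⟩ := h.surj (j, false)
    obtain ⟨b, hb, hpb⟩ := h.surj (j, true)
    -- otherwise the segment `j` would be an edge of the chain
    have hW : ∀ i', i' < 2 * k → (pt (W i')).1 ≠ j := by
      intro i' hi' he
      refine hj (2 * (i' / 2)) (by omega) ?_
      have hm := hmate (i' / 2) (by omega)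
      have he' : (pt (W (2 * (i' / 2)))).1 = j := by
        rcases Nat.mod_two_eq_zero_or_one i' with h2 | h2
        · rwa [show 2 * (i' / 2) = i' by omega]
        · rw [show 2 * (i' / 2) + 1 = i' by omega] at hm
          rw [← he, ← hm]
          rfl
      unfold EdgeIsSegment
      dsimp only
      rw [← hm, sym2_eq, he']
    have hWa : ∀ i', i' < 2 * k → W i' ≠ a := fun i' hi' he => hW i' hi' (by rw [he, hpa])
    have hWb : ∀ i', i' < 2 * k → W i' ≠ b := fun i' hi' he => hW i' hi' (by rw [he, hpb])
    have := hedge i a b (by omega) ha hb (by rw [hpa, hpb]; rfl) (hWa _ (by omega))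
      (hWb _ (by omega)) (hWa _ (by omega)) (hWb _ (by omega))
    rwa [hpa, hpb] at this
  · have : ((Finset.range (2 * k - 1)).filter fun i => i % 2 = 0) =
        (Finset.range k).image fun i => 2 * i := by
      ext i
      simp only [Finset.mem_filter, Finset.mem_range, Finset.mem_image]
      constructor
      · rintro ⟨h1, h2⟩
        exact ⟨i / 2, by omega, by omega⟩
      · rintro ⟨j, h1, rfl⟩
        omega
    rw [this, Finset.card_image_of_injective _ fun a b hab => by omega,
      Finset.card_range]

/-- Every family with more than `extremalSize k` segments admits a compatible alternating path
through `k + 1` of them. -/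
theorem mem_guaranteedPathSizes {n k : ℕ} (h : extremalSize k < n) :
    k + 1 ∈ guaranteedPathSizes n := by
  intro S hS
  obtain ⟨pt, hpt⟩ := exists_isNumbering (by omega) hS.2
  obtain ⟨Φ, hΦ⟩ := PlaneForest.exists_represents hpt hS
  obtain ⟨A, B, hr, hle⟩ := PlaneForest.exists_rotation_size_le (Φ := Φ) (by
    rintro rfl
    have := hΦ.1
    simp only [PlaneForest.size] at this
    omega)
  obtain ⟨pt', hpt', hΦ'⟩ := hΦ.exists_of_isRotation hpt hr
  obtain ⟨l, hl, hlen⟩ := PlaneForest.exists_path_cons A B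
  refine admitsCompatiblePath_of_isAltPath hpt' hS hΦ' hl ?_
  by_contra hcon
  have := extremalSize_mono (show A.height + B.height + 1 ≤ k by omega)
  have := hΦ.1
  omega

/-! ### Caterpillars from sequences of edges in a tree -/

namespace SimpleGraph

variable {V : Type} {T : SimpleGraph V}

/-- The subgraph of `T` that consists of the given edges and their ends. -/
def subgraphOfEdges (T : SimpleGraph V) (E : Set (Sym2 V)) (hE : E ⊆ T.edgeSet) : T.Subgraph where
  verts := {v | ∃ e ∈ E, v ∈ e}
  Adj v w := s(v, w) ∈ E
  adj_sub h := hE h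
  edge_vert h := ⟨_, h, Sym2.mem_mk_left _ _⟩
  symm := ⟨fun v w h => by rwa [Sym2.eq_swap]⟩

theorem edgeSet_subgraphOfEdges (E : Set (Sym2 V)) (hE : E ⊆ T.edgeSet) :
    (T.subgraphOfEdges E hE).edgeSet = E := by
  ext e
  induction e with
  | _ x y => rfl

theorem neighborSet_coe_encard_ne_one_of_two {H : T.Subgraph} {x : H.verts} {y z : V}
    (hy : H.Adj x y) (hz : H.Adj x z) (hyz : y ≠ z) : (H.coe.neighborSet x).encard ≠ 1 := by
  intro h
  obtain ⟨w, hw⟩ := Set.encard_eq_one.1 h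
  have h1 : (⟨y, hy.snd_mem⟩ : H.verts) ∈ H.coe.neighborSet x := hy
  have h2 : (⟨z, hz.snd_mem⟩ : H.verts) ∈ H.coe.neighborSet x := hz
  rw [hw, Set.mem_singleton_iff] at h1 h2
  exact hyz (congrArg Subtype.val (h1.trans h2.symm))

theorem neighborSet_coe_encard_eq_one {H : T.Subgraph} {x : H.verts} {y : V}
    (hy : H.Adj x y) (huniq : ∀ z, H.Adj x z → z = y) : (H.coe.neighborSet x).encard = 1 := by
  rw [Set.encard_eq_one]
  refine ⟨⟨y, hy.snd_mem⟩, ?_⟩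
  ext z
  simp only [mem_neighborSet, Subgraph.coe_adj, Set.mem_singleton_iff]
  constructor
  · intro h
    exact Subtype.ext (huniq _ h)
  · rintro rfl
    exact hy

/-- A vertex outside a path of a forest has at most one neighbour on the path. -/
theorem IsAcyclic.eq_of_adj_of_mem_support (hT : T.IsAcyclic) {a b x y z : V} {w : T.Walk a b}
    (hw : w.IsPath) (hx : x ∉ w.support) (hy : y ∈ w.support) (hz : z ∈ w.support)
    (hxy : T.Adj x y) (hxz : T.Adj x z) : y = z := by
  classical
  rw [← w.take_spec hz, Walk.mem_support_append_iff] at hy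
  rcases hy with hy | hy
  · have h1 : ((w.takeUntil z hz).concat hxz.symm).IsPath :=
      (hw.takeUntil hz).concat (fun h => hx (w.support_takeUntil_subset_support hz h)) _
    have := hT.eq_penultimate_of_adj_end h1 hxy (Walk.support_subset_support_concat _ _ hy)
    rwa [Walk.penultimate_concat] at this
  · have h1 : ((w.dropUntil z hz).reverse.concat hxz.symm).IsPath :=
      (hw.dropUntil hz).reverse.concat
        (fun h => hx (w.support_dropUntil_subset_support hz (by simpa using h))) _
    have := hT.eq_penultimate_of_adj_end h1 hxy
      (Walk.support_subset_support_concat _ _ (by simpa using hy))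
    rwa [Walk.penultimate_concat] at this

/-- In a forest, only consecutive vertices of a path are adjacent. -/
theorem IsAcyclic.adj_getVert_iff (hT : T.IsAcyclic) {a b : V} {w : T.Walk a b}
    (hw : w.IsPath) {i j : ℕ} (hi : i ≤ w.length) (hj : j ≤ w.length) :
    T.Adj (w.getVert i) (w.getVert j) ↔ i + 1 = j ∨ j + 1 = i := by
  have key : ∀ i j, i < j → j ≤ w.length → T.Adj (w.getVert j) (w.getVert i) → i + 1 = j := by
    intro i j hij hj h
    have h1 : w.getVert i ∈ (w.take j).support := by
      rw [Walk.mem_support_iff_exists_getVert]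
      refine ⟨i, ?_, ?_⟩
      · rw [Walk.take_getVert, min_eq_right hij.le]
      · rw [Walk.take_length]
        omega
    have h2 := hT.eq_penultimate_of_adj_end (hw.take j) h h1
    rw [Walk.penultimate, Walk.take_getVert, Walk.take_length] at h2
    have := hw.getVert_injOn (Set.mem_ofPred.2 (by omega)) (Set.mem_ofPred.2 (by omega)) h2
    omega
  constructor
  · intro h
    rcases lt_trichotomy i j with hij | rfl | hij
    · exact Or.inl (key i j hij hj h.symm)
    · exact absurd h (T.irrefl)
    · exact Or.inr (key j i hij hi h)
  · rintro (rfl | rfl)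
    · exact w.adj_getVert_succ (by omega)
    · exact (w.adj_getVert_succ (by omega)).symm

/-- If a path of a forest meets all edges of `H`, and its vertices are not leaves of `H`, then it is
the graph induced on the vertices of `H` that are not leaves. -/
theorem nonempty_iso_pathGraph (hT : T.IsAcyclic) {H : T.Subgraph} {a b : V} {w : T.Walk a b}
    (hw : w.IsPath) (hedges : ∀ e ∈ w.edges, e ∈ H.edgeSet)
    (hverts : ∀ x ∈ H.verts, ∃ y, H.Adj x y)
    (hcover : ∀ x y, H.Adj x y → x ∈ w.support ∨ y ∈ w.support)
    (htwo : ∀ x ∈ w.support, ∃ y z, y ≠ z ∧ H.Adj x y ∧ H.Adj x z) :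
    Nonempty (H.coe.induce {x | (H.coe.neighborSet x).encard ≠ 1} ≃g
      pathGraph (w.length + 1)) := by
  have hmem : ∀ x (hx : x ∈ w.support), ∃ h : x ∈ H.verts,
      (⟨x, h⟩ : H.verts) ∈ {x | (H.coe.neighborSet x).encard ≠ 1} := by
    intro x hx
    obtain ⟨y, z, hyz, hy, hz⟩ := htwo x hx
    exact ⟨hy.fst_mem, neighborSet_coe_encard_ne_one_of_two hy hz hyz⟩
  have hmem' : ∀ x : H.verts, (H.coe.neighborSet x).encard ≠ 1 → (x : V) ∈ w.support := by
    intro x hx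
    by_contra hxw
    obtain ⟨y, hy⟩ := hverts x x.2
    refine hx (neighborSet_coe_encard_eq_one hy fun z hz => ?_)
    exact hT.eq_of_adj_of_mem_support hw hxw ((hcover _ _ hz).resolve_left hxw)
      ((hcover _ _ hy).resolve_left hxw) hz.adj_sub hy.adj_sub
  let f : Fin (w.length + 1) → {x : H.verts | (H.coe.neighborSet x).encard ≠ 1} := fun i =>
    ⟨⟨w.getVert i, (hmem _ (w.getVert_mem_support i)).1⟩,
      (hmem _ (w.getVert_mem_support i)).2⟩
  have hf : Function.Bijective f := by
    constructor
    · intro i j hij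
      have h1 : w.getVert i = w.getVert j := congrArg (fun x => (x.1 : V)) hij
      exact Fin.ext (hw.getVert_injOn (Set.mem_ofPred.2 (by omega))
        (Set.mem_ofPred.2 (by omega)) h1)
    · rintro ⟨⟨x, hx⟩, hx'⟩
      obtain ⟨i, hi, hi'⟩ := Walk.mem_support_iff_exists_getVert.1 (hmem' _ hx')
      exact ⟨⟨i, by omega⟩, Subtype.ext (Subtype.ext hi)⟩
  refine ⟨Iso.symm ⟨Equiv.ofBijective f hf, ?_⟩⟩
  intro i j
  rw [pathGraph_adj]
  change H.Adj (w.getVert i) (w.getVert j) ↔ _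
  rw [← hT.adj_getVert_iff hw (show (i : ℕ) ≤ w.length by omega) (show (j : ℕ) ≤ w.length by omega)]
  refine ⟨fun h => h.adj_sub, fun h => ?_⟩
  rw [hT.adj_getVert_iff hw (by omega) (by omega)] at h
  have key : ∀ l, l < w.length → H.Adj (w.getVert l) (w.getVert (l + 1)) := fun l hl =>
    hedges _ ((Walk.mk_mem_edges_iff_exists w).2 ⟨l, hl, rfl⟩)
  rcases h with h | h
  · rw [← h]
    exact key i (by omega)
  · rw [← h]
    exact (key j (by omega)).symm

/-- The edges `e 0, …, e (k - 1)` have a spine: a path in `T` that meets all of them, whose edges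
are among them, and each of whose vertices lies on at least two of them. The last edge leads from
the end of the spine to a vertex outside. -/
theorem exists_spine (hT : T.IsAcyclic) {e : ℕ → Sym2 V} {k : ℕ} (hk : 2 ≤ k)
    (hmem : ∀ i < k, e i ∈ T.edgeSet) (hinj : ∀ i j, i < j → j < k → e i ≠ e j)
    (hadj : ∀ i, i + 1 < k → ∃ x, x ∈ e i ∧ x ∈ e (i + 1)) :
    ∃ (a b u : V) (w : T.Walk a b), w.IsPath ∧ e (k - 1) = s(b, u) ∧ u ∉ w.support ∧
      (∀ f ∈ w.edges, ∃ i < k, e i = f) ∧ (∀ i < k, ∃ x ∈ w.support, x ∈ e i) ∧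
      ∀ x ∈ w.support, ∃ i j, i < j ∧ j < k ∧ x ∈ e i ∧ x ∈ e j := by
  induction k, hk using Nat.le_induction with
  | base =>
    obtain ⟨v, hv0, hv1⟩ := hadj 0 (by norm_num)
    obtain ⟨u, hu⟩ := hv1
    have huv : T.Adj v u := by
      have := hmem 1 (by norm_num)
      rwa [show e 1 = s(v, u) from hu] at this
    refine ⟨v, v, u, .nil, by simp, hu, by simpa using huv.ne', by simp, ?_, ?_⟩
    · intro i hi
      refine ⟨v, by simp, ?_⟩
      interval_cases i
      · exact hv0
      · exact ⟨u, hu⟩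
    · intro x hx
      obtain rfl : x = v := by simpa using hx
      exact ⟨0, 1, by norm_num, by norm_num, hv0, u, hu⟩
  | succ k hk ih =>
    obtain ⟨a, b, u, w, hw, hlast, hu, hedges, hcover, htwo⟩ := ih
      (fun i hi => hmem i (by omega)) (fun i j hij hj => hinj i j hij (by omega))
      fun i hi => hadj i (by omega)
    obtain ⟨x, hx, hx'⟩ := hadj (k - 1) (by omega)
    rw [show k - 1 + 1 = k by omega] at hx'
    obtain ⟨u', hu'⟩ := hx'
    have hxu' : T.Adj x u' := by
      have := hmem k (by omega)
      rwa [hu'] at this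
    have hbu : T.Adj b u := by
      have := hmem (k - 1) (by omega)
      rwa [hlast] at this
    have hcoverk : ∀ {c d : V} {w' : T.Walk c d}, w.support ⊆ w'.support → x ∈ w'.support →
        ∀ i < k + 1, ∃ y ∈ w'.support, y ∈ e i := by
      intro c d w' hsub hxw i hi
      rcases Nat.lt_or_ge i k with hik | hik
      · obtain ⟨y, hy, hy'⟩ := hcover i hik
        exact ⟨y, hsub hy, hy'⟩
      · obtain rfl : i = k := by omega
        exact ⟨x, hxw, u', hu'⟩
    rw [hlast, Sym2.mem_iff] at hx
    rcases hx with rfl | rfl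
    · -- the new edge is attached to the end of the spine
      refine ⟨a, x, u', w, hw, hu', ?_, fun f hf => ?_, hcoverk (fun _ h => h) w.end_mem_support,
        fun y hy => ?_⟩
      · intro hu'w
        have hpen := hT.eq_penultimate_of_adj_end hw hxu' hu'w
        have hnil : ¬ w.Nil := by
          intro hnil
          have : u' = a := by simpa [Walk.nil_iff_support_eq.1 hnil] using hu'w
          have : x = a := by simpa [Walk.nil_iff_support_eq.1 hnil] using w.end_mem_support
          exact hxu'.ne (by simp_all)
        obtain ⟨i, hi, hi'⟩ := hedges s(w.penultimate, x) (Walk.mk_penultimate_end_mem_edges hnil)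
        refine hinj i k hi (by omega) ?_
        rw [hi', hu', ← hpen, Sym2.eq_swap]
      · obtain ⟨i, hi, hi'⟩ := hedges f hf
        exact ⟨i, by omega, hi'⟩
      · obtain ⟨i, j, h1, h2, h3⟩ := htwo y hy
        exact ⟨i, j, h1, by omega, h3⟩
    · -- the new edge is attached to the outer end of the last edge, which is added to the spine
      refine ⟨a, x, u', w.concat hbu, hw.concat hu hbu, hu', ?_, fun f hf => ?_,
        hcoverk (Walk.support_subset_support_concat _ _) (Walk.end_mem_support _), fun y hy => ?_⟩
      · intro hu'w
        have hpen := hT.eq_penultimate_of_adj_end (hw.concat hu hbu) hxu' hu'w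
        rw [Walk.penultimate_concat] at hpen
        refine hinj (k - 1) k (by omega) (by omega) ?_
        rw [hlast, hu', ← hpen, Sym2.eq_swap]
      · rw [Walk.edges_concat, List.concat_eq_append, List.mem_append, List.mem_singleton] at hf
        rcases hf with hf | rfl
        · obtain ⟨i, hi, hi'⟩ := hedges f hf
          exact ⟨i, by omega, hi'⟩
        · exact ⟨k - 1, by omega, hlast⟩
      · rw [Walk.support_concat, List.mem_append, List.mem_singleton] at hy
        rcases hy with hy | rfl
        · obtain ⟨i, j, h1, h2, h3⟩ := htwo y hy
          exact ⟨i, j, h1, by omega, h3⟩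
        · refine ⟨k - 1, k, by omega, by omega, ?_, u', hu'⟩
          rw [hlast]
          exact Sym2.mem_mk_right _ _

/-- Distinct edges of a tree, each of which has a common end with the next one, form a
caterpillar. -/
theorem IsTree.containsCaterpillar (hT : T.IsTree) {e : ℕ → Sym2 V} {k : ℕ}
    (hmem : ∀ i < k, e i ∈ T.edgeSet) (hinj : ∀ i j, i < j → j < k → e i ≠ e j)
    (hadj : ∀ i, i + 1 < k → ∃ x, x ∈ e i ∧ x ∈ e (i + 1)) : ContainsCaterpillar T k := by
  rcases Nat.eq_zero_or_pos k with rfl | hk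
  · obtain ⟨v⟩ := hT.connected.nonempty
    refine ⟨T.singletonSubgraph v, ⟨IsTree.coe_singletonSubgraph T v, 1, ?_⟩, by simp⟩
    have hz : ∀ x, ((T.singletonSubgraph v).coe.neighborSet x).encard ≠ 1 := by
      intro x hx
      obtain ⟨y, hy⟩ := Set.encard_eq_one.1 hx
      have : y ∈ (T.singletonSubgraph v).coe.neighborSet x := by rw [hy]; rfl
      exact this
    have : Unique {x | ((T.singletonSubgraph v).coe.neighborSet x).encard ≠ 1} :=
      ⟨⟨⟨⟨v, rfl⟩, hz _⟩⟩, fun x => Subtype.ext (Subtype.ext x.1.2)⟩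
    refine ⟨Equiv.ofUnique _ _, ?_⟩
    intro x y
    obtain rfl : x = y := Subsingleton.elim _ _
    simp
  have hE : {f | ∃ i < k, e i = f} ⊆ T.edgeSet := by
    rintro _ ⟨i, hi, rfl⟩
    exact hmem i hi
  have hcard : {f | ∃ i < k, e i = f}.encard = k := by
    have : {f | ∃ i < k, e i = f} = (Finset.range k : Set ℕ).image e := by
      ext f
      simp
    rw [this, Set.InjOn.encard_image, Set.encard_coe_eq_coe_finsetCard, Finset.card_range]
    intro i hi j hj hij
    simp only [Finset.coe_range, Set.mem_Iio] at hi hj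
    by_contra hne
    rcases lt_or_gt_of_ne hne with h | h
    · exact hinj i j h hj hij
    · exact hinj j i h hi hij.symm
  refine ⟨T.subgraphOfEdges _ hE, ⟨⟨?_, hT.isAcyclic.subgraph _⟩, ?_⟩, by
    rw [edgeSet_subgraphOfEdges, hcard]⟩
  · -- all ends of the edges are connected to the ends of `e 0`
    set H := T.subgraphOfEdges _ hE with hH
    have hv : ∀ i, i < k → ∀ v, v ∈ e i → v ∈ H.verts := fun i hi v hv => ⟨e i, ⟨i, hi, rfl⟩, hv⟩
    have hsame : ∀ i (hi : i < k) v w (h : v ∈ e i) (h' : w ∈ e i),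
        H.coe.Reachable ⟨v, hv i hi v h⟩ ⟨w, hv i hi w h'⟩ := by
      intro i hi v w h h'
      by_cases hvw : v = w
      · subst hvw
        rfl
      · refine Adj.reachable (?_ : H.Adj v w)
        exact ⟨i, hi, ((Sym2.mem_and_mem_iff hvw).1 ⟨h, h'⟩)⟩
    obtain ⟨o, ho⟩ : ∃ o, o ∈ e 0 := by
      induction e 0 with
      | _ x y => exact ⟨x, Sym2.mem_mk_left _ _⟩
    have hreach : ∀ i (hi : i < k) v (h : v ∈ e i),
        H.coe.Reachable ⟨o, hv 0 hk o ho⟩ ⟨v, hv i hi v h⟩ := by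
      intro i
      induction i with
      | zero => exact fun hi v h => hsame 0 hk o v ho h
      | succ i ih =>
        intro hi v h
        obtain ⟨x, hx, hx'⟩ := hadj i hi
        exact (ih (by omega) x hx).trans (hsame (i + 1) hi x v hx' h)
    have : Nonempty H.verts := ⟨⟨o, hv 0 hk o ho⟩⟩
    refine ⟨fun x y => ?_⟩
    obtain ⟨x, _, ⟨i, hi, rfl⟩, hx⟩ := x
    obtain ⟨y, _, ⟨j, hj, rfl⟩, hy⟩ := y
    exact (hreach i hi x hx).symm.trans (hreach j hj y hy)
  · rcases Nat.lt_or_ge k 2 with hk2 | hk2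
    · obtain rfl : k = 1 := by omega
      refine ⟨0, ?_⟩
      have : IsEmpty {x | ((T.subgraphOfEdges _ hE).coe.neighborSet x).encard ≠ 1} := by
        refine ⟨fun x => x.2 ?_⟩
        obtain ⟨x, hx'⟩ := x
        obtain ⟨x, _, ⟨i, hi, rfl⟩, y, hx⟩ := x
        refine neighborSet_coe_encard_eq_one (y := y) ⟨i, hi, hx⟩ ?_
        rintro z ⟨j, hj, hz⟩
        obtain rfl : i = j := by omega
        exact (Sym2.congr_right.1 (hx.symm.trans hz)).symm
      exact ⟨Equiv.equivOfIsEmpty _ _, fun {x} => isEmptyElim x⟩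
    · obtain ⟨a, b, u, w, hw, -, -, hedges, hcover, htwo⟩ :=
        exists_spine hT.isAcyclic hk2 hmem hinj hadj
      refine ⟨_, nonempty_iso_pathGraph hT.isAcyclic hw ?_ ?_ ?_ ?_⟩
      · intro f hf
        rw [edgeSet_subgraphOfEdges]
        exact hedges f hf
      · rintro x ⟨f, hf, y, rfl⟩
        exact ⟨y, hf⟩
      · rintro x y ⟨i, hi, hxy⟩
        obtain ⟨z, hz, hz'⟩ := hcover i hi
        rw [hxy, Sym2.mem_iff] at hz'
        rcases hz' with rfl | rfl
        · exact Or.inl hz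
        · exact Or.inr hz
      · intro x hx
        obtain ⟨i, j, hij, hj, ⟨y, hy⟩, z, hz⟩ := htwo x hx
        refine ⟨y, z, ?_, ⟨i, by omega, hy⟩, j, hj, hz⟩
        rintro rfl
        exact hinj i j hij hj (hy.trans hz.symm)

end SimpleGraph

/-! ### Realizing a tree by segments in convex position -/

theorem exists_gap (s : Finset ℝ) (t : ℝ) : ∃ δ > 0, ∀ x ∈ s, t < x → t + δ < x := by
  induction s using Finset.induction_on with
  | empty => exact ⟨1, one_pos, by simp⟩
  | insert a s _ ih =>
    obtain ⟨δ, hδ, h⟩ := ih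
    rcases le_or_gt a t with ha | ha
    · refine ⟨δ, hδ, fun x hx htx => ?_⟩
      rcases Finset.mem_insert.1 hx with rfl | hx
      · exact absurd htx ha.not_gt
      · exact h x hx htx
    · refine ⟨min δ ((a - t) / 2), lt_min hδ (by linarith), fun x hx htx => ?_⟩
      have h1 := min_le_left δ ((a - t) / 2)
      have h2 := min_le_right δ ((a - t) / 2)
      rcases Finset.mem_insert.1 hx with rfl | hx
      · linarith
      · have := h x hx htx
        linarith

/-- The point `x` lies strictly between the ends of the `i`-th interval. -/
def Inside (P : ℕ → Bool → ℝ) (i : ℕ) (x : ℝ) : Prop := P i false < x ∧ x < P i true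

/-- A drawing, by nested or disjoint intervals on a line, of the rooted tree with vertices
`0, …, n` in which `par i` is the parent of `i`: the interval of `i` represents the edge from `i` to
its parent, the complement of all intervals splits into faces, and the point `τ v` lies in the face
that represents the vertex `v`. Points that are not separated by any interval, except the
intervals of which they are ends, belong to incident edges and vertices. -/
structure IsIntervalDrawing (par : ℕ → ℕ) (n : ℕ) (P : ℕ → Bool → ℝ) (τ : ℕ → ℝ) : Prop where
  lt : ∀ i, 1 ≤ i → i ≤ n → P i false < P i true
  ne : ∀ i j b c, 1 ≤ i → i ≤ n → 1 ≤ j → j ≤ n → i ≠ j → P i b ≠ P j c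
  ne' : ∀ v i b, v ≤ n → 1 ≤ i → i ≤ n → τ v ≠ P i b
  noncrossing : ∀ i j, 1 ≤ i → i ≤ n → 1 ≤ j → j ≤ n → i ≠ j →
    (Inside P i (P j false) ↔ Inside P i (P j true))
  vertex_edge : ∀ v j b, v ≤ n → 1 ≤ j → j ≤ n →
    (∀ i, 1 ≤ i → i ≤ n → i ≠ j → (Inside P i (τ v) ↔ Inside P i (P j b))) → v = j ∨ v = par j
  edge_edge : ∀ j j' b b', 1 ≤ j → j ≤ n → 1 ≤ j' → j' ≤ n → j ≠ j' →
    (∀ i, 1 ≤ i → i ≤ n → i ≠ j → i ≠ j' → (Inside P i (P j b) ↔ Inside P i (P j' b'))) →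
    ∃ v, (v = j ∨ v = par j) ∧ (v = j' ∨ v = par j')
  vertex_vertex : ∀ v v', v ≤ n → v' ≤ n →
    (∀ i, 1 ≤ i → i ≤ n → (Inside P i (τ v) ↔ Inside P i (τ v'))) → v = v'

/-- Every rooted tree has an interval drawing: a new leaf is drawn by a short interval next to the
point that represents its parent. -/
theorem exists_isIntervalDrawing (par : ℕ → ℕ) (n : ℕ) (hpar : ∀ i, 1 ≤ i → i ≤ n → par i < i) :
    ∃ P τ, IsIntervalDrawing par n P τ := by
  induction n with
  | zero =>
    refine ⟨fun _ _ => 0, fun _ => 0, ?_, ?_, ?_, ?_, ?_, ?_, ?_⟩ <;> intros <;> omega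
  | succ n ih =>
    obtain ⟨P, τ, h⟩ := ih fun i hi hi' => hpar i hi (by omega)
    have hy : par (n + 1) ≤ n := Nat.lt_succ_iff.1 (hpar (n + 1) (by omega) le_rfl)
    set t := τ (par (n + 1)) with ht
    obtain ⟨δ, hδ, hgap⟩ := exists_gap
      (((Finset.range (n + 1) ×ˢ Finset.univ).image fun p : ℕ × Bool => P p.1 p.2) ∪
        (Finset.range (n + 1)).image τ) t
    have hgapP : ∀ i b, i ≤ n → t < P i b → t + δ < P i b := fun i b hi hlt =>
      hgap _ (Finset.mem_union_left _ (Finset.mem_image.2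
        ⟨(i, b), by simp only [Finset.mem_product, Finset.mem_range, Finset.mem_univ, and_true]; omega,
          rfl⟩)) hlt
    have hgapτ : ∀ v, v ≤ n → t < τ v → t + δ < τ v := fun v hv hlt =>
      hgap _ (Finset.mem_union_right _ (Finset.mem_image.2
        ⟨v, by simp only [Finset.mem_range]; omega, rfl⟩)) hlt
    let P' : ℕ → Bool → ℝ := fun i b =>
      if i = n + 1 then (if b then t + 3 * (δ / 4) else t + δ / 4) else P i b
    let τ' : ℕ → ℝ := fun v => if v = n + 1 then t + 2 * (δ / 4) else τ v
    have hP : ∀ i b, i ≤ n → P' i b = P i b := fun i b hi => if_neg (by omega)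
    have hPf : P' (n + 1) false = t + δ / 4 := by simp [P']
    have hPt : P' (n + 1) true = t + 3 * (δ / 4) := by simp [P']
    have hτ : ∀ v, v ≤ n → τ' v = τ v := fun v hv => if_neg (by omega)
    have hτn : τ' (n + 1) = t + 2 * (δ / 4) := by simp [τ']
    have hin : ∀ i x, i ≤ n → (Inside P' i x ↔ Inside P i x) := fun i x hi => by
      simp only [Inside, hP i _ hi]
    have hnew : ∀ b, t < P' (n + 1) b ∧ P' (n + 1) b < t + δ := by
      intro b
      cases b
      · rw [hPf]; constructor <;> linarith
      · rw [hPt]; constructor <;> linarith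
    have hnear : ∀ i x, 1 ≤ i → i ≤ n → t < x → x < t + δ →
        (Inside P' i x ↔ Inside P i t) := by
      intro i x hi hi' htx hxt
      rw [hin i x hi']
      have h1 := h.ne' _ i false hy hi hi'
      have h2 := h.ne' _ i true hy hi hi'
      constructor
      · rintro ⟨h3, h4⟩
        refine ⟨?_, by linarith⟩
        by_contra hcon
        have := hgapP i false hi' (lt_of_le_of_ne (not_lt.1 hcon) h1)
        linarith
      · rintro ⟨h3, h4⟩
        have := hgapP i true hi' h4
        exact ⟨by linarith, by linarith⟩
    have hfarP : ∀ i b, 1 ≤ i → i ≤ n → ¬ Inside P' (n + 1) (P' i b) := by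
      rintro i b hi hi' ⟨h1, h2⟩
      rw [hP i b hi'] at h1 h2
      rw [hPf] at h1
      rw [hPt] at h2
      have := hgapP i b hi' (by linarith)
      linarith
    have hfarτ : ∀ v, v ≤ n → ¬ Inside P' (n + 1) (τ' v) := by
      rintro v hv ⟨h1, h2⟩
      rw [hτ v hv] at h1 h2
      rw [hPf] at h1
      rw [hPt] at h2
      have := hgapτ v hv (by linarith)
      linarith
    have hclose : Inside P' (n + 1) (τ' (n + 1)) := by
      rw [Inside, hPf, hPt, hτn]
      constructor <;> linarith
    -- what sees a new end also sees the point of the parent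
    have hsee : ∀ j b x, 1 ≤ j → j ≤ n → (∀ i, 1 ≤ i → i ≤ n → i ≠ j →
        (Inside P' i (P' (n + 1) x) ↔ Inside P' i (P' j b))) →
        par (n + 1) = j ∨ par (n + 1) = par j := by
      intro j b x hj hj' H
      refine h.vertex_edge _ j b hy hj hj' fun i hi hi' hij => ?_
      rw [← ht, ← hnear i _ hi hi' (hnew x).1 (hnew x).2, H i hi hi' hij, hin i _ hi', hP j b hj']
    refine ⟨P', τ', ?_, ?_, ?_, ?_, ?_, ?_, ?_⟩
    · intro i hi hi'
      rcases Nat.lt_or_ge n i with hn | hn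
      · obtain rfl : i = n + 1 := by omega
        rw [hPf, hPt]
        linarith
      · rw [hP i _ hn, hP i _ hn]
        exact h.lt i hi hn
    · have key : ∀ i b c, 1 ≤ i → i ≤ n → P' i b ≠ P' (n + 1) c := by
        intro i b c hi hi' he
        have h1 := hnew c
        rw [← he, hP i b hi'] at h1
        have := hgapP i b hi' h1.1
        linarith
      intro i j b c hi hi' hj hj' hij
      rcases Nat.lt_or_ge n i with hn | hn <;> rcases Nat.lt_or_ge n j with hm | hm
      · omega
      · obtain rfl : i = n + 1 := by omega
        exact (key j c b hj hm).symm
      · obtain rfl : j = n + 1 := by omega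
        exact key i b c hi hn
      · rw [hP i _ hn, hP j _ hm]
        exact h.ne i j b c hi hn hj hm hij
    · intro v i b hv hi hi'
      rcases Nat.lt_or_ge n v with hn | hn <;> rcases Nat.lt_or_ge n i with hm | hm
      · obtain rfl : v = n + 1 := by omega
        obtain rfl : i = n + 1 := by omega
        rw [hτn]
        cases b
        · rw [hPf]; intro he; linarith
        · rw [hPt]; intro he; linarith
      · obtain rfl : v = n + 1 := by omega
        rw [hτn, hP i b hm]
        intro he
        have := hgapP i b hm (by linarith)
        linarith
      · obtain rfl : i = n + 1 := by omega
        rw [hτ v hn]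
        intro he
        have h1 := hnew b
        rw [← he] at h1
        have := hgapτ v hn h1.1
        linarith
      · rw [hτ v hn, hP i b hm]
        exact h.ne' v i b hn hi hm
    · intro i j hi hi' hj hj' hij
      rcases Nat.lt_or_ge n i with hn | hn <;> rcases Nat.lt_or_ge n j with hm | hm
      · omega
      · obtain rfl : i = n + 1 := by omega
        exact iff_of_false (hfarP j _ hj hm) (hfarP j _ hj hm)
      · obtain rfl : j = n + 1 := by omega
        rw [hnear i _ hi hn (hnew _).1 (hnew _).2, hnear i _ hi hn (hnew _).1 (hnew _).2]
      · rw [hin i _ hn, hin i _ hn, hP j _ hm, hP j _ hm]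
        exact h.noncrossing i j hi hn hj hm hij
    · intro v j b hv hj hj' H
      rcases Nat.lt_or_ge n v with hn | hn <;> rcases Nat.lt_or_ge n j with hm | hm
      · omega
      · obtain rfl : v = n + 1 := by omega
        exact absurd ((H (n + 1) (by omega) le_rfl (by omega)).1 hclose) (hfarP j b hj hm)
      · obtain rfl : j = n + 1 := by omega
        refine Or.inr (h.vertex_vertex v _ hn hy fun i hi hi' => ?_)
        rw [← ht, ← hnear i _ hi hi' (hnew b).1 (hnew b).2, ← H i hi (by omega) (by omega),
          hin i _ hi', hτ v hn]
      · refine h.vertex_edge v j b hn hj hm fun i hi hi' hij => ?_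
        rw [← hτ v hn, ← hP j b hm, ← hin i _ hi', ← hin i _ hi']
        exact H i hi (by omega) hij
    · intro j j' b b' hj hj' hk hk' hjk H
      rcases Nat.lt_or_ge n j with hn | hn <;> rcases Nat.lt_or_ge n j' with hm | hm
      · omega
      · obtain rfl : j = n + 1 := by omega
        exact ⟨_, Or.inr rfl, hsee j' b' b hk hm fun i hi hi' hij =>
          H i hi (by omega) (by omega) hij⟩
      · obtain rfl : j' = n + 1 := by omega
        exact ⟨_, hsee j b b' hj hn fun i hi hi' hij =>
          (H i hi (by omega) hij (by omega)).symm, Or.inr rfl⟩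
      · refine h.edge_edge j j' b b' hj hn hk hm hjk fun i hi hi' h1 h2 => ?_
        rw [← hP j b hn, ← hP j' b' hm, ← hin i _ hi', ← hin i _ hi']
        exact H i hi (by omega) h1 h2
    · intro v v' hv hv' H
      rcases Nat.lt_or_ge n v with hn | hn <;> rcases Nat.lt_or_ge n v' with hm | hm
      · omega
      · obtain rfl : v = n + 1 := by omega
        exact absurd ((H (n + 1) (by omega) le_rfl).1 hclose) (hfarτ v' hm)
      · obtain rfl : v' = n + 1 := by omega
        exact absurd ((H (n + 1) (by omega) le_rfl).2 hclose) (hfarτ v hn)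
      · refine h.vertex_vertex v v' hn hm fun i hi hi' => ?_
        rw [← hτ v hn, ← hτ v' hm, ← hin i _ hi', ← hin i _ hi']
        exact H i hi (by omega)

/-- The vertices of a tree with `n` edges can be numbered such that every vertex but the first one
is adjacent to an earlier one. -/
theorem SimpleGraph.IsTree.exists_numbering {V : Type} {T : SimpleGraph V} (hT : T.IsTree) {n : ℕ}
    (hn : T.edgeSet.encard = n) : ∃ (f : ℕ → V) (par : ℕ → ℕ),
      (∀ i j, i ≤ n → j ≤ n → f i = f j → i = j) ∧
      ∀ i, 1 ≤ i → i ≤ n → par i < i ∧ T.Adj (f i) (f (par i)) := by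
  suffices H : ∀ m ≤ n, ∃ (f : ℕ → V) (par : ℕ → ℕ),
      (∀ i j, i ≤ m → j ≤ m → f i = f j → i = j) ∧
      ∀ i, 1 ≤ i → i ≤ m → par i < i ∧ T.Adj (f i) (f (par i)) from H n le_rfl
  intro m
  induction m with
  | zero =>
    intro _
    obtain ⟨v⟩ := hT.connected.nonempty
    exact ⟨fun _ => v, fun _ => 0, by intros; omega, by intros; omega⟩
  | succ m ih =>
    intro hm
    obtain ⟨f, par, hf, hpar⟩ := ih (by omega)
    have hinj : Set.InjOn f (Finset.range (m + 1) : Set ℕ) := by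
      intro i hi j hj hij
      simp only [Finset.coe_range, Set.mem_Iio] at hi hj
      exact hf i j (by omega) (by omega) hij
    obtain ⟨x, hx⟩ : ∃ x, x ∉ f '' (Finset.range (m + 1) : Set ℕ) := by
      by_contra hcon
      push Not at hcon
      have huniv : f '' (Finset.range (m + 1) : Set ℕ) = Set.univ := Set.eq_univ_of_forall hcon
      have hfin : (Set.univ : Set V).Finite := by
        rw [← huniv]
        exact (Finset.finite_toSet _).image f
      have hV : Finite V := Set.finite_univ_iff.1 hfin
      have hcard : Nat.card V = m + 1 := by
        rw [← Set.ncard_univ, ← huniv, Set.InjOn.ncard_image hinj, Set.ncard_coe_finset,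
          Finset.card_range]
      have h1 := (SimpleGraph.isTree_iff_connected_and_card.1 hT).2
      have h2 : Nat.card T.edgeSet = n := by
        rw [Nat.card_coe_set_eq, Set.ncard, hn]
        rfl
      omega
    obtain ⟨w⟩ := hT.connected.preconnected (f 0) x
    obtain ⟨d, -, hd, hd'⟩ := w.exists_boundary_dart (f '' (Finset.range (m + 1) : Set ℕ))
      ⟨0, by simp, rfl⟩ hx
    obtain ⟨p, hp, hpd⟩ := hd
    simp only [Finset.coe_range, Set.mem_Iio] at hp
    have hne : ∀ i, i ≤ m → f i ≠ d.snd := fun i hi he =>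
      hd' ⟨i, by simp only [Finset.coe_range, Set.mem_Iio]; omega, he⟩
    refine ⟨Function.update f (m + 1) d.snd, Function.update par (m + 1) p, ?_, ?_⟩
    · intro i j hi hj hij
      rcases Nat.lt_or_ge m i with h1 | h1 <;> rcases Nat.lt_or_ge m j with h2 | h2
      · omega
      · obtain rfl : i = m + 1 := by omega
        rw [Function.update_self, Function.update_of_ne (by omega)] at hij
        exact absurd hij.symm (hne j h2)
      · obtain rfl : j = m + 1 := by omega
        rw [Function.update_self, Function.update_of_ne (by omega)] at hij
        exact absurd hij (hne i h1)
      · rw [Function.update_of_ne (by omega), Function.update_of_ne (by omega)] at hij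
        exact hf i j h1 h2 hij
    · intro i hi hi'
      rcases Nat.lt_or_ge m i with h1 | h1
      · obtain rfl : i = m + 1 := by omega
        rw [Function.update_self, Function.update_self, Function.update_of_ne (by omega), hpd]
        exact ⟨hp, d.adj.symm⟩
      · have := hpar i hi h1
        rw [Function.update_of_ne (by omega), Function.update_of_ne (by omega),
          Function.update_of_ne (by omega)]
        exact this

/-- The point of the parabola `y = x ^ 2` with the given abscissa. -/
noncomputable def parabola (x : ℝ) : Plane := !₂[x, x ^ 2]

theorem orient_parabola (x y z : ℝ) :
    orient (parabola x) (parabola y) (parabola z) = (y - x) * (z - x) * (z - y) := by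
  simp only [orient, parabola]
  simp
  ring

theorem convexIndependent_parabola {ι : Type*} {Q : ι → ℝ} (hQ : Function.Injective Q) :
    ConvexIndependent ℝ fun i => parabola (Q i) := by
  intro s x hx
  by_contra hxs
  -- the tangent at the point of `x` strictly supports the other points
  have hconv : Convex ℝ {p : Plane | 0 < p 1 - 2 * Q x * p 0 + Q x ^ 2} := by
    intro p hp q hq a b ha hb hab
    simp only [Set.mem_ofPred_eq, PiLp.add_apply, PiLp.smul_apply, smul_eq_mul] at hp hq ⊢
    obtain rfl : b = 1 - a := by linarith
    have : 0 < a * (p 1 - 2 * Q x * p 0 + Q x ^ 2) +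
        (1 - a) * (q 1 - 2 * Q x * q 0 + Q x ^ 2) := by
      rcases ha.eq_or_lt with rfl | ha
      · simpa using hq
      · have := mul_pos ha hp
        have := mul_nonneg hb hq.le
        linarith
    linarith
  have hsub : (fun i => parabola (Q i)) '' s ⊆
      {p : Plane | 0 < p 1 - 2 * Q x * p 0 + Q x ^ 2} := by
    rintro _ ⟨y, hy, rfl⟩
    have hne : Q y - Q x ≠ 0 := sub_ne_zero.2 fun h => hxs (hQ h ▸ hy)
    have := pow_pos (abs_pos.2 hne) 2
    rw [sq_abs] at this
    simp only [parabola, Set.mem_ofPred_eq]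
    simp
    linarith
  have := convexHull_min hsub hconv hx
  simp only [parabola, Set.mem_ofPred_eq] at this
  simp at this
  linarith

theorem not_disjoint_segment_parabola {a b c d : ℝ} (hab : a < b) (hbc : b < c) (hcd : c < d) :
    ¬ Disjoint (segment ℝ (parabola a) (parabola c)) (segment ℝ (parabola b) (parabola d)) := by
  refine not_disjoint_segment_of_orient ?_ ?_ ?_ ?_ <;> rw [orient_parabola] <;>
    refine mul_pos (mul_pos ?_ ?_) ?_ <;> linarith

/-- A segment between points of the parabola that is disjoint from the segment of an interval
joins points on the same side of the interval. -/
theorem inside_iff_inside_of_disjoint {P : ℕ → Bool → ℝ} {i : ℕ} {p q : ℝ}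
    (hpq : Disjoint (segment ℝ (parabola p) (parabola q))
      (segment ℝ (parabola (P i false)) (parabola (P i true))))
    (hp : ∀ b, p ≠ P i b) (hq : ∀ b, q ≠ P i b) : Inside P i p ↔ Inside P i q := by
  have key : ∀ p q, Disjoint (segment ℝ (parabola p) (parabola q))
      (segment ℝ (parabola (P i false)) (parabola (P i true))) →
      (∀ b, q ≠ P i b) → Inside P i p → Inside P i q := by
    rintro p q hpq hq ⟨h1, h2⟩
    by_contra hcon
    rcases lt_or_gt_of_ne (hq false) with h3 | h3
    · exact not_disjoint_segment_parabola h3 h1 h2 (by rwa [segment_symm ℝ (parabola q)])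
    · have h4 : P i true < q :=
        lt_of_le_of_ne (not_lt.1 fun h4 => hcon ⟨h3, h4⟩) (hq true).symm
      exact not_disjoint_segment_parabola h1 h2 h4 hpq.symm
  exact ⟨key p q hpq hq, key q p (by rwa [segment_symm]) hp⟩

theorem chainEdge_eq_famSegment {n : ℕ} {S : Fin n × Bool → Plane} {v : ℕ → Plane} {i : ℕ}
    {j : Fin n} (h : EdgeIsSegment S v i j) : chainEdge v i = famSegment S j := by
  rcases Sym2.eq_iff.1 h with ⟨h1, h2⟩ | ⟨h1, h2⟩
  · rw [chainEdge, famSegment, h1, h2]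
  · rw [chainEdge, famSegment, h1, h2, segment_symm]

/-- A compatible alternating path yields a sequence of distinct segments such that consecutive ones
are joined by a segment disjoint from all other segments. -/
theorem AdmitsCompatiblePath.exists_segments {n : ℕ} {S : Fin n × Bool → Plane}
    (hS : IsDisjointConvexFamily S) {k : ℕ} (h : AdmitsCompatiblePath S k) :
    ∃ j : Fin k → Fin n, Function.Injective j ∧
      ∀ t (ht : t + 1 < k), ∃ b b', ∀ l, l ≠ j ⟨t, by omega⟩ → l ≠ j ⟨t + 1, ht⟩ →
        Disjoint (segment ℝ (S (j ⟨t, by omega⟩, b)) (S (j ⟨t + 1, ht⟩, b')))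
          (famSegment S l) := by
  obtain ⟨v, m, r, ⟨⟨-, hconsec, hdisj⟩, hr, halt⟩, hcomp, hcard⟩ := h
  have hlt : ∀ t < k, r + 2 * t < m := by
    have himage : ((Finset.range m).filter fun i => i % 2 = r) =
        (Finset.range ((m + 1 - r) / 2)).image fun t => r + 2 * t := by
      ext i
      simp only [Finset.mem_filter, Finset.mem_range, Finset.mem_image]
      constructor
      · rintro ⟨h1, h2⟩
        exact ⟨(i - r) / 2, by omega, by omega⟩
      · rintro ⟨t, h1, rfl⟩
        omega
    rw [himage, Finset.card_image_of_injective _ fun a b hab => by omega,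
      Finset.card_range] at hcard
    intro t ht
    omega
  have hex : ∀ t : Fin k, ∃ j, EdgeIsSegment S v (r + 2 * t) j := fun t =>
    halt _ (hlt t t.2) (by omega)
  choose j hj using hex
  have hne : ∀ t t' : Fin k, t < t' → j t ≠ j t' := by
    intro t t' htt' he
    have htt'' : (t : ℕ) < t' := htt'
    have h1 := chainEdge_eq_famSegment (hj t')
    have h2 := chainEdge_eq_famSegment (hj t)
    have h3 := hdisj (r + 2 * t) (r + 2 * t') (by omega) (hlt t' t'.2)
    rw [h1, h2, he, disjoint_self] at h3
    have : S (j t', false) ∈ famSegment S (j t') := left_mem_segment ℝ _ _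
    rw [h3] at this
    exact this
  refine ⟨j, fun t t' he => ?_, fun t ht => ?_⟩
  · rcases lt_trichotomy t t' with h | h | h
    · exact absurd he (hne _ _ h)
    · exact h
    · exact absurd he.symm (hne _ _ h)
  have hedge : ∀ i l, EdgeIsSegment S v i l →
      (∃ b, v i = S (l, b)) ∧ ∃ b, v (i + 1) = S (l, b) := by
    intro i l h
    rcases Sym2.eq_iff.1 h with ⟨h1, h2⟩ | ⟨h1, h2⟩
    · exact ⟨⟨_, h1⟩, _, h2⟩
    · exact ⟨⟨_, h1⟩, _, h2⟩
  obtain ⟨b, hb⟩ := (hedge _ _ (hj ⟨t, by omega⟩)).2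
  obtain ⟨b', hb'⟩ := (hedge _ _ (hj ⟨t + 1, ht⟩)).1
  refine ⟨b, b', fun l hla hlc => ?_⟩
  have hlen := hlt (t + 1) ht
  have hE : segment ℝ (S (j ⟨t, by omega⟩, b)) (S (j ⟨t + 1, ht⟩, b')) =
      chainEdge v (r + 2 * t + 1) := by
    rw [← hb, ← hb']
    rfl
  rw [hE]
  by_cases hin : ∃ i < m, EdgeIsSegment S v i l
  · obtain ⟨i, hi, hil⟩ := hin
    rw [← chainEdge_eq_famSegment hil]
    rcases (show i + 1 < r + 2 * t + 1 ∨ i = r + 2 * t ∨ i = r + 2 * t + 1 ∨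
        i = r + 2 * (t + 1) ∨ r + 2 * t + 1 + 1 < i by omega) with h | h | h | h | h
    · exact (hdisj _ _ h (by omega)).symm
    · -- the edge would share an end with the segment before it
      obtain ⟨b'', hb''⟩ := (hedge _ _ hil).2
      rw [h, hb] at hb''
      exact absurd (congrArg Prod.fst (hS.2.injective hb'')).symm hla
    · obtain ⟨b'', hb''⟩ := (hedge _ _ hil).1
      rw [h, hb] at hb''
      exact absurd (congrArg Prod.fst (hS.2.injective hb'')).symm hla
    · obtain ⟨b'', hb''⟩ := (hedge _ _ hil).1
      rw [h, hb'] at hb''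
      exact absurd (congrArg Prod.fst (hS.2.injective hb'')).symm hlc
    · exact hdisj _ _ h hi
  · push Not at hin
    exact hcomp l hin _ (by omega)

/-- Every tree is dual to a family of segments in convex position: the compatible alternating paths
of this family trace caterpillars in the tree. -/
theorem SimpleGraph.IsTree.exists_family {V : Type} {T : SimpleGraph V} (hT : T.IsTree) {n : ℕ}
    (hn : T.edgeSet.encard = n) : ∃ S : Fin n × Bool → Plane, IsDisjointConvexFamily S ∧
      ∀ k, AdmitsCompatiblePath S k → ContainsCaterpillar T k := by
  obtain ⟨f, par, hf, hpar⟩ := hT.exists_numbering hn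
  obtain ⟨P, τ, hP⟩ := exists_isIntervalDrawing par n fun i hi hi' => (hpar i hi hi').1
  let S : Fin n × Bool → Plane := fun x => parabola (P (x.1 + 1) x.2)
  have hinj : Function.Injective fun x : Fin n × Bool => P (x.1 + 1) x.2 := by
    rintro ⟨i, b⟩ ⟨j, c⟩ hij
    dsimp only at hij
    by_cases h : i = j
    · subst h
      have := hP.lt (i + 1) (by omega) (by omega)
      cases b <;> cases c <;> first | rfl | (exfalso; linarith)
    · exact absurd hij (hP.ne _ _ _ _ (by omega) (by omega) (by omega) (by omega)
        (by simpa [Fin.ext_iff] using h))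
  have hS : IsDisjointConvexFamily S := by
    refine ⟨fun i j hij => ?_, convexIndependent_parabola hinj⟩
    have hij' : (i : ℕ) + 1 ≠ j + 1 := by simpa [Fin.ext_iff] using hij
    have hlt := hP.lt (i + 1) (by omega) (by omega)
    have hside : ∀ x, (∀ b, P (i + 1) b ≠ x) →
        (Inside P (i + 1) x → orient (S (i, false)) (S (i, true)) (parabola x) < 0) ∧
        (¬ Inside P (i + 1) x → 0 < orient (S (i, false)) (S (i, true)) (parabola x)) := by
      intro x hx
      simp only [S, orient_parabola, Inside]
      refine ⟨fun h => mul_neg_of_pos_of_neg (mul_pos ?_ ?_) ?_, fun h => ?_⟩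
      · linarith
      · linarith [h.1]
      · linarith [h.2]
      · rcases lt_or_gt_of_ne (hx false) with h1 | h1
        · have h2 : P (i + 1) true < x := lt_of_le_of_ne (not_lt.1 fun h2 => h ⟨h1, h2⟩) (hx true)
          exact mul_pos (mul_pos (by linarith) (by linarith)) (by linarith)
        · rw [mul_assoc]
          exact mul_pos (by linarith) (mul_pos_of_neg_of_neg (by linarith) (by linarith))
    have hne : ∀ b c, P (i + 1) b ≠ P (j + 1) c := fun b c =>
      hP.ne _ _ _ _ (by omega) (by omega) (by omega) (by omega) hij'
    have hnc := hP.noncrossing (i + 1) (j + 1) (by omega) (by omega) (by omega) (by omega) hij'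
    refine disjoint_segment_of_orient ?_
    by_cases hin : Inside P (i + 1) (P (j + 1) false)
    · exact mul_pos_of_neg_of_neg ((hside _ fun b => hne b _).1 hin)
        ((hside _ fun b => hne b _).1 (hnc.1 hin))
    · exact mul_pos ((hside _ fun b => hne b _).2 hin)
        ((hside _ fun b => hne b _).2 fun h => hin (hnc.2 h))
  refine ⟨S, hS, fun k hk => ?_⟩
  obtain ⟨j, hj, hlink⟩ := hk.exists_segments hS
  -- the edge of the tree that belongs to the `t`-th segment of the path
  let g : Fin n → Sym2 V := fun a => s(f (a + 1), f (par (a + 1)))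
  have hg : ∀ a b, g a = g b → a = b := by
    have key : ∀ a b : Fin n, a < b → g a ≠ g b := by
      intro a b hab he
      have hmem : f (b + 1) ∈ g a := he ▸ Sym2.mem_mk_left _ _
      have hab' : (a : ℕ) < b := hab
      have hp := (hpar (a + 1) (by omega) (by omega)).1
      rcases Sym2.mem_iff.1 hmem with h | h
      · have := hf _ _ (by omega) (by omega) h
        omega
      · have := hf _ _ (by omega) (by omega) h
        omega
    intro a b hab
    rcases lt_trichotomy a b with h | h | h
    · exact absurd hab (key a b h)
    · exact h
    · exact absurd hab.symm (key b a h)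
  have he : ∀ t (ht : t < k), (if h : t < k then g (j ⟨t, h⟩) else s(f 0, f 0)) =
      g (j ⟨t, ht⟩) := fun t ht => dif_pos ht
  refine hT.containsCaterpillar
    (e := fun t => if h : t < k then g (j ⟨t, h⟩) else s(f 0, f 0)) ?_ ?_ ?_
  · intro t ht
    rw [he t ht]
    exact (hpar (j ⟨t, ht⟩ + 1) (by omega) (by omega)).2
  · intro t t' htt' ht' heq
    rw [he t (by omega), he t' ht'] at heq
    have := congrArg Fin.val (hj (hg _ _ heq))
    dsimp only at this
    omega
  · intro t ht
    rw [he t (by omega), he (t + 1) ht]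
    have hne' : j ⟨t, by omega⟩ ≠ j ⟨t + 1, ht⟩ := fun heq => by
      have := congrArg Fin.val (hj heq)
      dsimp only at this
      omega
    obtain ⟨b, b', hdis⟩ := hlink t ht
    obtain ⟨v, hv, hv'⟩ := hP.edge_edge (j ⟨t, by omega⟩ + 1) (j ⟨t + 1, ht⟩ + 1) b b' (by omega) (by omega)
      (by omega) (by omega) (by simpa [Fin.ext_iff] using hne') fun i hi hi' h1 h2 => by
        obtain ⟨l, rfl⟩ : ∃ l : Fin n, i = l + 1 := ⟨⟨i - 1, by omega⟩, by simp; omega⟩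
        refine inside_iff_inside_of_disjoint (hdis l ?_ ?_) ?_ ?_
        · rintro rfl
          exact h1 rfl
        · rintro rfl
          exact h2 rfl
        · exact fun c => hP.ne _ _ _ _ (by omega) (by omega) (by omega) (by omega) h1.symm
        · exact fun c => hP.ne _ _ _ _ (by omega) (by omega) (by omega) (by omega) h2.symm
    refine ⟨f v, ?_, ?_⟩
    · rcases hv with rfl | rfl
      · exact Sym2.mem_mk_left _ _
      · exact Sym2.mem_mk_right _ _
    · rcases hv' with rfl | rfl
      · exact Sym2.mem_mk_left _ _
      · exact Sym2.mem_mk_right _ _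

theorem guaranteedPathSizes_subset (n : ℕ) :
    guaranteedPathSizes n ⊆ guaranteedCaterpillarSizes n := by
  intro k hk V T hT hn
  obtain ⟨S, hS, h⟩ := hT.exists_family hn
  exact h k (hk S hS)

/-! ### Extremal trees -/

namespace ExtremalTree

mutual

/-- The vertices of the extremal tree with root degree `D` and branches of height `h` are words; the
parent of a word is its tail. `remaining D h x` is the height that is available for the branch
starting at `x` (this value at the root is chosen such that the children of the root get the
height `h`). -/
def remaining (D h : ℕ) : List ℕ → ℕ
  | [] => h + D
  | _ :: x => remaining D h x - weight D h x

/-- The number of children of the word `x` in the extremal tree. -/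
def weight (D h : ℕ) : List ℕ → ℕ
  | [] => D
  | _ :: x => branchDegree (remaining D h x - weight D h x)

end

/-- The number of children of the vertices on the way from the root to `x`, without the root. -/
def depth (D h : ℕ) : List ℕ → ℕ
  | [] => 0
  | c :: x => depth D h x + weight D h (c :: x)

variable {D h : ℕ}

theorem weight_cons (c : ℕ) (x : List ℕ) :
    weight D h (c :: x) = branchDegree (remaining D h (c :: x)) := by
  rw [weight, remaining]

theorem depth_add_remaining (c : ℕ) (x : List ℕ) :
    depth D h (c :: x) + remaining D h (c :: x) = h + weight D h (c :: x) := by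
  induction x generalizing c with
  | nil => simp [depth, remaining, weight]; omega
  | cons c' x ih =>
    have h1 := ih c'
    have h2 := branchDegree_le (remaining D h (c' :: x))
    rw [← weight_cons] at h2
    rw [depth, show remaining D h (c :: c' :: x) = remaining D h (c' :: x) - weight D h (c' :: x)
      from by rw [remaining]]
    omega

theorem depth_le (x : List ℕ) : depth D h x ≤ h := by
  cases x with
  | nil => simp [depth]
  | cons c x =>
    have h1 := depth_add_remaining (D := D) (h := h) c x
    have h2 := branchDegree_le (remaining D h (c :: x))
    rw [← weight_cons] at h2
    omega

/-- A bound for the degree of `x` in the extremal tree, minus one. -/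
def excess (D h : ℕ) : List ℕ → ℕ
  | [] => D - 1
  | c :: x => weight D h (c :: x)

/-- Two words are adjacent if one of them is the tail of the other. -/
def WordAdj (x y : List ℕ) : Prop := (∃ c, x = c :: y) ∨ ∃ c, y = c :: x

theorem sum_excess_descending (x : List ℕ) (l : List (List ℕ)) (hnd : (x :: l).Nodup)
    (hc : (x :: l).IsChain WordAdj) (hl : ∀ y ∈ l.head?, ∃ c, y = c :: x) :
    ((x :: l).map (excess D h)).sum + depth D h x ≤ excess D h x + h := by
  induction l generalizing x with
  | nil => simpa using depth_le x
  | cons y l ih =>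
    obtain ⟨c, rfl⟩ := hl y (by simp)
    rw [List.isChain_cons_cons] at hc
    have := ih (c :: x) hnd.of_cons hc.2 fun z hz => by
      obtain ⟨l', rfl⟩ : ∃ l', l = z :: l' := by
        cases l with
        | nil => simp at hz
        | cons a l' =>
          obtain rfl : a = z := by simpa using hz
          exact ⟨l', rfl⟩
      rcases (List.isChain_cons_cons.1 hc.2).1 with ⟨c', hc'⟩ | ⟨c', hc'⟩
      · -- the path would return to `x`
        obtain rfl : x = z := (List.cons.inj hc').2
        simp at hnd
      · exact ⟨c', hc'⟩
    have e : excess D h (c :: x) = weight D h (c :: x) := rfl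
    rw [List.map_cons, List.sum_cons]
    rw [depth] at this
    omega

theorem excess_le_depth_add (x : List ℕ) : excess D h x ≤ depth D h x + (D - 1) := by
  cases x with
  | nil => simp [excess]
  | cons c x =>
    simp only [excess, depth]
    omega

/-- A path first climbs towards the root and then descends. -/
theorem sum_excess_le_depth_add (x : List ℕ) (l : List (List ℕ)) (hnd : (x :: l).Nodup)
    (hc : (x :: l).IsChain WordAdj) :
    ((x :: l).map (excess D h)).sum ≤ depth D h x + h + (D - 1) := by
  induction l generalizing x with
  | nil =>
    have := excess_le_depth_add (D := D) (h := h) x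
    simp
    omega
  | cons y l ih =>
    have hc' := List.isChain_cons_cons.1 hc
    rcases hc'.1 with ⟨c, rfl⟩ | ⟨c, rfl⟩
    · have := ih y hnd.of_cons hc'.2
      rw [List.map_cons, List.sum_cons, depth]
      have e : excess D h (c :: y) = weight D h (c :: y) := rfl
      omega
    · have h1 := sum_excess_descending (D := D) (h := h) x _ hnd hc (by simp)
      have h2 := excess_le_depth_add (D := D) (h := h) x
      omega

theorem sum_excess_le (l : List (List ℕ)) (hnd : l.Nodup) (hc : l.IsChain WordAdj) :
    (l.map (excess D h)).sum ≤ 2 * h + (D - 1) := by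
  cases l with
  | nil => simp
  | cons x l =>
    have h1 := sum_excess_le_depth_add (D := D) (h := h) x l hnd hc
    have h2 := depth_le (D := D) (h := h) x
    omega

/-- `A` consists of vertices of the extremal tree in the branch starting at `l`, and is closed under
taking parents. -/
def IsBranch (D h : ℕ) (l : List ℕ) (A : Finset (List ℕ)) : Prop :=
  l ∈ A ∧ (∀ x ∈ A, l <:+ x) ∧
    ∀ x ∈ A, x ≠ l → ∃ c y, x = c :: y ∧ y ∈ A ∧ c < weight D h y

theorem exists_isBranch_of_children {l : List ℕ} {M : ℕ}
    (H : ∀ c < weight D h l, ∃ A, IsBranch D h (c :: l) A ∧ A.card = M) :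
    ∃ A, IsBranch D h l A ∧ A.card = 1 + weight D h l * M := by
  choose! A hA hM using H
  have hsuff : ∀ c < weight D h l, ∀ x ∈ A c, c :: l <:+ x := fun c hc x hx => (hA c hc).2.1 x hx
  have hdisj : Set.PairwiseDisjoint (Finset.range (weight D h l) : Set ℕ) A := by
    intro c hc c' hc' hne
    simp only [Finset.coe_range, Set.mem_Iio] at hc hc'
    rw [Function.onFun, Finset.disjoint_left]
    intro x hx hx'
    have h1 := List.suffix_of_suffix_length_le (hsuff c hc x hx) (hsuff c' hc' x hx') (by simp)
    have h2 := h1.eq_of_length (by simp)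
    exact hne (List.cons.inj h2).1
  have hl : l ∉ (Finset.range (weight D h l)).biUnion A := by
    intro hmem
    obtain ⟨c, hc, hx⟩ := Finset.mem_biUnion.1 hmem
    have := (hsuff c (Finset.mem_range.1 hc) l hx).length_le
    simp at this
  refine ⟨insert l ((Finset.range (weight D h l)).biUnion A), ⟨Finset.mem_insert_self _ _, ?_, ?_⟩,
    ?_⟩
  · intro x hx
    rcases Finset.mem_insert.1 hx with rfl | hx
    · exact List.suffix_refl _
    · obtain ⟨c, hc, hx⟩ := Finset.mem_biUnion.1 hx
      exact (List.suffix_cons c l).trans (hsuff c (Finset.mem_range.1 hc) x hx)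
  · intro x hx hxl
    obtain ⟨c, hc, hx⟩ := Finset.mem_biUnion.1 ((Finset.mem_insert.1 hx).resolve_left hxl)
    by_cases hxc : x = c :: l
    · exact ⟨c, l, hxc, Finset.mem_insert_self _ _, Finset.mem_range.1 hc⟩
    · obtain ⟨c', y, rfl, hy, hc'⟩ := (hA c (Finset.mem_range.1 hc)).2.2 x hx hxc
      exact ⟨c', y, rfl, Finset.mem_insert_of_mem (Finset.mem_biUnion.2 ⟨c, hc, hy⟩), hc'⟩
  · rw [Finset.card_insert_of_notMem hl, Finset.card_biUnion fun c hc c' hc' hne =>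
        hdisj hc hc' hne,
      Finset.sum_congr rfl fun c hc => hM c (Finset.mem_range.1 hc), Finset.sum_const,
      Finset.card_range, smul_eq_mul, add_comm]

theorem exists_isBranch (m c : ℕ) (x : List ℕ) (hm : remaining D h (c :: x) = m) :
    ∃ A, IsBranch D h (c :: x) A ∧ A.card = branchSize m := by
  induction m using Nat.strong_induction_on generalizing c x with
  | _ m ih =>
    rw [branchSize_eq m, ← hm, ← weight_cons]
    refine exists_isBranch_of_children fun c' hc' => ?_
    have hpos : 0 < m := by
      have := branchDegree_le m
      rw [weight_cons, hm] at hc'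
      omega
    have := branchDegree_pos hpos
    refine ih _ ?_ c' (c :: x) (by rw [remaining])
    rw [weight_cons, hm]
    omega

theorem exists_isBranch_root (D h : ℕ) :
    ∃ A, IsBranch D h [] A ∧ A.card = 1 + D * branchSize h := by
  have := exists_isBranch_of_children (D := D) (h := h) (l := []) (M := branchSize h) fun c _ =>
    exists_isBranch h c [] (by simp [remaining, weight])
  simpa only [weight] using this

/-- A branch can be pruned, one longest word after the other, to every smaller size. -/
theorem IsBranch.exists_subset {A : Finset (List ℕ)} (hA : IsBranch D h [] A) {n : ℕ}
    (hn : n + 1 ≤ A.card) : ∃ B, IsBranch D h [] B ∧ B.card = n + 1 := by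
  obtain ⟨d, hd⟩ := Nat.exists_eq_add_of_le hn
  induction d generalizing A with
  | zero => exact ⟨A, hA, by omega⟩
  | succ d ih =>
    obtain ⟨x, hx, hmax⟩ := A.exists_max_image List.length ⟨_, hA.1⟩
    have hx0 : x ≠ [] := by
      rintro rfl
      have : A ⊆ {[]} := fun y hy => by
        have := hmax y hy
        rw [List.length_nil, Nat.le_zero, List.length_eq_zero_iff] at this
        simp [this]
      have := Finset.card_le_card this
      rw [Finset.card_singleton] at this
      omega
    have hcard := Finset.card_erase_of_mem hx
    refine ih (A := A.erase x) ⟨Finset.mem_erase.2 ⟨hx0.symm, hA.1⟩, fun y _ => List.nil_suffix,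
      fun y hy hy0 => ?_⟩ (by omega) (by omega)
    obtain ⟨c, z, rfl, hz, hc⟩ := hA.2.2 y (Finset.mem_of_mem_erase hy) hy0
    refine ⟨c, z, rfl, Finset.mem_erase.2 ⟨?_, hz⟩, hc⟩
    rintro rfl
    have := hmax _ (Finset.mem_of_mem_erase hy)
    simp at this

/-- The tree on a set of words. -/
def wordGraph (B : Finset (List ℕ)) : SimpleGraph B where
  Adj x y := WordAdj x y
  symm := ⟨fun _ _ h => Or.symm h⟩
  loopless := ⟨fun x h => by
    rcases h with ⟨c, h⟩ | ⟨c, h⟩ <;> simpa using congrArg List.length h⟩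

theorem wordGraph_connected {B : Finset (List ℕ)} (hB : IsBranch D h [] B) :
    (wordGraph B).Connected := by
  have key : ∀ (x : List ℕ) (hx : x ∈ B), (wordGraph B).Reachable ⟨x, hx⟩ ⟨[], hB.1⟩ := by
    intro x
    induction x with
    | nil => exact fun _ => SimpleGraph.Reachable.rfl
    | cons c x ih =>
      intro hx
      obtain ⟨c', y, he, hy, -⟩ := hB.2.2 _ hx (List.cons_ne_nil _ _)
      obtain ⟨-, rfl⟩ := List.cons.inj he
      exact (SimpleGraph.Adj.reachable (Or.inl ⟨c, rfl⟩)).trans (ih hy)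
  have : Nonempty B := ⟨⟨[], hB.1⟩⟩
  exact ⟨fun x y => (key x x.2).trans (key y y.2).symm⟩

theorem wordGraph_card_edgeSet {B : Finset (List ℕ)} (hB : IsBranch D h [] B) :
    Nat.card (wordGraph B).edgeSet + 1 = Nat.card B := by
  have htail : ∀ x : B, (x : List ℕ) ≠ [] → ∃ y : B, ∃ c, (x : List ℕ) = c :: y := by
    intro x hx
    obtain ⟨c, y, h1, h2, -⟩ := hB.2.2 x x.2 hx
    exact ⟨⟨y, h2⟩, c, h1⟩
  choose! t ht using htail
  let F : {x : B // (x : List ℕ) ≠ []} → (wordGraph B).edgeSet := fun x =>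
    ⟨s(x.1, t x.1), Or.inl (ht x.1 x.2)⟩
  have hF : Function.Bijective F := by
    constructor
    · intro x y hxy
      have h1 : s(x.1, t x.1) = s(y.1, t y.1) := congrArg Subtype.val hxy
      rcases Sym2.eq_iff.1 h1 with ⟨h2, -⟩ | ⟨h2, h3⟩
      · exact Subtype.ext h2
      · obtain ⟨c, hc⟩ := ht x.1 x.2
        obtain ⟨c', hc'⟩ := ht y.1 y.2
        rw [h3] at hc
        rw [← h2] at hc'
        have e1 := congrArg List.length hc
        have e2 := congrArg List.length hc'
        simp only [List.length_cons] at e1 e2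
        omega
    · rintro ⟨e, he⟩
      induction e with
      | _ x y =>
        have key : ∀ x y : B, (∃ c, (x : List ℕ) = c :: y) → ∃ z, (F z : Sym2 B) = s(x, y) := by
          rintro x y ⟨c, hc⟩
          have hx : (x : List ℕ) ≠ [] := by simp [hc]
          refine ⟨⟨x, hx⟩, ?_⟩
          obtain ⟨c', hc'⟩ := ht x hx
          have : t x = y := Subtype.ext (List.cons.inj (hc'.symm.trans hc)).2
          simp only [F, this]
        rcases he with he | he
        · obtain ⟨z, hz⟩ := key x y he
          exact ⟨z, Subtype.ext hz⟩
        · obtain ⟨z, hz⟩ := key y x he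
          exact ⟨z, Subtype.ext (hz.trans Sym2.eq_swap)⟩
  rw [← Nat.card_congr (Equiv.ofBijective F hF)]
  have h1 : Fintype.card {x : B // (x : List ℕ) ≠ []} = Fintype.card B - 1 := by
    have : ∀ x : B, (x : List ℕ) ≠ [] ↔ x ≠ ⟨[], hB.1⟩ := fun x => by
      rw [Ne, Ne, Subtype.ext_iff]
    rw [Fintype.card_congr (Equiv.subtypeEquivRight this)]
    exact Set.card_ne_eq _
  have h2 : 0 < Fintype.card B := Fintype.card_pos_iff.2 ⟨⟨[], hB.1⟩⟩
  rw [Nat.card_eq_fintype_card, Nat.card_eq_fintype_card]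
  omega

theorem wordGraph_isTree {B : Finset (List ℕ)} (hB : IsBranch D h [] B) :
    (wordGraph B).IsTree :=
  SimpleGraph.isTree_iff_connected_and_card.2 ⟨wordGraph_connected hB, wordGraph_card_edgeSet hB⟩

theorem card_le_of_wordAdj {B : Finset (List ℕ)} (hB : IsBranch D h [] B) {x : List ℕ}
    {s : Finset (List ℕ)} (hs : ∀ y ∈ s, y ∈ B ∧ WordAdj x y) : s.card ≤ excess D h x + 1 := by
  have hchild : ∀ c, c :: x ∈ B → c < weight D h x := by
    intro c hc
    obtain ⟨c', y, he, -, hlt⟩ := hB.2.2 _ hc (List.cons_ne_nil _ _)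
    obtain ⟨rfl, rfl⟩ := List.cons.inj he
    exact hlt
  have hcard : ((Finset.range (weight D h x)).image fun c => c :: x).card ≤ weight D h x :=
    Finset.card_image_le.trans_eq (Finset.card_range _)
  cases x with
  | nil =>
    have hsub : s ⊆ (Finset.range (weight D h [])).image fun c => [c] := by
      intro y hy
      obtain ⟨hyB, ⟨c, hc⟩ | ⟨c, rfl⟩⟩ := hs y hy
      · simp at hc
      · exact Finset.mem_image.2 ⟨c, Finset.mem_range.2 (hchild c hyB), rfl⟩
    have := Finset.card_le_card hsub
    rw [weight] at this hcard
    rw [excess]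
    omega
  | cons a x =>
    have hsub : s ⊆ insert x ((Finset.range (weight D h (a :: x))).image fun c => c :: a :: x) := by
      intro y hy
      obtain ⟨hyB, ⟨c, hc⟩ | ⟨c, rfl⟩⟩ := hs y hy
      · rw [(List.cons.inj hc).2]
        exact Finset.mem_insert_self _ _
      · exact Finset.mem_insert_of_mem
          (Finset.mem_image.2 ⟨c, Finset.mem_range.2 (hchild c hyB), rfl⟩)
    have := (Finset.card_le_card hsub).trans (Finset.card_insert_le _ _)
    rw [excess]
    omega

/-- In a tree with `j` edges, the sum of `deg v - 1` over all vertices is `j - 1`; the leaves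
contribute nothing, and so a caterpillar in a word graph is bounded by the excess of its spine. -/
theorem card_edges_le_of_isCaterpillar {B : Finset (List ℕ)} (hB : IsBranch D h [] B)
    {H : (wordGraph B).Subgraph} (hH : IsCaterpillar H.coe) {j : ℕ} (hj : H.edgeSet.encard = j) :
    j ≤ 2 * h + (D - 1) + 1 := by
  classical
  obtain ⟨htree, l, ⟨φ⟩⟩ := hH
  have : Fintype H.verts := Fintype.ofFinite _
  have hedges : H.coe.edgeFinset.card = j := by
    have h1 : H.coe.edgeSet.encard = j := by
      rw [← hj, ← SimpleGraph.Subgraph.image_coe_edgeSet_coe,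
        (Sym2.map.injective Subtype.val_injective).encard_image]
    rw [← SimpleGraph.coe_edgeFinset, Set.encard_coe_eq_coe_finsetCard] at h1
    exact_mod_cast h1
  have hverts := htree.card_edgeFinset
  have hdeg : ∑ v : H.verts, H.coe.degree v = 2 * j := by
    rw [← hedges]
    convert H.coe.sum_degrees_eq_twice_card_edges
  rw [hedges] at hverts
  -- the words of the spine, in the order of the path
  let w : Fin l → List ℕ := fun i => ((φ.symm i).1.1.1 : List ℕ)
  have hw : Function.Injective w := fun i i' hii' =>
    φ.symm.injective (Subtype.ext (Subtype.ext (Subtype.ext hii')))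
  have hnd : (List.ofFn w).Nodup := List.nodup_ofFn.2 hw
  have hchain : (List.ofFn w).IsChain WordAdj := by
    rw [List.isChain_iff_getElem]
    intro i hi
    rw [List.length_ofFn] at hi
    have h1 : (SimpleGraph.pathGraph l).Adj ⟨i, by omega⟩ ⟨i + 1, hi⟩ := by
      simp [SimpleGraph.pathGraph_adj]
    have h2 := φ.symm.map_adj_iff.2 h1
    have h3 : H.Adj (φ.symm ⟨i, by omega⟩).1.1 (φ.symm ⟨i + 1, hi⟩).1.1 := h2
    have h4 : WordAdj (w ⟨i, by omega⟩) (w ⟨i + 1, hi⟩) := h3.adj_sub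
    simpa using h4
  have hsum := sum_excess_le (D := D) (h := h) _ hnd hchain
  rw [List.map_ofFn, List.sum_ofFn] at hsum
  have hle : ∀ v : H.verts, H.coe.degree v ≤ excess D h (v.1.1 : List ℕ) + 1 := by
    intro v
    have h1 := card_le_of_wordAdj hB (x := (v.1.1 : List ℕ))
      (s := (H.coe.neighborFinset v).image fun u => (u.1.1 : List ℕ)) (by
        intro y hy
        obtain ⟨u, hu, rfl⟩ := Finset.mem_image.1 hy
        rw [SimpleGraph.mem_neighborFinset] at hu
        exact ⟨u.1.2, SimpleGraph.Subgraph.adj_sub _ hu⟩)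
    rwa [Finset.card_image_of_injective _ fun u u' huu' => Subtype.ext (Subtype.ext huu'),
      SimpleGraph.card_neighborFinset_eq_degree] at h1
  have hleaf : ∀ v : H.verts, (H.coe.neighborSet v).encard ≠ 1 ↔ H.coe.degree v ≠ 1 := by
    intro v
    rw [← SimpleGraph.coe_neighborFinset, Set.encard_coe_eq_coe_finsetCard,
      SimpleGraph.card_neighborFinset_eq_degree]
    norm_cast
  have h1 : ∑ v : H.verts, ((H.coe.degree v : ℤ) - 1) = j - 1 := by
    rw [Finset.sum_sub_distrib, ← Nat.cast_sum, hdeg]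
    simp only [Finset.sum_const, Finset.card_univ, nsmul_eq_mul, mul_one]
    push_cast
    omega
  have h2 : ∑ v : H.verts, ((H.coe.degree v : ℤ) - 1) =
      ∑ i : Fin l, ((H.coe.degree (φ.symm i).1 : ℤ) - 1) := by
    rw [← Finset.sum_filter_of_ne (p := fun v => H.coe.degree v ≠ 1) (fun v _ hv hv1 => by
      rw [hv1] at hv
      exact hv (by norm_num))]
    refine (Finset.sum_bij (fun i _ => (φ.symm i).1) ?_ ?_ ?_ ?_).symm
    · intro i _
      exact Finset.mem_filter.2 ⟨Finset.mem_univ _, (hleaf _).1 (φ.symm i).2⟩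
    · exact fun i _ i' _ hii' => φ.symm.injective (Subtype.ext hii')
    · intro v hv
      refine ⟨φ ⟨v, (hleaf v).2 (Finset.mem_filter.1 hv).2⟩, Finset.mem_univ _, ?_⟩
      simp
    · exact fun _ _ => rfl
  have h3 : ∑ i : Fin l, ((H.coe.degree (φ.symm i).1 : ℤ) - 1) ≤
      ∑ i : Fin l, ((excess D h (w i) : ℕ) : ℤ) := by
    refine Finset.sum_le_sum fun i _ => ?_
    have := hle (φ.symm i).1
    have e : w i = ((φ.symm i).1.1.1 : List ℕ) := rfl
    rw [e]
    omega
  have h4 : ∑ i : Fin l, ((excess D h (w i) : ℕ) : ℤ) ≤ ((2 * h + (D - 1) : ℕ) : ℤ) := by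
    rw [← Nat.cast_sum]
    exact_mod_cast hsum
  omega

end ExtremalTree

/-- Some tree with `n ≤ extremalSize k` edges contains no caterpillar with more than `k` edges. -/
theorem le_of_mem_guaranteedCaterpillarSizes {n k j : ℕ} (hn : 1 ≤ n) (hk : n ≤ extremalSize k)
    (hj : j ∈ guaranteedCaterpillarSizes n) : j ≤ k := by
  obtain ⟨D, h, rfl, he⟩ := exists_extremalSize_eq k
  obtain ⟨A, hA, hAcard⟩ := ExtremalTree.exists_isBranch_root D h
  obtain ⟨B, hB, hBcard⟩ := hA.exists_subset (n := n) (by omega)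
  have hcard := ExtremalTree.wordGraph_card_edgeSet hB
  have hencard : (ExtremalTree.wordGraph B).edgeSet.encard = n := by
    rw [Nat.card_eq_fintype_card (α := B), Fintype.card_coe, hBcard, Nat.card_coe_set_eq] at hcard
    rw [← (Set.toFinite _).cast_ncard_eq]
    norm_cast
    omega
  obtain ⟨H, hH, hHj⟩ := hj _ _ (ExtremalTree.wordGraph_isTree hB) hencard
  have := ExtremalTree.card_edges_le_of_isCaterpillar hB hH hHj
  rcases Nat.eq_zero_or_pos D with rfl | hD
  · omega
  · omega

/-! ### The values of `q` -/

theorem isGreatest_of_extremalSize {n k : ℕ} (h₁ : extremalSize k < n)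
    (h₂ : n ≤ extremalSize (k + 1)) : IsGreatest (guaranteedPathSizes n) (k + 1) ∧
      IsGreatest (guaranteedCaterpillarSizes n) (k + 1) := by
  have hpath := mem_guaranteedPathSizes h₁
  have hle : ∀ j ∈ guaranteedCaterpillarSizes n, j ≤ k + 1 := fun j hj =>
    le_of_mem_guaranteedCaterpillarSizes (by omega) h₂ hj
  exact ⟨⟨hpath, fun j hj => hle j (guaranteedPathSizes_subset n hj)⟩,
    guaranteedPathSizes_subset n hpath, hle⟩

theorem q_eq_of_extremalSize {n k : ℕ} (h₁ : extremalSize k < n)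
    (h₂ : n ≤ extremalSize (k + 1)) : q n = k + 1 :=
  (isGreatest_of_extremalSize h₁ h₂).1.csSup_eq

theorem exists_extremalSize_lt_le {n : ℕ} (hn : 1 ≤ n) :
    ∃ k, extremalSize k < n ∧ n ≤ extremalSize (k + 1) := by
  classical
  have hex : ∃ k, n ≤ extremalSize k := ⟨n, le_extremalSize n⟩
  have hspec := Nat.find_spec hex
  have hmin := fun k => Nat.find_min (H := hex) (m := k)
  have h0 : extremalSize 0 = 0 := by decide
  generalize Nat.find hex = k at hspec hmin
  cases k with
  | zero => omega
  | succ k => exact ⟨k, not_le.1 (hmin k (Nat.lt_succ_self k)), hspec⟩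

theorem isGreatest_q {n : ℕ} (hn : 1 ≤ n) : IsGreatest (guaranteedPathSizes n) (q n) ∧
    IsGreatest (guaranteedCaterpillarSizes n) (q n) := by
  obtain ⟨k, h₁, h₂⟩ := exists_extremalSize_lt_le hn
  rw [q_eq_of_extremalSize h₁ h₂]
  exact isGreatest_of_extremalSize h₁ h₂

theorem succ_le_q_iff {n k : ℕ} (hn : 1 ≤ n) : k + 1 ≤ q n ↔ extremalSize k < n := by
  obtain ⟨l, h₁, h₂⟩ := exists_extremalSize_lt_le hn
  rw [q_eq_of_extremalSize h₁ h₂]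
  constructor
  · intro h
    exact (extremalSize_mono (by omega)).trans_lt h₁
  · intro h
    by_contra hcon
    have := extremalSize_mono (show l + 1 ≤ k by omega)
    omega

/-! ### The explicit formulas -/

theorem two_mul_branchSize_add_one {h : ℕ} (hh : 5 ≤ h) (j : ℕ) :
    2 * (branchSize (h + 3 * j) : ℝ) + 1 = (2 * branchSize h + 1) * 3 ^ j := by
  induction j with
  | zero => simp
  | succ j ih =>
    rw [show h + 3 * (j + 1) = h + 3 * j + 3 by ring, branchSize_add_three (by omega), pow_succ,
      ← mul_assoc, ← ih]
    push_cast
    ring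

/-- With `c = 6 * a - 1`, the jumps of `roundedLog` are at the powers of three. -/
theorem le_floor_iff {x : ℝ} (hx : 0 < x) (a m : ℤ) :
    m ≤ ⌊(1 / 6 : ℝ) * (⌈6 * Real.logb 3 x + (6 * a - 1)⌉ : ℝ)⌋ ↔ (3 : ℝ) ^ (m - a) < x := by
  have h1 : m ≤ ⌊(1 / 6 : ℝ) * (⌈6 * Real.logb 3 x + (6 * a - 1)⌉ : ℝ)⌋ ↔
      6 * m - 1 < ⌈6 * Real.logb 3 x + (6 * a - 1)⌉ := by
    rw [Int.le_floor]
    constructor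
    · intro h
      have : ((6 * m : ℤ) : ℝ) ≤ (⌈6 * Real.logb 3 x + (6 * a - 1)⌉ : ℝ) := by
        push_cast
        linarith
      have := Int.cast_le.1 this
      omega
    · intro h
      have : 6 * m ≤ ⌈6 * Real.logb 3 x + (6 * a - 1)⌉ := by omega
      have : ((6 * m : ℤ) : ℝ) ≤ (⌈6 * Real.logb 3 x + (6 * a - 1)⌉ : ℝ) := Int.cast_le.2 this
      push_cast at this
      linarith
  rw [h1, Int.lt_ceil, ← Real.rpow_intCast, ← Real.lt_logb_iff_rpow_lt (by norm_num) hx]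
  push_cast
  constructor <;> intro h <;> linarith

theorem roundedLog_eq {n : ℕ} (hn : 1 ≤ n) {x c : ℝ} (hx : 0 < x) {a : ℤ} (hc : c = 6 * a - 1)
    {r m₀ : ℕ} (h0 : 6 * m₀ + r ≤ q n) (hr : 1 ≤ 6 * m₀ + r)
    (h : ∀ m, m₀ ≤ m → (extremalSize (6 * m + r - 1) < n ↔ (3 : ℝ) ^ ((m : ℤ) - a) < x)) :
    roundedLog x c + r = 6 * (((q n : ℤ) - r) / 6) + r := by
  subst hc
  have key : ∀ m : ℕ, m₀ ≤ m →
      ((m : ℤ) ≤ ⌊(1 / 6 : ℝ) * (⌈6 * Real.logb 3 x + (6 * a - 1)⌉ : ℝ)⌋ ↔ 6 * m + r ≤ q n) := by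
    intro m hm
    rw [le_floor_iff hx, ← h m hm, ← succ_le_q_iff hn, show 6 * m + r - 1 + 1 = 6 * m + r by omega]
  unfold roundedLog
  generalize ⌊(1 / 6 : ℝ) * (⌈6 * Real.logb 3 x + (6 * a - 1)⌉ : ℝ)⌋ = M at key ⊢
  have h1 := (key m₀ le_rfl).2 h0
  have h2 := key M.toNat (by omega)
  have h3 := key ((q n - r) / 6) (by omega)
  omega

theorem extremalSize_lt_iff_odd {n h₀ j : ℕ} (hh : 5 ≤ h₀) :
    extremalSize (2 * (h₀ + 3 * j) + 5) < n ↔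
      5 * (2 * (branchSize h₀ : ℝ) + 1) * 3 ^ j < 2 * n + 5 := by
  have h1 := two_mul_branchSize_add_one hh j
  rw [extremalSize_odd (by omega), ← Nat.cast_lt (α := ℝ), mul_assoc, ← h1]
  push_cast
  constructor <;> intro h <;> linarith

theorem extremalSize_lt_iff_even {n h₀ j : ℕ} (hh : 5 ≤ h₀) :
    extremalSize (2 * (h₀ + 3 * j) + 6) < n ↔
      3 * (2 * (branchSize h₀ : ℝ) + 1) * 3 ^ j < n + 3 := by
  have h1 := two_mul_branchSize_add_one hh j
  rw [extremalSize_even (by omega), ← Nat.cast_lt (α := ℝ), mul_assoc, ← h1]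
  push_cast
  constructor <;> intro h <;> linarith

theorem zpow_sub_eq {m j b : ℕ} {a : ℤ} (h : (m : ℤ) - a = ((b + j : ℕ) : ℤ)) :
    (3 : ℝ) ^ ((m : ℤ) - a) = 3 ^ b * 3 ^ j := by
  rw [h, zpow_natCast, pow_add]

section

variable {n : ℕ}

theorem q₀_eq (hn : 171 ≤ n) (hq : 22 ≤ q n) : q₀ n = 6 * ((q n : ℤ) / 6) := by
  have := roundedLog_eq (n := n) (x := 2 * (n : ℝ) / 55 + 1 / 11) (c := 11) (a := 2) (r := 0)
    (m₀ := 3) (by omega) (by positivity) (by norm_num) (by omega) (by omega) fun m hm => by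
      obtain ⟨j, rfl⟩ := Nat.exists_eq_add_of_le' hm
      rw [show 6 * (j + 3) + 0 - 1 = 2 * (6 + 3 * j) + 5 by omega,
        extremalSize_lt_iff_odd (by norm_num),
        zpow_sub_eq (m := j + 3) (b := 1) (j := j) (by push_cast; ring),
        show branchSize 6 = 16 from rfl]
      push_cast
      constructor <;> intro h <;> linarith
  simpa [q₀] using this

theorem q₁_eq (hn : 171 ≤ n) (hq : 22 ≤ q n) : q₁ n = 6 * (((q n : ℤ) - 1) / 6) + 1 := by
  have := roundedLog_eq (n := n) (x := (n : ℝ) / 33 + 1 / 11) (c := 11) (a := 2) (r := 1)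
    (m₀ := 3) (by omega) (by positivity) (by norm_num) (by omega) (by omega) fun m hm => by
      obtain ⟨j, rfl⟩ := Nat.exists_eq_add_of_le' hm
      rw [show 6 * (j + 3) + 1 - 1 = 2 * (6 + 3 * j) + 6 by omega,
        extremalSize_lt_iff_even (by norm_num),
        zpow_sub_eq (m := j + 3) (b := 1) (j := j) (by push_cast; ring),
        show branchSize 6 = 16 from rfl]
      push_cast
      constructor <;> intro h <;> linarith
  simpa [q₁] using this

theorem q₂_eq (hn : 171 ≤ n) (hq : 22 ≤ q n) : q₂ n = 6 * (((q n : ℤ) - 2) / 6) + 2 := by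
  have := roundedLog_eq (n := n) (x := 2 * (n : ℝ) / 235 + 1 / 47) (c := 17) (a := 3) (r := 2)
    (m₀ := 3) (by omega) (by positivity) (by norm_num) (by omega) (by omega) fun m hm => by
      obtain ⟨j, rfl⟩ := Nat.exists_eq_add_of_le' hm
      rw [show 6 * (j + 3) + 2 - 1 = 2 * (7 + 3 * j) + 5 by omega,
        extremalSize_lt_iff_odd (by norm_num),
        zpow_sub_eq (m := j + 3) (b := 0) (j := j) (by push_cast; ring),
        show branchSize 7 = 23 from rfl]
      push_cast
      constructor <;> intro h <;> linarith
  simpa [q₂] using this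

theorem q₃_eq (hn : 171 ≤ n) (hq : 22 ≤ q n) : q₃ n = 6 * (((q n : ℤ) - 3) / 6) + 3 := by
  have := roundedLog_eq (n := n) (x := (n : ℝ) / 141 + 1 / 47) (c := 17) (a := 3) (r := 3)
    (m₀ := 3) (by omega) (by positivity) (by norm_num) (by omega) (by omega) fun m hm => by
      obtain ⟨j, rfl⟩ := Nat.exists_eq_add_of_le' hm
      rw [show 6 * (j + 3) + 3 - 1 = 2 * (7 + 3 * j) + 6 by omega,
        extremalSize_lt_iff_even (by norm_num),
        zpow_sub_eq (m := j + 3) (b := 0) (j := j) (by push_cast; ring),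
        show branchSize 7 = 23 from rfl]
      push_cast
      constructor <;> intro h <;> linarith
  simpa [q₃] using this

theorem q₄_eq (hn : 171 ≤ n) (hq : 22 ≤ q n) : q₄ n = 6 * (((q n : ℤ) - 4) / 6) + 4 := by
  have := roundedLog_eq (n := n) (x := 2 * (n : ℝ) / 115 + 1 / 23) (c := 11) (a := 2) (r := 4)
    (m₀ := 2) (by omega) (by positivity) (by norm_num) (by omega) (by omega) fun m hm => by
      obtain ⟨j, rfl⟩ := Nat.exists_eq_add_of_le' hm
      rw [show 6 * (j + 2) + 4 - 1 = 2 * (5 + 3 * j) + 5 by omega,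
        extremalSize_lt_iff_odd (by norm_num),
        zpow_sub_eq (m := j + 2) (b := 0) (j := j) (by push_cast; ring),
        show branchSize 5 = 11 from rfl]
      push_cast
      constructor <;> intro h <;> linarith
  simpa [q₄] using this

theorem q₅_eq (hn : 171 ≤ n) (hq : 22 ≤ q n) : q₅ n = 6 * (((q n : ℤ) - 5) / 6) + 5 := by
  have := roundedLog_eq (n := n) (x := (n : ℝ) / 69 + 1 / 23) (c := 11) (a := 2) (r := 5)
    (m₀ := 2) (by omega) (by positivity) (by norm_num) (by omega) (by omega) fun m hm => by
      obtain ⟨j, rfl⟩ := Nat.exists_eq_add_of_le' hm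
      rw [show 6 * (j + 2) + 5 - 1 = 2 * (5 + 3 * j) + 6 by omega,
        extremalSize_lt_iff_even (by norm_num),
        zpow_sub_eq (m := j + 2) (b := 0) (j := j) (by push_cast; ring),
        show branchSize 5 = 11 from rfl]
      push_cast
      constructor <;> intro h <;> linarith
  simpa [q₅] using this

theorem q_eq_max (hn : 171 ≤ n) :
    (q n : ℤ) = max (q₀ n) (max (q₁ n) (max (q₂ n) (max (q₃ n) (max (q₄ n) (q₅ n))))) := by
  have hq : 22 ≤ q n := (succ_le_q_iff (k := 21) (by omega)).2 (by
    rw [show extremalSize 21 = 170 by decide]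
    omega)
  rw [q₀_eq hn hq, q₁_eq hn hq, q₂_eq hn hq, q₃_eq hn hq, q₄_eq hn hq, q₅_eq hn hq]
  omega

end

theorem roundedLog_le {n : ℕ} {x c : ℝ} (hx : 0 < x) (hxn : x ≤ n) :
    (roundedLog x c : ℝ) ≤ 6 * Real.logb 3 n + c + 1 := by
  have h1 := Int.floor_le ((1 / 6 : ℝ) * (⌈6 * Real.logb 3 x + c⌉ : ℝ))
  have h2 := Int.ceil_lt_add_one (6 * Real.logb 3 x + c)
  have h3 := Real.logb_le_logb_of_le (b := 3) (by norm_num) hx hxn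
  unfold roundedLog
  push_cast
  linarith

theorem le_roundedLog {x y c : ℝ} (hy : 0 < y) (hxy : y ≤ x) :
    6 * Real.logb 3 y + c - 6 ≤ (roundedLog x c : ℝ) := by
  have h1 := Int.lt_floor_add_one ((1 / 6 : ℝ) * (⌈6 * Real.logb 3 x + c⌉ : ℝ))
  have h2 := Int.le_ceil (6 * Real.logb 3 x + c)
  have h3 := Real.logb_le_logb_of_le (b := 3) (by norm_num) hy hxy
  unfold roundedLog
  push_cast
  linarith

theorem exists_abs_q_sub_le :
    ∃ C : ℝ, ∀ n : ℕ, 1 ≤ n → |(q n : ℝ) - 6 * Real.logb 3 (n : ℝ)| ≤ C := by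
  refine ⟨6 * |Real.logb 3 (2 / 55)| + 30, fun n hn => ?_⟩
  have hn' : (1 : ℝ) ≤ n := by exact_mod_cast hn
  have hC := abs_nonneg (Real.logb 3 (2 / 55))
  have hC' := neg_abs_le (Real.logb 3 (2 / 55))
  rcases Nat.lt_or_ge n 171 with h | h
  · have h1 : q n ≤ 21 := by
      by_contra hcon
      have := (succ_le_q_iff (k := 21) hn).1 (by omega)
      rw [show extremalSize 21 = 170 by decide] at this
      omega
    have h1' : (q n : ℝ) ≤ 21 := by exact_mod_cast h1
    have h2 : 0 ≤ Real.logb 3 (n : ℝ) := Real.logb_nonneg (by norm_num) hn'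
    have h3 : Real.logb 3 (n : ℝ) ≤ 5 := by
      rw [Real.logb_le_iff_le_rpow (by norm_num) (by linarith)]
      have : (n : ℝ) < 171 := by exact_mod_cast h
      norm_num
      linarith
    have h4 : (0 : ℝ) ≤ q n := Nat.cast_nonneg _
    rw [abs_le]
    constructor <;> linarith
  · have hmax := q_eq_max h
    have u0 := roundedLog_le (n := n) (x := 2 * (n : ℝ) / 55 + 1 / 11) (c := 11) (by positivity)
      (by linarith)
    have u1 := roundedLog_le (n := n) (x := (n : ℝ) / 33 + 1 / 11) (c := 11) (by positivity)
      (by linarith)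
    have u2 := roundedLog_le (n := n) (x := 2 * (n : ℝ) / 235 + 1 / 47) (c := 17) (by positivity)
      (by linarith)
    have u3 := roundedLog_le (n := n) (x := (n : ℝ) / 141 + 1 / 47) (c := 17) (by positivity)
      (by linarith)
    have u4 := roundedLog_le (n := n) (x := 2 * (n : ℝ) / 115 + 1 / 23) (c := 11) (by positivity)
      (by linarith)
    have u5 := roundedLog_le (n := n) (x := (n : ℝ) / 69 + 1 / 23) (c := 11) (by positivity)
      (by linarith)
    have l0 := le_roundedLog (x := 2 * (n : ℝ) / 55 + 1 / 11) (y := 2 / 55 * n) (c := 11)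
      (by positivity) (by linarith)
    rw [Real.logb_mul (by norm_num) (by positivity)] at l0
    have hle : (q₀ n : ℝ) ≤ q n := by
      have : q₀ n ≤ (q n : ℤ) := by omega
      exact_mod_cast this
    have hor : (q n : ℤ) = q₀ n ∨ (q n : ℤ) = q₁ n ∨ (q n : ℤ) = q₂ n ∨ (q n : ℤ) = q₃ n ∨
        (q n : ℤ) = q₄ n ∨ (q n : ℤ) = q₅ n := by omega
    have hup : (q n : ℝ) ≤ 6 * Real.logb 3 n + 30 := by
      rw [← Int.cast_natCast (R := ℝ) (q n)]
      rcases hor with e | e | e | e | e | e <;> rw [e]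
      · rw [q₀]; linarith
      · rw [q₁]; push_cast; linarith
      · rw [q₂]; push_cast; linarith
      · rw [q₃]; push_cast; linarith
      · rw [q₄]; push_cast; linarith
      · rw [q₅]; push_cast; linarith
    rw [q₀] at hle
    rw [abs_le]
    constructor <;> linarith

theorem theorem2 :
    -- the maximum in the definition of `q n` exists, for every `n ≥ 1`
    (∀ n : ℕ, 1 ≤ n → IsGreatest (guaranteedPathSizes n) (q n)) ∧
    -- the values for `1 ≤ n ≤ 170`
    (∀ n : ℕ, n ∈ Set.Icc 1 4 → q n = n) ∧
    (∀ n : ℕ, n ∈ Set.Icc 5 6 → q n = 5) ∧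
    (∀ n : ℕ, n ∈ Set.Icc 7 8 → q n = 6) ∧
    (∀ n : ℕ, n ∈ Set.Icc 9 10 → q n = 7) ∧
    (∀ n : ℕ, n ∈ Set.Icc 11 12 → q n = 8) ∧
    (∀ n : ℕ, n ∈ Set.Icc 13 15 → q n = 9) ∧
    (∀ n : ℕ, n ∈ Set.Icc 16 20 → q n = 10) ∧
    (∀ n : ℕ, n ∈ Set.Icc 21 25 → q n = 11) ∧
    (∀ n : ℕ, n ∈ Set.Icc 26 30 → q n = 12) ∧
    (∀ n : ℕ, n ∈ Set.Icc 31 35 → q n = 13) ∧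
    (∀ n : ℕ, n ∈ Set.Icc 36 44 → q n = 14) ∧
    (∀ n : ℕ, n ∈ Set.Icc 45 55 → q n = 15) ∧
    (∀ n : ℕ, n ∈ Set.Icc 56 66 → q n = 16) ∧
    (∀ n : ℕ, n ∈ Set.Icc 67 80 → q n = 17) ∧
    (∀ n : ℕ, n ∈ Set.Icc 81 96 → q n = 18) ∧
    (∀ n : ℕ, n ∈ Set.Icc 97 115 → q n = 19) ∧
    (∀ n : ℕ, n ∈ Set.Icc 116 138 → q n = 20) ∧
    (∀ n : ℕ, n ∈ Set.Icc 139 170 → q n = 21) ∧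
    -- the formula for `n ≥ 171`
    (∀ n : ℕ, 171 ≤ n →
      (q n : ℤ) = max (q₀ n) (max (q₁ n) (max (q₂ n) (max (q₃ n) (max (q₄ n) (q₅ n)))))) ∧
    -- the same number for caterpillars in trees
    (∀ n : ℕ, 1 ≤ n → IsGreatest (guaranteedCaterpillarSizes n) (q n)) ∧
    -- `q n` is `6 log₃ n` up to an additive constant
    (∃ C : ℝ, ∀ n : ℕ, 1 ≤ n → |(q n : ℝ) - 6 * Real.logb 3 (n : ℝ)| ≤ C) := by
  have table : ∀ k a b : ℕ, extremalSize k + 1 = a → extremalSize (k + 1) = b →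
      ∀ n : ℕ, n ∈ Set.Icc a b → q n = k + 1 := by
    rintro k a b rfl rfl n ⟨h₁, h₂⟩
    exact q_eq_of_extremalSize h₁ h₂
  refine ⟨fun n hn => (isGreatest_q hn).1, ?_, table 4 5 6 (by decide) (by decide),
    table 5 7 8 (by decide) (by decide), table 6 9 10 (by decide) (by decide),
    table 7 11 12 (by decide) (by decide), table 8 13 15 (by decide) (by decide),
    table 9 16 20 (by decide) (by decide), table 10 21 25 (by decide) (by decide),
    table 11 26 30 (by decide) (by decide), table 12 31 35 (by decide) (by decide),
    table 13 36 44 (by decide) (by decide), table 14 45 55 (by decide) (by decide),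
    table 15 56 66 (by decide) (by decide), table 16 67 80 (by decide) (by decide),
    table 17 81 96 (by decide) (by decide), table 18 97 115 (by decide) (by decide),
    table 19 116 138 (by decide) (by decide), table 20 139 170 (by decide) (by decide),
    fun n hn => q_eq_max hn, fun n hn => (isGreatest_q hn).2, exists_abs_q_sub_le⟩
  rintro n ⟨h₁, h₂⟩
  interval_cases n
  · exact table 0 1 1 (by decide) (by decide) 1 ⟨le_rfl, le_rfl⟩
  · exact table 1 2 2 (by decide) (by decide) 2 ⟨le_rfl, le_rfl⟩
  · exact table 2 3 3 (by decide) (by decide) 3 ⟨le_rfl, le_rfl⟩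
  · exact table 3 4 4 (by decide) (by decide) 4 ⟨le_rfl, le_rfl⟩
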